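/- **Setting.** One divisible item is sold online to $n\ge 1$ agents; $n$ is known. The type of agent $i$ is $(a_i,d_i,v_i,b_i)$: arrival and departure times $a_i\le d_i$, a value $v_i$ per unit, a budget $b_i$. On arrival agents report a type, and every component (arrival and departure included, earlier or later than the true one; values and budgets non-negative) may be misreported. Mechanisms only see reports; arrival times are distinct in truthful profiles, and ties caused by a misreport are broken by index. An agent who receives $x$ units at time $t$ and pays $p$ has utility $v_i x-p$ if $p\le b_i$ and $t\in[a_i,d_i]$, utility $-p$ if $p\le b_i$ and $t\notin[a_i,d_i]$, and $-\infty$ if $p>b_i$. Put $\bar v_i=\min\{v_i,b_i\}$. The liquid welfare of an allocation $x$ is $\sum_i\min\{v_ix_i,b_i\}$, and $OPT$ is its supremum over $x\ge 0$, $\sum_i x_i\le 1$. For the welfare guarantee an adversary fixes time frames $[a_1,d_1],\dots,[a_n,d_n]$ with $a_1<\dots<a_n$ and pairs $(v_1,b_1),\dots,(v_n,b_n)$ with all $v_i,b_i>0$; a uniformly random permutation $\pi$ gives agent $i$ the type $(a_i,d_i,v_{\pi(i)},b_{\pi(i)})$. **Ingredients.** *Clearing price* $\bar P(S)$: list $S$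 so that $v_{i_1}\ge v_{i_2}\ge\cdots$, let $k\ge 0$ be maximal with $\sum_{l\le k}b_{i_l}\le v_{i_k}$ ($k=0$ if there is none), and put $\bar P(S)=\max\{\sum_{l\le k}b_{i_l},\,v_{i_{k+1}}\}$, where $v_{i_{|S|+1}}=0$. *Greedy allocation* $\mathrm{Alloc}(S,p,q)$: go through $S$ in uniformly random order with $q$ units; an agent with $v\ge p$ gets $\min\{b/p,\text{remaining amount}\}$ (the whole remaining amount if $p=0$), other agents get nothing. **RS_Liquid.** Toss $n-1$ fair coins; $A$ consists of the first $(\#\text{tails}+1)$ agents, $j$ is the last of them, $B$ is the rest. When $j$ arrives, at time $t_0$, split $A$ into $A_1,A_2$ by independent fair coins, named so that $j\in A_2$. Compute $\mathrm{Alloc}(A_1,\bar P(A_2),\frac14)$ and $\mathrm{Alloc}(A_2,\bar P(A_1),\frac14)$; each agent of $A$ with reported departure at least $t_0$ receives her amount at time $t_0$ at that price per unit, and the other agents of $A$ receive and pay nothing. Put $m_1=m_2=\frac14$. Each $i\in B$ on arrival is put into $B_1$ (heads) or $B_2$ (tails) by a fair coin. In the first case let $x'_i$ be her amount in $\mathrm{Alloc}(A_1\cup\{i\},p,\frac14)$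 with $p=\bar P(A_2\setminus\{j\})$; she gets $x_i=\min\{x'_i,m_1\}$ at once at price $p$ per unit, and $m_1$ decreases by $x_i$. In the second case do the same with $\mathrm{Alloc}((A_2\setminus\{j\})\cup\{i\},p,\frac14)$, $p=\bar P(A_1)$ and $m_2$. **MVCG** (parameter $\gamma>1$). $A$ consists of the first $\lfloor n/2\rfloor$ agents, $B$ of the rest; $p_1$ and $p_2$ are $\gamma$ times the highest and second highest $\bar v$ in $A$ (ties broken by index; $0$ if there is no such agent). When the last agent of $A$ arrives, toss a fair coin. Heads: the agent with the highest $\bar v$ in $A$ gets the entire item at price $p_2$, provided that her $\bar v$ is at least $p_2$ and she has not departed. Tails: the first agent of $B$ with $\bar v\ge p_1$, if there is one, gets the entire item on arrival at price $p_1$. **Liquid_Div** runs MVCG with probability $\mu$ and RS_Liquid with probability $1-\mu$. **Theorem.** 1. For all $n\ge1$, $\mu\in[0,1]$ and $\gamma>1$, Liquid_Div never sells more than the item, gives a truthful agent non-negative expected utility, and is truthful: whatever the other agents report, an agent with positive budget maximizes her expected utility (over the coins of the mechanism) by reporting her true type. 2. For $\mu=1/10$ and $\gamma=1.0001$, Liquid_Div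 is a constant approximation to the optimal liquid welfare, without any large-market assumption: there is an absolute constant $C$ such that for all $n\ge 1$ and all choices of the adversary, $OPT\le C\cdot\mathbb E[\text{liquid welfare}]$, the expectation being over $\pi$ and the coins of the mechanism, under truthful reports. 3. For $n\ge 100$ and these $\mu,\gamma$, the ratio is at most $2443$: $OPT\le 2443\cdot\mathbb E[\text{liquid welfare}]$. -/

import Mathlib

open Finset

namespace BudgetedSecretary

noncomputable section

/-- The (private, or reported) type of an agent: time frame, value per unit, budget. -/
structure AgentType where
  arrival : ℝ
  departure : ℝ
  value : ℝ
  budget : ℝ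
  arrival_le_departure : arrival ≤ departure
  value_nonneg : 0 ≤ value
  budget_nonneg : 0 ≤ budget

/-- The liquid value `min {v, b}`. -/
def AgentType.liquid (τ : AgentType) : ℝ := min τ.value τ.budget

/-- What a mechanism does with one agent: she receives `amount` units at time `time` and pays
`payment`. -/
structure Outcome where
  amount : ℝ
  payment : ℝ
  time : ℝ

/-- Utility of an agent of true type `τ`: `-∞` if she pays more than her budget; otherwise value
minus payment, where units received outside the real time frame are worth nothing. -/
def utility (τ : AgentType) (o : Outcome) : EReal :=
  if τ.budget < o.payment then ⊥
  else (((if τ.arrival ≤ o.time ∧ o.time ≤ τ.departure then τ.value * o.amount else 0)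
    - o.payment : ℝ) : EReal)

/-- A randomized direct mechanism for `n` agents whose internal coins take finitely many values:
`prob` is the law of the coins, and `outcome θ ω i` is what happens to agent `i` when the reported
types are `θ` and the coins show `ω`. -/
structure Mechanism (n : ℕ) where
  Coins : Type
  [fin : Fintype Coins]
  prob : Coins → ℝ
  prob_nonneg : ∀ ω, 0 ≤ prob ω
  prob_sum : ∑ ω, prob ω = 1
  outcome : (Fin n → AgentType) → Coins → Fin n → Outcome

attribute [instance] Mechanism.fin

variable {n : ℕ}

/-! ### Properties of mechanisms -/

/-- Expected utility, over the coins of the mechanism, of agent `i` with true type `τ` when the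
reported types are `θ`. -/
def Mechanism.expectedUtility (M : Mechanism n) (τ : AgentType) (θ : Fin n → AgentType)
    (i : Fin n) : EReal :=
  ∑ ω, (M.prob ω : EReal) * utility τ (M.outcome θ ω i)

/-- Never more than the single item is sold. -/
def Mechanism.Feasible (M : Mechanism n) : Prop :=
  ∀ θ ω, (∀ i, 0 ≤ (M.outcome θ ω i).amount) ∧ ∑ i, (M.outcome θ ω i).amount ≤ 1

/-- A truthful agent has non-negative expected utility, whatever the others report. -/
def Mechanism.IndividuallyRational (M : Mechanism n) : Prop :=
  ∀ θ i, 0 ≤ M.expectedUtility (θ i) θ i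

/-- Whatever the other agents report, agent `i` (of true type `θ i`) maximizes her expected utility
by reporting her true type; a misreport `r` may change every component of the type. Arrival times
are distinct, and the budget of agent `i` is positive. -/
def Mechanism.Truthful (M : Mechanism n) : Prop :=
  ∀ θ : Fin n → AgentType, Function.Injective (fun l => (θ l).arrival) →
    ∀ i, 0 < (θ i).budget → ∀ r : AgentType,
      M.expectedUtility (θ i) (Function.update θ i r) i ≤ M.expectedUtility (θ i) θ i

/-- The choices of the adversary: `n` time frames, ordered by (distinct) arrival times, and `n`
pairs (value, budget). -/
structure Input (n : ℕ) where
  arrival : Fin n → ℝ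
  departure : Fin n → ℝ
  value : Fin n → ℝ
  budget : Fin n → ℝ
  arrival_strictMono : StrictMono arrival
  arrival_le_departure : ∀ i, arrival i ≤ departure i
  value_pos : ∀ i, 0 < value i
  budget_pos : ∀ i, 0 < budget i

/-- The types that result when the pairs are matched to the time frames by `π`. -/
def Input.types (I : Input n) (π : Equiv.Perm (Fin n)) (i : Fin n) : AgentType where
  arrival := I.arrival i
  departure := I.departure i
  value := I.value (π i)
  budget := I.budget (π i)
  arrival_le_departure := I.arrival_le_departure i
  value_nonneg := (I.value_pos _).le
  budget_nonneg := (I.budget_pos _).le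

/-- Liquid welfare `∑ min {vᵢ xᵢ, bᵢ}` of an allocation `x`. -/
def liquidWelfare (v b x : Fin n → ℝ) : ℝ := ∑ i, min (v i * x i) (b i)

/-- The optimal liquid welfare of the agents with values `v` and budgets `b`, for one divisible
item. -/
def optLiquidWelfare (v b : Fin n → ℝ) : ℝ :=
  sSup {W | ∃ x : Fin n → ℝ, (∀ i, 0 ≤ x i) ∧ ∑ i, x i ≤ 1 ∧ W = liquidWelfare v b x}

/-- Expected liquid welfare under truthful reports, over the coins of the mechanism and the
uniformly random matching `π`. -/
def Mechanism.expectedLiquidWelfare (M : Mechanism n) (I : Input n) : ℝ :=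
  (Fintype.card (Equiv.Perm (Fin n)) : ℝ)⁻¹ * ∑ π : Equiv.Perm (Fin n), ∑ ω, M.prob ω *
    liquidWelfare (fun i => I.value (π i)) (fun i => I.budget (π i))
      (fun i => (M.outcome (I.types π) ω i).amount)

/-- `M` is a `c`-approximation to the optimal liquid welfare. -/
def Mechanism.Approximates (M : Mechanism n) (c : ℝ) : Prop :=
  ∀ I : Input n, optLiquidWelfare I.value I.budget ≤ c * M.expectedLiquidWelfare I

/-! ### Orders -/

/-- `agentAt θ k` is the agent who arrives in place `k` (counted from `0`) according to the reported
arrival times; equal reported times are ordered by index. -/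
def agentAt (θ : Fin n → AgentType) : Equiv.Perm (Fin n) := Tuple.sort fun i => (θ i).arrival

/-- The place of agent `i`, counted from `0`, in the reported order of arrival. -/
def place (θ : Fin n → AgentType) (i : Fin n) : Fin n := (agentAt θ).symm i

/-- The first `k` agents. -/
def firstAgents (θ : Fin n → AgentType) (k : ℕ) : Finset (Fin n) :=
  univ.filter fun i => (place θ i : ℕ) < k

/-- The members of `S` up to and including `i` when `S` is listed by decreasing `f` (equal entries
by index). -/
def topUpTo (S : Finset (Fin n)) (f : Fin n → ℝ) (i : Fin n) : Finset (Fin n) :=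
  S.filter fun l => f i < f l ∨ (f l = f i ∧ l ≤ i)

/-- The position of `i`, counted from `1`, when `S` is listed by decreasing `f`. -/
def rankIn (S : Finset (Fin n)) (f : Fin n → ℝ) (i : Fin n) : ℕ := #(topUpTo S f i)

/-- The `k`-th largest of the values `f i`, `i ∈ S` (`k = 1, 2, …`), and `0` if `S` has fewer than
`k` members: the sum has at most one term. -/
def kthLargest (S : Finset (Fin n)) (f : Fin n → ℝ) (k : ℕ) : ℝ :=
  ∑ i ∈ S.filter fun i => rankIn S f i = k, f i

/-! ### Market clearing price and greedy allocation -/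

/-- The largest `k` with `b_{i₁} + ⋯ + b_{iₖ} ≤ v_{iₖ}`, where `S = {i₁, i₂, …}` is listed by
decreasing value (and `0` if there is none). -/
def clearingIndex (θ : Fin n → AgentType) (S : Finset (Fin n)) : ℕ :=
  (S.filter fun i =>
    ∑ l ∈ topUpTo S (fun l => (θ l).value) i, (θ l).budget ≤ (θ i).value).sup
      (rankIn S fun l => (θ l).value)

/-- The market clearing price `max {b_{i₁} + ⋯ + b_{iₖ}, v_{iₖ₊₁}}`. -/
def clearingPrice (θ : Fin n → AgentType) (S : Finset (Fin n)) : ℝ :=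
  max (∑ i ∈ S.filter fun i => rankIn S (fun l => (θ l).value) i ≤ clearingIndex θ S,
      (θ i).budget)
    (kthLargest S (fun l => (θ l).value) (clearingIndex θ S + 1))

/-- What an agent of type `τ` buys when `k` units are left at price `p` per unit: `min {b / p, k}`
if `v ≥ p`, and nothing otherwise. At price `0` the budget is no restriction. -/
def purchase (τ : AgentType) (p k : ℝ) : ℝ :=
  if p ≤ τ.value then (if p = 0 then k else min (τ.budget / p) k) else 0

/-- The agents of a list buy one after the other from `k` units at price `p` per unit. -/
def sellAlong (θ : Fin n → AgentType) (p : ℝ) : List (Fin n) → ℝ → Fin n → ℝ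
  | [], _ => 0
  | i :: L, k =>
      Function.update (sellAlong θ p L (k - purchase (θ i) p k)) i (purchase (θ i) p k)

/-- `Div_Alloc (S, p, k)`, where the random order of `S` is the one induced by `σ`. -/
def divAlloc (θ : Fin n → AgentType) (σ : Equiv.Perm (Fin n)) (S : Finset (Fin n)) (p k : ℝ) :
    Fin n → ℝ :=
  sellAlong θ p ((List.ofFn σ).filter fun i => i ∈ S) k

/-! ### The mechanism `RS_Liquid`, that is, `RS_Online` for one item with `Div_Alloc` and the market
clearing price -/

/-- The coins of `RS_Liquid`. -/
abbrev RSCoins (n : ℕ) : Type :=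
  (Fin (n - 1) → Bool) × (Fin n → Bool) ×
    Equiv.Perm (Fin n) × Equiv.Perm (Fin n) × (Fin n → Equiv.Perm (Fin n))

namespace RSCoins

/-- The number of tails (`false`) in the `n - 1` tosses that determine the size of `A`. -/
def tails (ω : RSCoins n) : ℕ := #(univ.filter fun k => ω.1 k = false)

/-- The coin tossed for agent `i` (heads is `true`): when `A` is partitioned if `i ∈ A`, upon her
arrival if `i ∈ B`. -/
def coin (ω : RSCoins n) : Fin n → Bool := ω.2.1

/-- The order used by `Div_Alloc` on `A₁`. -/
def order₁ (ω : RSCoins n) : Equiv.Perm (Fin n) := ω.2.2.1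

/-- The order used by `Div_Alloc` on `A₂`. -/
def order₂ (ω : RSCoins n) : Equiv.Perm (Fin n) := ω.2.2.2.1

/-- The order used by the call of `Div_Alloc` made upon the arrival of agent `i ∈ B`. -/
def orderB (ω : RSCoins n) (i : Fin n) : Equiv.Perm (Fin n) := ω.2.2.2.2 i

theorem tails_lt [NeZero n] (ω : RSCoins n) : ω.tails < n := by
  have h : ω.tails ≤ n - 1 := by
    simpa [tails] using card_filter_le (univ : Finset (Fin (n - 1))) fun k => ω.1 k = false
  have := NeZero.pos n
  omega

end RSCoins

section RS

variable [NeZero n] (θ : Fin n → AgentType) (ω : RSCoins n)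

/-- The last agent `j` of `A`. -/
def lastAgent : Fin n := agentAt θ ⟨ω.tails, ω.tails_lt⟩

/-- The sampling set `A`: the first `tails + 1` agents. -/
def setA : Finset (Fin n) := firstAgents θ (ω.tails + 1)

/-- The members of `A` whose coin differs from that of `j`. -/
def setA₁ : Finset (Fin n) := (setA θ ω).filter fun i => ω.coin i ≠ ω.coin (lastAgent θ ω)

/-- The members of `A` whose coin agrees with that of `j`; in particular `j ∈ A₂`. -/
def setA₂ : Finset (Fin n) := (setA θ ω).filter fun i => ω.coin i = ω.coin (lastAgent θ ω)

/-- The price for agent `i ∈ B`: that of `B₁` on heads, that of `B₂` on tails. -/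
def priceB (i : Fin n) : ℝ :=
  if ω.coin i = true then clearingPrice θ ((setA₂ θ ω).erase (lastAgent θ ω))
  else clearingPrice θ (setA₁ θ ω)

/-- The amount that agent `i ∈ B` would get if she competed with the agents of `A₁` (on heads), or
of `A₂ - j` (on tails). -/
def requestB (i : Fin n) : ℝ :=
  if ω.coin i = true then
    divAlloc θ (ω.orderB i) (insert i (setA₁ θ ω)) (priceB θ ω i) (1 / 4) i
  else
    divAlloc θ (ω.orderB i) (insert i ((setA₂ θ ω).erase (lastAgent θ ω))) (priceB θ ω i) (1 / 4) i

/-- The revenue collection phase: the agents of the list arrive one after the other, while `m₁` and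
`m₂` units remain for `B₁` and `B₂`. -/
def serveB : List (Fin n) → ℝ → ℝ → Fin n → ℝ
  | [], _, _ => 0
  | i :: L, m₁, m₂ =>
      if ω.coin i = true then
        Function.update (serveB L (m₁ - min (requestB θ ω i) m₁) m₂) i (min (requestB θ ω i) m₁)
      else
        Function.update (serveB L m₁ (m₂ - min (requestB θ ω i) m₂)) i (min (requestB θ ω i) m₂)

/-- The allocation to the agents of `B`, who come in their order of arrival after those of `A`. -/
def allocB : Fin n → ℝ :=
  serveB θ ω ((List.ofFn (agentAt θ)).drop (ω.tails + 1)) (1 / 4) (1 / 4)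

/-- The price for agent `i ∈ A`. -/
def priceA (i : Fin n) : ℝ :=
  if i ∈ setA₁ θ ω then clearingPrice θ (setA₂ θ ω) else clearingPrice θ (setA₁ θ ω)

/-- The allocation computed for the agents of `A` at the arrival of `j`. -/
def allocA (i : Fin n) : ℝ :=
  if i ∈ setA₁ θ ω then divAlloc θ ω.order₁ (setA₁ θ ω) (clearingPrice θ (setA₂ θ ω)) (1 / 4) i
  else divAlloc θ ω.order₂ (setA₂ θ ω) (clearingPrice θ (setA₁ θ ω)) (1 / 4) i

/-- The outcome of `RS_Liquid`. An agent of `A` is served at the reported arrival time of `j` unless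
she has departed, an agent of `B` at her own reported arrival time. -/
def rsOutcome (i : Fin n) : Outcome :=
  if i ∈ setA θ ω then
    if (θ (lastAgent θ ω)).arrival ≤ (θ i).departure then
      ⟨allocA θ ω i, allocA θ ω i * priceA θ ω i, (θ (lastAgent θ ω)).arrival⟩
    else ⟨0, 0, (θ (lastAgent θ ω)).arrival⟩
  else ⟨allocB θ ω i, allocB θ ω i * priceB θ ω i, (θ i).arrival⟩

end RS

/-! ### The mechanism `MVCG` -/

section MVCG

variable [NeZero n] (γ : ℝ) (θ : Fin n → AgentType)

/-- The reported arrival time of the `⌊n / 2⌋`-th agent (irrelevant if `n = 1`). -/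
def halfTime : ℝ :=
  (θ (agentAt θ ⟨n / 2 - 1, by have := NeZero.pos n; omega⟩)).arrival

/-- The `k`-th largest liquid value among the first `⌊n / 2⌋` agents, times `γ`. -/
def mvcgPrice (k : ℕ) : ℝ :=
  γ * kthLargest (firstAgents θ (n / 2)) (fun l => (θ l).liquid) k

/-- Agent `i` is in `B` and her liquid value reaches the threshold `p₁`. -/
def Surpasses (i : Fin n) : Prop :=
  i ∉ firstAgents θ (n / 2) ∧ mvcgPrice γ θ 1 ≤ (θ i).liquid

open Classical in
/-- The outcome of `MVCG`. On heads (`true`) the entire item goes, at the arrival of the last agent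
of `A`, to the agent of `A` with the highest liquid value, at price `p₂`, if her liquid value is at
least `p₂` and she has not departed. On tails it goes to the first agent of `B` whose liquid value
is at least `p₁`, upon her arrival, at price `p₁`. -/
def mvcgOutcome (heads : Bool) (i : Fin n) : Outcome :=
  if heads = true then
    if i ∈ firstAgents θ (n / 2) ∧
        rankIn (firstAgents θ (n / 2)) (fun l => (θ l).liquid) i = 1 ∧
        mvcgPrice γ θ 2 ≤ (θ i).liquid ∧ halfTime θ ≤ (θ i).departure then
      ⟨1, mvcgPrice γ θ 2, halfTime θ⟩
    else ⟨0, 0, halfTime θ⟩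
  else
    if Surpasses γ θ i ∧ ∀ l, place θ l < place θ i → ¬ Surpasses γ θ l then
      ⟨1, mvcgPrice γ θ 1, (θ i).arrival⟩
    else ⟨0, 0, (θ i).arrival⟩

end MVCG

/-! ### The mechanism `Liquid_Div` -/

/-- A mechanism that draws its coins uniformly from a finite set. -/
def uniformMechanism (Ω : Type) [Fintype Ω] [Nonempty Ω]
    (outcome : (Fin n → AgentType) → Ω → Fin n → Outcome) : Mechanism n where
  Coins := Ω
  prob _ := (Fintype.card Ω : ℝ)⁻¹
  prob_nonneg _ := by positivity
  prob_sum := by simp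
  outcome := outcome

/-- Run `M` with probability `μ`, and `M'` otherwise. -/
def mix (μ : ℝ) (h₀ : 0 ≤ μ) (h₁ : μ ≤ 1) (M M' : Mechanism n) : Mechanism n where
  Coins := M.Coins ⊕ M'.Coins
  prob := Sum.elim (fun ω => μ * M.prob ω) fun ω => (1 - μ) * M'.prob ω
  prob_nonneg := by
    rintro (ω | ω)
    · exact mul_nonneg h₀ (M.prob_nonneg ω)
    · exact mul_nonneg (sub_nonneg.2 h₁) (M'.prob_nonneg ω)
  prob_sum := by
    simp [Fintype.sum_sum_type, ← mul_sum, M.prob_sum, M'.prob_sum]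
  outcome θ := Sum.elim (M.outcome θ) (M'.outcome θ)

/-- The mechanism `RS_Liquid`. -/
def rsLiquid (n : ℕ) [NeZero n] : Mechanism n := uniformMechanism (RSCoins n) rsOutcome

/-- The mechanism `MVCG`. -/
def mvcg (n : ℕ) [NeZero n] (γ : ℝ) : Mechanism n := uniformMechanism Bool (mvcgOutcome γ)

/-- The mechanism `Liquid_Div`: `MVCG` with probability `μ`, and `RS_Liquid` otherwise. -/
def liquidDiv (n : ℕ) [NeZero n] (μ γ : ℝ) (h₀ : 0 ≤ μ) (h₁ : μ ≤ 1) : Mechanism n :=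
  mix μ h₀ h₁ (mvcg n γ) (rsLiquid n)

end

end BudgetedSecretary

open BudgetedSecretary

/-!
**Truthfulness.** A misreport `r` of agent `i` is compared with the truth coin by coin: there is a
measure-preserving permutation of the coins such that every outcome under `r` is at most as good
for `i` as the outcome under the truth for the permuted coins (`Mechanism.Coupled`). At a fixed
price and from a fixed supply the truthful purchase is optimal (`utility_le_utility_purchase`), so
it has to be seen that the misreport changes neither price nor supply to her advantage. In
`RS_Liquid` an agent of `A` faces the price of the others in `A` whose coins differ from hers, and
competes with those whose coins agree (`rsOutcome_of_mem`), and an agent of `B` meets the same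
situation with respect to `A` without its last member `j`. If the misreport moves `i` from `A` to
`B`, then `A` without `i` becomes `A` without `j`, so turning the coin of `i` suitably and
exchanging the random orders of the greedy allocations identifies the two situations. If it moves
her from `B` to `A`, or forward within `B`, she is served before her arrival. If it moves her
backward within `B`, only supply is lost. In `MVCG` the change from `A` to `B` is matched by
exchanging heads and tails: the truth earns her the price `γ` times the best liquid value of the
others in `A`, and the price after the misreport is no lower (`mvcg_coupled`).

**Welfare.** The clearing price of `S` is the unique `p` with `∑_{v > p} b ≤ p ≤ ∑_{v ≥ p} b`, the
sums being over `S` (`clears_clearingPrice`, `Clears.unique`), hence monotone in `S`, and the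
optimum is at most twice the clearing price `P` of all agents
(`optLiquidWelfare_le_two_mul_clearingPrice`). If one agent has liquid value at least `0.65 P`, and
at least `γ` times all others, then `MVCG` sells to her on tails whenever she comes in the second
half and the runner-up in the first one, which has probability at least `1 / 4`
(`mvcg_expectedLiquidWelfare_ge`).

Otherwise only the revenue that `RS_Liquid` collects from `B₁` is used. Let `Y` be `A₂` without
`j`, `W = A₁` and `U = B₁`. Given `j`, each of the other agents is in `Y`, `W`, `U` or none of them
with probability `1 / 4`, independently (`sum_perm_sum_tosses`, `sum_classOf`). At the price `p` of
`Y`, if the demand of `U` is at least the supply `1 / 4` and at least the demand of `W`, then the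
requests of `U` amount on average to at least half the supply (`purchase_le_sum_divAlloc`). As
these requests use independent orders, at least a fraction `1 - exp (-1 / 2)` of the supply is sold
on average (`sum_min_one_sum_ge`, `card_orders_mul_le`). By the symmetry between `U` and `W` this
happens at least half of the time that `p` is at most the larger of the prices of `W` and `U`, and
by the symmetry of all three classes the two smaller ones of the three prices count. If prices are
bounded below by `ρ` times an additive weight `w` of total mass `1`, the expected revenue is then
at least a constant times `ρ (1 - ∑ w²)` (`sum_guarantee_ge`). Such a weight exists whenever no
agent dominates (`exists_shares`).

For `n ≤ 2`, where this bound is void, some ratio comes from the event that the first agent is the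
whole sample, when she gets a quarter of the item for free (`exists_liquidDiv_approximates`).
-/

namespace BudgetedSecretary

noncomputable section

/-! ### Ranks in a finite set -/

section Ranks

variable {n : ℕ} {S : Finset (Fin n)} {f : Fin n → ℝ} {i l : Fin n}

theorem mem_topUpTo_self (hi : i ∈ S) : i ∈ topUpTo S f i := by
  simp [topUpTo, hi]

theorem topUpTo_subset_of_mem (h : l ∈ topUpTo S f i) : topUpTo S f l ⊆ topUpTo S f i := by
  intro x hx
  simp only [topUpTo, mem_filter] at h hx ⊢
  refine ⟨hx.1, ?_⟩
  rcases h.2 with h1 | ⟨h1, h1'⟩ <;> rcases hx.2 with h2 | ⟨h2, h2'⟩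
  · exact Or.inl (h1.trans h2)
  · exact Or.inl (by rw [h2]; exact h1)
  · exact Or.inl (by rw [← h1]; exact h2)
  · exact Or.inr ⟨h2.trans h1, h2'.trans h1'⟩

theorem mem_topUpTo_or (hi : i ∈ S) (hl : l ∈ S) : l ∈ topUpTo S f i ∨ i ∈ topUpTo S f l := by
  simp only [topUpTo, mem_filter, hi, hl, true_and]
  rcases lt_trichotomy (f i) (f l) with h | h | h
  · exact Or.inl (Or.inl h)
  · rcases le_total l i with h' | h'
    · exact Or.inl (Or.inr ⟨h.symm, h'⟩)
    · exact Or.inr (Or.inr ⟨h, h'⟩)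
  · exact Or.inr (Or.inl h)

theorem eq_of_mem_topUpTo (h : l ∈ topUpTo S f i) (h' : i ∈ topUpTo S f l) : l = i := by
  simp only [topUpTo, mem_filter] at h h'
  rcases h.2 with h1 | ⟨h1, h1'⟩ <;> rcases h'.2 with h2 | ⟨h2, h2'⟩
  · exact absurd h1 h2.not_gt
  · exact absurd h2 h1.ne
  · exact absurd h1 h2.ne
  · exact le_antisymm h1' h2'

theorem rankIn_le_iff (hi : i ∈ S) (hl : l ∈ S) :
    rankIn S f l ≤ rankIn S f i ↔ l ∈ topUpTo S f i := by
  constructor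
  · intro h
    rcases mem_topUpTo_or (f := f) hi hl with h' | h'
    · exact h'
    · have := eq_of_subset_of_card_le (topUpTo_subset_of_mem h') h
      rw [this]
      exact mem_topUpTo_self hl
  · exact fun h => card_le_card (topUpTo_subset_of_mem h)

theorem rankIn_inj (hi : i ∈ S) (hl : l ∈ S) (h : rankIn S f l = rankIn S f i) : l = i :=
  eq_of_mem_topUpTo ((rankIn_le_iff hi hl).1 h.le) ((rankIn_le_iff hl hi).1 h.ge)

theorem one_le_rankIn (hi : i ∈ S) : 1 ≤ rankIn S f i :=
  card_pos.2 ⟨i, mem_topUpTo_self hi⟩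

theorem image_rankIn (S : Finset (Fin n)) (f : Fin n → ℝ) :
    S.image (rankIn S f) = Icc 1 #S := by
  refine eq_of_subset_of_card_le ?_ ?_
  · intro k hk
    obtain ⟨i, hi, rfl⟩ := mem_image.1 hk
    exact mem_Icc.2 ⟨one_le_rankIn hi, card_le_card (filter_subset _ _)⟩
  · rw [card_image_of_injOn fun a ha b hb h => rankIn_inj hb ha h]
    simp

theorem exists_rankIn_eq {k : ℕ} (h1 : 1 ≤ k) (h2 : k ≤ #S) : ∃ i ∈ S, rankIn S f i = k := by
  have : k ∈ S.image (rankIn S f) := by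
    rw [image_rankIn]
    exact mem_Icc.2 ⟨h1, h2⟩
  exact mem_image.1 this

theorem apply_le_of_rankIn_le (hi : i ∈ S) (hl : l ∈ S) (h : rankIn S f l ≤ rankIn S f i) :
    f i ≤ f l := by
  have := (rankIn_le_iff hi hl).1 h
  simp only [topUpTo, mem_filter] at this
  rcases this.2 with h | h
  · exact h.le
  · exact h.1.ge

theorem kthLargest_eq (hi : i ∈ S) : kthLargest S f (rankIn S f i) = f i := by
  have : (S.filter fun l => rankIn S f l = rankIn S f i) = {i} := by
    ext l
    simp only [mem_filter, mem_singleton]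
    exact ⟨fun h => rankIn_inj hi h.1 h.2, fun h => by rw [h]; exact ⟨hi, rfl⟩⟩
  rw [kthLargest, this, sum_singleton]

theorem kthLargest_eq_zero {k : ℕ} (h : ∀ i ∈ S, rankIn S f i ≠ k) : kthLargest S f k = 0 := by
  rw [kthLargest, filter_false_of_mem h, sum_empty]

/-- Whoever is not among the first `k` is dominated by number `k + 1`. -/
theorem le_kthLargest_succ {k : ℕ} (hl : l ∈ S) (h : k < rankIn S f l) :
    f l ≤ kthLargest S f (k + 1) := by
  have hc : rankIn S f l ≤ #S := card_le_card (filter_subset _ _)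
  obtain ⟨i, hi, hik⟩ := exists_rankIn_eq (S := S) (f := f) (k := k + 1) (by omega) (by omega)
  rw [← hik, kthLargest_eq hi]
  exact apply_le_of_rankIn_le hl hi (by omega)

theorem kthLargest_eq_zero_or (S : Finset (Fin n)) (f : Fin n → ℝ) (k : ℕ) :
    kthLargest S f k = 0 ∨ ∃ i ∈ S, rankIn S f i = k ∧ kthLargest S f k = f i := by
  by_cases h : ∃ i ∈ S, rankIn S f i = k
  · obtain ⟨i, hi, hk⟩ := h
    exact Or.inr ⟨i, hi, hk, by rw [← hk, kthLargest_eq hi]⟩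
  · push Not at h
    exact Or.inl (kthLargest_eq_zero h)

/-- `M` is the maximum of `f` over `S`, where the empty set has maximum `0`. -/
def IsTop (S : Finset (Fin n)) (f : Fin n → ℝ) (M : ℝ) : Prop :=
  (∀ l ∈ S, f l ≤ M) ∧ 0 ≤ M ∧ (M = 0 ∨ ∃ l ∈ S, f l = M)

theorem IsTop.mono {T : Finset (Fin n)} {M M' : ℝ} (h : IsTop S f M) (h' : IsTop T f M')
    (hST : S ⊆ T) : M ≤ M' := by
  rcases h.2.2 with h0 | ⟨l, hl, hM⟩
  · rw [h0]
    exact h'.2.1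
  · rw [← hM]
    exact h'.1 l (hST hl)

theorem IsTop.unique {M M' : ℝ} (h : IsTop S f M) (h' : IsTop S f M') : M = M' :=
  le_antisymm (h.mono h' subset_rfl) (h'.mono h subset_rfl)

theorem IsTop.congr {g : Fin n → ℝ} {M : ℝ} (h : IsTop S f M) (hfg : ∀ l ∈ S, f l = g l) :
    IsTop S g M := by
  refine ⟨fun l hl => hfg l hl ▸ h.1 l hl, h.2.1, h.2.2.imp id ?_⟩
  rintro ⟨l, hl, h⟩
  exact ⟨l, hl, hfg l hl ▸ h⟩

theorem kthLargest_nonneg (hf : ∀ i, 0 ≤ f i) (k : ℕ) : 0 ≤ kthLargest S f k :=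
  sum_nonneg fun i _ => hf i

theorem isTop_kthLargest_one (hf : ∀ i, 0 ≤ f i) : IsTop S f (kthLargest S f 1) := by
  refine ⟨fun l hl => le_kthLargest_succ hl (one_le_rankIn hl), kthLargest_nonneg hf 1, ?_⟩
  rcases kthLargest_eq_zero_or S f 1 with h | ⟨i, hi, -, h⟩
  · exact Or.inl h
  · exact Or.inr ⟨i, hi, h.symm⟩

theorem isTop_kthLargest_two (hf : ∀ i, 0 ≤ f i) (hi : i ∈ S) (h1 : rankIn S f i = 1) :
    IsTop (S.erase i) f (kthLargest S f 2) := by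
  refine ⟨fun l hl => le_kthLargest_succ (mem_of_mem_erase hl) ?_, kthLargest_nonneg hf 2, ?_⟩
  · have h2 := one_le_rankIn (f := f) (mem_of_mem_erase hl)
    have h3 : rankIn S f l ≠ 1 := fun h =>
      ne_of_mem_erase hl (rankIn_inj hi (mem_of_mem_erase hl) (h.trans h1.symm))
    omega
  · rcases kthLargest_eq_zero_or S f 2 with h | ⟨l, hl, hk, h⟩
    · exact Or.inl h
    · refine Or.inr ⟨l, mem_erase.2 ⟨?_, hl⟩, h.symm⟩
      rintro rfl
      omega

theorem rankIn_eq_one (hi : i ∈ S) (h : ∀ l ∈ S, l ≠ i → f l < f i) : rankIn S f i = 1 := by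
  rw [rankIn, card_eq_one]
  refine ⟨i, ?_⟩
  ext l
  simp only [topUpTo, mem_filter, mem_singleton]
  constructor
  · rintro ⟨hl, h'⟩
    by_contra hne
    have := h l hl hne
    rcases h' with h' | h'
    · exact absurd h' this.not_gt
    · exact absurd h'.1 this.ne
  · rintro rfl
    exact ⟨hi, Or.inr ⟨rfl, le_rfl⟩⟩

end Ranks

/-! ### The market clearing price -/

section Clearing

variable {n : ℕ}

/-- The total budget of the members of `S` who are willing to pay `p` per unit. -/
def weakDemand (v b : Fin n → ℝ) (S : Finset (Fin n)) (p : ℝ) : ℝ :=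
  ∑ l ∈ S with p ≤ v l, b l

/-- The total budget of the members of `S` whose value exceeds `p`. -/
def strictDemand (v b : Fin n → ℝ) (S : Finset (Fin n)) (p : ℝ) : ℝ :=
  ∑ l ∈ S with p < v l, b l

/-- At price `p` the item can be sold out: `p` lies between the strict and the weak demand, both
measured in money. -/
def Clears (v b : Fin n → ℝ) (S : Finset (Fin n)) (p : ℝ) : Prop :=
  strictDemand v b S p ≤ p ∧ p ≤ weakDemand v b S p

variable {v b : Fin n → ℝ} {S T : Finset (Fin n)} {p q : ℝ}

theorem weakDemand_nonneg (hb : ∀ i, 0 ≤ b i) : 0 ≤ weakDemand v b S p :=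
  sum_nonneg fun i _ => hb i

theorem strictDemand_nonneg (hb : ∀ i, 0 ≤ b i) : 0 ≤ strictDemand v b S p :=
  sum_nonneg fun i _ => hb i

theorem weakDemand_mono (hb : ∀ i, 0 ≤ b i) (h : S ⊆ T) :
    weakDemand v b S p ≤ weakDemand v b T p :=
  sum_le_sum_of_subset_of_nonneg (filter_subset_filter _ h) fun i _ _ => hb i

theorem weakDemand_le_strictDemand (hb : ∀ i, 0 ≤ b i) (h : p < q) :
    weakDemand v b S q ≤ strictDemand v b S p := by
  refine sum_le_sum_of_subset_of_nonneg (fun l hl => ?_) fun i _ _ => hb i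
  rw [mem_filter] at hl ⊢
  exact ⟨hl.1, h.trans_le hl.2⟩

/-- A clearing price is the largest price that is covered by its weak demand. -/
theorem Clears.le_of_le_weakDemand (hb : ∀ i, 0 ≤ b i) (h : Clears v b S p)
    (hq : q ≤ weakDemand v b S q) : q ≤ p := by
  by_contra! hlt
  exact absurd (hq.trans ((weakDemand_le_strictDemand hb hlt).trans h.1)) hlt.not_ge

theorem Clears.mono (hb : ∀ i, 0 ≤ b i) (h : Clears v b S p) (h' : Clears v b T q)
    (hST : S ⊆ T) : p ≤ q :=
  h'.le_of_le_weakDemand hb (h.2.trans (weakDemand_mono hb hST))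

theorem Clears.unique (hb : ∀ i, 0 ≤ b i) (h : Clears v b S p) (h' : Clears v b S q) : p = q :=
  le_antisymm (h.mono hb h' subset_rfl) (h'.mono hb h subset_rfl)

/-- The clearing price is the price at which the item can be sold out. In its definition, the
maximum is the total budget of the first `k` agents if these can pay it, and otherwise the value of
agent `k + 1`, whose budget, with those before her, exceeds it. -/
theorem clears_clearingPrice (θ : Fin n → AgentType) (S : Finset (Fin n)) :
    Clears (fun l => (θ l).value) (fun l => (θ l).budget) S (clearingPrice θ S) := by
  set v : Fin n → ℝ := fun l => (θ l).value with hv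
  set b : Fin n → ℝ := fun l => (θ l).budget with hb
  set K := clearingIndex θ S with hK
  have hb0 : ∀ i, 0 ≤ b i := fun i => (θ i).budget_nonneg
  have hp : clearingPrice θ S =
      max (∑ i ∈ S with rankIn S v i ≤ K, b i) (kthLargest S v (K + 1)) := rfl
  rw [hp]
  set B := ∑ i ∈ S with rankIn S v i ≤ K, b i with hB
  have htop : ∀ i ∈ S, (S.filter fun l => rankIn S v l ≤ rankIn S v i) = topUpTo S v i := by
    intro i hi
    ext l
    rw [mem_filter]
    exact ⟨fun h => (rankIn_le_iff hi h.1).1 h.2, fun h =>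
      have hl := (mem_filter.1 h).1
      ⟨hl, (rankIn_le_iff hi hl).2 h⟩⟩
  have hmax : ∀ i ∈ S, ∑ l ∈ topUpTo S v i, b l ≤ v i → rankIn S v i ≤ K := by
    intro i hi h
    exact le_sup (f := rankIn S v) (mem_filter.2 ⟨hi, h⟩)
  constructor
  · refine le_trans (sum_le_sum_of_subset_of_nonneg ?_ fun i _ _ => hb0 i) (le_max_left _ _)
    intro l hl
    rw [mem_filter] at hl ⊢
    refine ⟨hl.1, ?_⟩
    by_contra! h
    exact absurd (le_kthLargest_succ hl.1 h) ((le_max_right _ _).trans_lt hl.2).not_ge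
  · rcases le_total (kthLargest S v (K + 1)) B with h | h
    · rw [max_eq_left h]
      rcases Nat.eq_zero_or_pos K with h0 | h0
      · have : B = 0 := by
          rw [hB, filter_false_of_mem, sum_empty]
          intro i hi
          have := one_le_rankIn (f := v) hi
          omega
        rw [this]
        exact weakDemand_nonneg hb0
      · -- the agent at position `K` can afford the price, and so can all before her
        have hne : (S.filter fun i => ∑ l ∈ topUpTo S v i, b l ≤ v i).Nonempty := by
          by_contra hne
          rw [not_nonempty_iff_eq_empty] at hne
          have : K = 0 := by
            rw [hK, clearingIndex, hne, sup_empty]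
            rfl
          omega
        obtain ⟨i, hi, hKi⟩ := exists_mem_eq_sup _ hne (rankIn S v)
        have hKi : K = rankIn S v i := hKi
        rw [mem_filter] at hi
        have hBi : B ≤ v i := by
          rw [hB, hKi, htop i hi.1]
          exact hi.2
        refine sum_le_sum_of_subset_of_nonneg ?_ fun i _ _ => hb0 i
        intro l hl
        rw [mem_filter] at hl ⊢
        rw [hKi] at hl
        exact ⟨hl.1, hBi.trans (apply_le_of_rankIn_le hi.1 hl.1 hl.2)⟩
    · rw [max_eq_right h]
      rcases kthLargest_eq_zero_or S v (K + 1) with h0 | ⟨i, hi, hr, hk⟩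
      · rw [h0]
        exact weakDemand_nonneg hb0
      · rw [hk]
        have h1 : v i < ∑ l ∈ topUpTo S v i, b l := by
          by_contra! h1
          have := hmax i hi h1
          omega
        refine h1.le.trans (sum_le_sum_of_subset_of_nonneg ?_ fun i _ _ => hb0 i)
        intro l hl
        have hlS := (mem_filter.1 hl).1
        exact mem_filter.2 ⟨hlS, apply_le_of_rankIn_le hi hlS ((rankIn_le_iff hi hlS).2 hl)⟩

theorem clearingPrice_nonneg (θ : Fin n → AgentType) (S : Finset (Fin n)) :
    0 ≤ clearingPrice θ S :=
  (strictDemand_nonneg fun i => (θ i).budget_nonneg).trans (clears_clearingPrice θ S).1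

theorem clearingPrice_congr {θ θ' : Fin n → AgentType} {S : Finset (Fin n)}
    (h : ∀ i ∈ S, θ i = θ' i) : clearingPrice θ S = clearingPrice θ' S := by
  refine (clears_clearingPrice θ S).unique (fun i => (θ i).budget_nonneg) ?_
  have h' := clears_clearingPrice θ' S
  constructor
  · convert h'.1 using 1
    rw [strictDemand, strictDemand, sum_filter, sum_filter]
    exact sum_congr rfl fun i hi => by simp only [h i hi]
  · convert h'.2 using 1
    rw [weakDemand, weakDemand, sum_filter, sum_filter]
    exact sum_congr rfl fun i hi => by simp only [h i hi]

end Clearing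

/-! ### Posted prices: purchases and utilities -/

section Purchase

variable {n : ℕ} {τ : AgentType} {p k k' x t t' : ℝ}

theorem purchase_nonneg (hp : 0 ≤ p) (hk : 0 ≤ k) : 0 ≤ purchase τ p k := by
  unfold purchase
  split_ifs
  · exact hk
  · exact le_min (div_nonneg τ.budget_nonneg hp) hk
  · exact le_rfl

theorem purchase_le (hk : 0 ≤ k) : purchase τ p k ≤ k := by
  unfold purchase
  split_ifs
  · exact le_rfl
  · exact min_le_right _ _
  · exact hk

theorem purchase_mono (h : k ≤ k') : purchase τ p k ≤ purchase τ p k' := by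
  unfold purchase
  split_ifs
  · exact h
  · exact min_le_min_left _ h
  · exact le_rfl

theorem purchase_mul_le (hp : 0 ≤ p) : purchase τ p k * p ≤ τ.budget := by
  unfold purchase
  split_ifs with h1 h2
  · simpa [h2] using τ.budget_nonneg
  · have hp' : 0 < p := lt_of_le_of_ne hp (Ne.symm h2)
    calc min (τ.budget / p) k * p ≤ τ.budget / p * p :=
          mul_le_mul_of_nonneg_right (min_le_left _ _) hp
      _ = τ.budget := div_mul_cancel₀ _ h2
  · simpa using τ.budget_nonneg

theorem purchase_eq_zero (h : τ.value < p) : purchase τ p k = 0 :=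
  if_neg h.not_ge

/-- A cap on the amount acts like a shorter supply. -/
theorem min_purchase (hk' : 0 ≤ k') :
    min (purchase τ p k) k' = purchase τ p (min k k') := by
  unfold purchase
  split_ifs
  · rfl
  · rw [min_assoc]
  · exact min_eq_left hk'

theorem utility_of_le_budget {o : Outcome} (h : o.payment ≤ τ.budget)
    (ht : τ.arrival ≤ o.time ∧ o.time ≤ τ.departure) :
    utility τ o = ((τ.value * o.amount - o.payment : ℝ) : EReal) := by
  rw [utility, if_neg h.not_gt, if_pos ht]

theorem utility_zero (τ : AgentType) (t : ℝ) : utility τ ⟨0, 0, t⟩ = 0 := by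
  simp [utility, τ.budget_nonneg.not_gt]

theorem utility_nonpos {o : Outcome} (h : 0 ≤ o.payment)
    (ht : ¬(τ.arrival ≤ o.time ∧ o.time ≤ τ.departure)) : utility τ o ≤ 0 := by
  rw [utility, if_neg ht]
  split_ifs
  · exact bot_le
  · rw [zero_sub]
    exact_mod_cast neg_nonpos.2 h

theorem utility_nonneg_of_le_purchase (hp : 0 ≤ p) (hx : 0 ≤ x) (hxk : x ≤ purchase τ p k)
    (ht : τ.arrival ≤ t ∧ t ≤ τ.departure) : 0 ≤ utility τ ⟨x, x * p, t⟩ := by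
  rw [utility_of_le_budget ((mul_le_mul_of_nonneg_right hxk hp).trans (purchase_mul_le hp)) ht]
  norm_cast
  show 0 ≤ τ.value * x - x * p
  rcases le_or_gt p τ.value with h | h
  · nlinarith
  · rw [purchase_eq_zero h] at hxk
    rw [le_antisymm hxk hx]
    simp

/-- At a fixed price and with `k` units left, the purchase determined by the true type is optimal.
-/
theorem utility_le_utility_purchase (hp : 0 ≤ p) (hx : 0 ≤ x) (hxk : x ≤ k)
    (ht : τ.arrival ≤ t ∧ t ≤ τ.departure) (ht' : τ.arrival ≤ t' ∧ t' ≤ τ.departure) :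
    utility τ ⟨x, x * p, t⟩ ≤ utility τ ⟨purchase τ p k, purchase τ p k * p, t'⟩ := by
  rw [utility_of_le_budget (o := ⟨purchase τ p k, purchase τ p k * p, t'⟩) (purchase_mul_le hp) ht']
  by_cases hb : τ.budget < x * p
  · rw [utility, if_pos hb]
    exact bot_le
  rw [utility_of_le_budget (not_lt.1 hb) ht]
  norm_cast
  show τ.value * x - x * p ≤ τ.value * purchase τ p k - purchase τ p k * p
  rcases le_or_gt p τ.value with h | h
  · have hx' : x ≤ purchase τ p k := by
      rw [purchase, if_pos h]
      split_ifs with h0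
      · exact hxk
      · exact le_min ((le_div_iff₀ (lt_of_le_of_ne hp (Ne.symm h0))).2 (not_lt.1 hb)) hxk
    nlinarith
  · rw [purchase_eq_zero h]
    nlinarith

end Purchase

/-! ### The greedy allocation -/

section Greedy

variable {n : ℕ} {θ : Fin n → AgentType} {p k : ℝ} {i l : Fin n}

theorem sellAlong_nonneg (hp : 0 ≤ p) (L : List (Fin n)) (hk : 0 ≤ k) (i : Fin n) :
    0 ≤ sellAlong θ p L k i := by
  induction L generalizing k with
  | nil => exact le_rfl
  | cons a L ih =>
    rw [sellAlong, Function.update_apply]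
    split_ifs
    · exact purchase_nonneg hp hk
    · exact ih (sub_nonneg.2 (purchase_le hk))

theorem sum_update_le {ι : Type*} [Fintype ι] [DecidableEq ι] {g : ι → ℝ} (i : ι) {x : ℝ}
    (hg : 0 ≤ g i) : ∑ l, Function.update g i x l ≤ x + ∑ l, g l := by
  rw [sum_update_of_mem (mem_univ i), ← add_sum_erase univ g (mem_univ i), sdiff_singleton_eq_erase]
  linarith

theorem sum_sellAlong_le (hp : 0 ≤ p) (L : List (Fin n)) (hk : 0 ≤ k) :
    ∑ i, sellAlong θ p L k i ≤ k := by
  induction L generalizing k with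
  | nil => simpa [sellAlong] using hk
  | cons a L ih =>
    have h := sub_nonneg.2 (purchase_le (τ := θ a) (p := p) hk)
    rw [sellAlong]
    refine (sum_update_le a (sellAlong_nonneg hp L h a)).trans ?_
    linarith [ih h]

/-- The amount bought by agent `i` of a list is her purchase from a remaining supply that does not
depend on her type, and that the earlier agents of the list have diminished by at most what each of
them would buy from the full supply. -/
theorem exists_left (θ : Fin n → AgentType) (hp : 0 ≤ p) {R : Fin n → Fin n → Prop} [DecidableRel R]
    {L : List (Fin n)} (hL : L.Nodup) (hR : L.Pairwise R) (hk : 0 ≤ k) (hi : i ∈ L) :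
    ∃ k', 0 ≤ k' ∧ k' ≤ k ∧
      k - ∑ l ∈ L.toFinset.erase i with R l i, purchase (θ l) p k ≤ k' ∧
      ∀ τ, sellAlong (Function.update θ i τ) p L k i = purchase τ p k' := by
  induction L generalizing k with
  | nil => simp at hi
  | cons a L ih =>
    rcases eq_or_ne a i with rfl | hai
    · refine ⟨k, hk, le_rfl, ?_, fun τ => ?_⟩
      · have : 0 ≤ ∑ l ∈ (a :: L).toFinset.erase a with R l a, purchase (θ l) p k :=
          sum_nonneg fun l _ => purchase_nonneg hp hk
        linarith
      · simp [sellAlong]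
    · have hiL : i ∈ L := by
        rcases List.mem_cons.1 hi with h | h
        · exact absurd h.symm hai
        · exact h
      have h := sub_nonneg.2 (purchase_le (τ := θ a) (p := p) hk)
      obtain ⟨k', h0, h1, h2, h3⟩ := ih (List.nodup_cons.1 hL).2 (List.pairwise_cons.1 hR).2 h hiL
      refine ⟨k', h0, h1.trans (sub_le_self _ (purchase_nonneg hp hk)), ?_, fun τ => ?_⟩
      · refine le_trans ?_ h2
        have hset : ((a :: L).toFinset.erase i).filter (fun l => R l i) =
            insert a ((L.toFinset.erase i).filter fun l => R l i) := by
          rw [List.toFinset_cons, erase_insert_of_ne hai, filter_insert,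
            if_pos ((List.pairwise_cons.1 hR).1 i hiL)]
        rw [hset, sum_insert (by simp [(List.nodup_cons.1 hL).1])]
        have : ∑ l ∈ (L.toFinset.erase i).filter (fun l => R l i),
            purchase (θ l) p (k - purchase (θ a) p k) ≤
            ∑ l ∈ (L.toFinset.erase i).filter (fun l => R l i), purchase (θ l) p k :=
          sum_le_sum fun l _ => purchase_mono (sub_le_self _ (purchase_nonneg hp hk))
        linarith
      · rw [sellAlong, Function.update_of_ne hai.symm, Function.update_of_ne hai, h3]

theorem divAlloc_nonneg (hp : 0 ≤ p) (hk : 0 ≤ k) (σ : Equiv.Perm (Fin n)) (S : Finset (Fin n))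
    (i : Fin n) : 0 ≤ divAlloc θ σ S p k i :=
  sellAlong_nonneg hp _ hk i

theorem sum_divAlloc_le (hp : 0 ≤ p) (hk : 0 ≤ k) (σ : Equiv.Perm (Fin n)) (S : Finset (Fin n)) :
    ∑ i, divAlloc θ σ S p k i ≤ k :=
  sum_sellAlong_le hp _ hk

/-- The supply that is left for a member `i` of `S` in the greedy allocation; it does not depend on
her type. -/
theorem exists_left_divAlloc (θ : Fin n → AgentType) (hp : 0 ≤ p) (hk : 0 ≤ k)
    (σ : Equiv.Perm (Fin n)) {S : Finset (Fin n)} (hi : i ∈ S) :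
    ∃ k', 0 ≤ k' ∧ k' ≤ k ∧
      k - ∑ l ∈ S.erase i with σ.symm l < σ.symm i, purchase (θ l) p k ≤ k' ∧
      ∀ τ, divAlloc (Function.update θ i τ) σ S p k i = purchase τ p k' := by
  have hnd : (List.ofFn σ).Nodup := List.nodup_ofFn.2 σ.injective
  have hpw : (List.ofFn σ).Pairwise fun l i => σ.symm l < σ.symm i := by
    rw [List.pairwise_ofFn]
    intro a b hab
    simpa using hab
  have hset : ((List.ofFn σ).filter fun i => i ∈ S).toFinset = S := by
    ext l
    simp only [List.mem_toFinset, List.mem_filter, List.mem_ofFn, decide_eq_true_eq]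
    exact ⟨fun h => h.2, fun h => ⟨⟨σ.symm l, by simp⟩, h⟩⟩
  have := exists_left θ hp (hnd.filter fun i => i ∈ S) (hpw.filter fun i => i ∈ S) hk
    (i := i) (by rw [← List.mem_toFinset, hset]; exact hi)
  rwa [hset] at this

end Greedy

/-! ### Outcomes of `RS_Liquid` -/

section RS

variable {n : ℕ} [NeZero n] (θ : Fin n → AgentType) (ω : RSCoins n)

theorem priceB_nonneg (i : Fin n) : 0 ≤ priceB θ ω i := by
  unfold priceB
  split_ifs <;> exact clearingPrice_nonneg _ _

theorem priceA_nonneg (i : Fin n) : 0 ≤ priceA θ ω i := by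
  unfold priceA
  split_ifs <;> exact clearingPrice_nonneg _ _

theorem requestB_nonneg (i : Fin n) : 0 ≤ requestB θ ω i := by
  unfold requestB
  split_ifs <;> exact divAlloc_nonneg (priceB_nonneg θ ω i) (by norm_num) _ _ _

variable {m₁ m₂ : ℝ}

theorem serveB_nonneg (L : List (Fin n)) (h₁ : 0 ≤ m₁) (h₂ : 0 ≤ m₂) (i : Fin n) :
    0 ≤ serveB θ ω L m₁ m₂ i := by
  induction L generalizing m₁ m₂ with
  | nil => exact le_rfl
  | cons a L ih =>
    rw [serveB]
    split_ifs <;> rw [Function.update_apply] <;> split_ifs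
    · exact le_min (requestB_nonneg θ ω a) h₁
    · exact ih (sub_nonneg.2 (min_le_right _ _)) h₂
    · exact le_min (requestB_nonneg θ ω a) h₂
    · exact ih h₁ (sub_nonneg.2 (min_le_right _ _))

theorem sum_serveB_le (L : List (Fin n)) (h₁ : 0 ≤ m₁) (h₂ : 0 ≤ m₂) :
    ∑ i, serveB θ ω L m₁ m₂ i ≤ m₁ + m₂ := by
  induction L generalizing m₁ m₂ with
  | nil => simpa [serveB] using add_nonneg h₁ h₂
  | cons a L ih =>
    rw [serveB]
    split_ifs
    · have h := sub_nonneg.2 (min_le_right (requestB θ ω a) m₁)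
      refine (sum_update_le a (serveB_nonneg θ ω L h h₂ a)).trans ?_
      linarith [ih h h₂]
    · have h := sub_nonneg.2 (min_le_right (requestB θ ω a) m₂)
      refine (sum_update_le a (serveB_nonneg θ ω L h₁ h a)).trans ?_
      linarith [ih h₁ h]

/-- In the revenue collection phase, agent `i` is served from what the earlier requests in her half
of `B` have left. -/
theorem serveB_eq {R : Fin n → Fin n → Prop} [DecidableRel R] (hirr : ∀ a, ¬R a a)
    (hasymm : ∀ a b, R a b → ¬R b a) {L : List (Fin n)} (hL : L.Nodup) (hR : L.Pairwise R)
    (h₁ : 0 ≤ m₁) (h₂ : 0 ≤ m₂) {i : Fin n} (hi : i ∈ L) :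
    serveB θ ω L m₁ m₂ i = min (requestB θ ω i) (max 0 ((if ω.coin i = true then m₁ else m₂) -
      ∑ l ∈ L.toFinset with R l i ∧ ω.coin l = ω.coin i, requestB θ ω l)) := by
  have hmax : ∀ m r x : ℝ, 0 ≤ m → 0 ≤ x → max 0 (m - min r m - x) = max 0 (m - (r + x)) := by
    intro m r x _ hx
    rcases le_total r m with h | h
    · rw [min_eq_left h, sub_sub]
    · rw [min_eq_right h, max_eq_left (by linarith), max_eq_left (by linarith)]
  induction L generalizing m₁ m₂ with
  | nil => simp at hi
  | cons a L ih =>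
    obtain ⟨hR1, hR2⟩ := List.pairwise_cons.1 hR
    obtain ⟨hL1, hL2⟩ := List.nodup_cons.1 hL
    rcases eq_or_ne a i with rfl | hai
    · have hempty : ((a :: L).toFinset.filter fun l => R l a ∧ ω.coin l = ω.coin a) = ∅ := by
        refine filter_false_of_mem fun l hl h => ?_
        rw [List.mem_toFinset, List.mem_cons] at hl
        rcases hl with rfl | hl
        · exact hirr _ h.1
        · exact hasymm _ _ h.1 (hR1 l hl)
      rw [hempty, sum_empty, sub_zero, serveB]
      split_ifs <;> simp [h₁, h₂]
    · have hiL : i ∈ L := (List.mem_cons.1 hi).resolve_left hai.symm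
      have hRa := hR1 i hiL
      set X := L.toFinset.filter fun l => R l i ∧ ω.coin l = ω.coin i with hX
      have hX0 : 0 ≤ ∑ l ∈ X, requestB θ ω l := sum_nonneg fun l _ => requestB_nonneg θ ω l
      have haX : a ∉ X := by simp [hX, hL1]
      by_cases hc : ω.coin a = ω.coin i
      · have hset : ((a :: L).toFinset.filter fun l => R l i ∧ ω.coin l = ω.coin i) =
            insert a X := by
          rw [List.toFinset_cons, filter_insert, if_pos ⟨hRa, hc⟩]
        rw [hset, sum_insert haX, serveB, hc]
        split_ifs with hci
        · rw [Function.update_of_ne hai.symm, ih hL2 hR2 (sub_nonneg.2 (min_le_right _ _)) h₂ hiL,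
            if_pos hci, hmax _ _ _ h₁ hX0]
        · rw [Function.update_of_ne hai.symm, ih hL2 hR2 h₁ (sub_nonneg.2 (min_le_right _ _)) hiL,
            if_neg hci, hmax _ _ _ h₂ hX0]
      · have hset : ((a :: L).toFinset.filter fun l => R l i ∧ ω.coin l = ω.coin i) = X := by
          rw [List.toFinset_cons, filter_insert, if_neg fun h => hc h.2]
        rw [hset, serveB]
        by_cases hca : ω.coin a = true
        · have hci : ¬ω.coin i = true := fun h => hc (hca.trans h.symm)
          rw [if_pos hca, Function.update_of_ne hai.symm,
            ih hL2 hR2 (sub_nonneg.2 (min_le_right _ _)) h₂ hiL, if_neg hci, if_neg hci]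
        · have hci : ω.coin i = true := by
            cases h1 : ω.coin i <;> cases h2 : ω.coin a <;> simp_all
          rw [if_neg hca, Function.update_of_ne hai.symm,
            ih hL2 hR2 h₁ (sub_nonneg.2 (min_le_right _ _)) hiL, if_pos hci, if_pos hci]

/-- The agents of `B₁` together get what they request, as long as supply lasts. -/
theorem sum_serveB_heads {L : List (Fin n)} (hL : L.Nodup) (h₁ : 0 ≤ m₁) :
    ∑ i ∈ L.toFinset with ω.coin i = true, serveB θ ω L m₁ m₂ i =
      min m₁ (∑ i ∈ L.toFinset with ω.coin i = true, requestB θ ω i) := by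
  induction L generalizing m₁ m₂ with
  | nil => simp [h₁]
  | cons a L ih =>
    obtain ⟨hL1, hL2⟩ := List.nodup_cons.1 hL
    have haX : a ∉ L.toFinset.filter fun l => ω.coin l = true := by simp [hL1]
    have hne : ∀ x ∈ L.toFinset.filter (fun l => ω.coin l = true), x ≠ a := by
      rintro x hx rfl
      exact haX hx
    rw [List.toFinset_cons, filter_insert]
    by_cases hca : ω.coin a = true
    · have h := sub_nonneg.2 (min_le_right (requestB θ ω a) m₁)
      rw [if_pos hca, sum_insert haX, sum_insert haX, serveB, if_pos hca, Function.update_self,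
        sum_congr rfl fun x hx => Function.update_of_ne (hne x hx) _ _, ih hL2 h]
      have h0 : 0 ≤ ∑ i ∈ L.toFinset with ω.coin i = true, requestB θ ω i :=
        sum_nonneg fun l _ => requestB_nonneg θ ω l
      rcases le_total (requestB θ ω a) m₁ with h' | h'
      · rw [min_eq_left h', ← min_add_add_left, add_sub_cancel]
      · rw [min_eq_right h', sub_self, min_eq_left h0, min_eq_left (by linarith), add_zero]
    · rw [if_neg hca, serveB, if_neg hca,
        sum_congr rfl fun x hx => Function.update_of_ne (hne x hx) _ _, ih hL2 h₁]

end RS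

/-! ### The order of arrival and the effect of one report on it -/

section Order

variable {n : ℕ} {θ θ' : Fin n → AgentType} {i l o : Fin n} {k : ℕ}

theorem agentAt_place (θ : Fin n → AgentType) (i : Fin n) : agentAt θ (place θ i) = i :=
  (agentAt θ).apply_symm_apply i

theorem place_agentAt (θ : Fin n → AgentType) (k : Fin n) : place θ (agentAt θ k) = k :=
  (agentAt θ).symm_apply_apply k

theorem place_injective (θ : Fin n → AgentType) : Function.Injective (place θ) :=
  (agentAt θ).symm.injective

theorem place_lt_iff : place θ l < place θ i ↔
    (θ l).arrival < (θ i).arrival ∨ ((θ l).arrival = (θ i).arrival ∧ l < i) := by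
  have hs := (Tuple.eq_sort_iff (f := fun i => (θ i).arrival) (σ := agentAt θ)).1 rfl
  have key : ∀ l i, place θ l < place θ i →
      (θ l).arrival < (θ i).arrival ∨ ((θ l).arrival = (θ i).arrival ∧ l < i) := by
    intro l i h
    have h1 := hs.1 h.le
    have h2 := hs.2 _ _ h
    simp only [Function.comp_apply, agentAt_place] at h1 h2
    exact h1.lt_or_eq.imp id fun h => ⟨h, h2 h⟩
  refine ⟨key l i, fun h => ?_⟩
  by_contra! hle
  rcases hle.lt_or_eq with h' | h'
  · rcases key i l h' with h1 | ⟨h1, h1'⟩ <;> rcases h with h2 | ⟨h2, h2'⟩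
    · exact absurd h1 h2.not_gt
    · exact absurd h2 h1.ne'
    · exact absurd h1 h2.ne'
    · exact absurd h1' h2'.not_gt
  · have := place_injective θ h'
    subst this
    rcases h with h | h
    · exact lt_irrefl _ h
    · exact lt_irrefl _ h.2

theorem arrival_le_of_place_le (h : place θ l ≤ place θ i) : (θ l).arrival ≤ (θ i).arrival := by
  rcases h.lt_or_eq with h | h
  · rcases place_lt_iff.1 h with h | h
    · exact h.le
    · exact h.1.le
  · rw [place_injective θ h]

theorem mem_firstAgents : i ∈ firstAgents θ k ↔ (place θ i : ℕ) < k := by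
  simp [firstAgents]

theorem firstAgents_mono {k' : ℕ} (h : k ≤ k') : firstAgents θ k ⊆ firstAgents θ k' := fun _ hi =>
  mem_firstAgents.2 ((mem_firstAgents.1 hi).trans_le h)

/-- The number of agents other than `i` who arrive before `o`; it does not depend on the report of
`i`. -/
def placeWithout (θ : Fin n → AgentType) (i o : Fin n) : ℕ :=
  #(univ.filter fun l => l ≠ i ∧ place θ l < place θ o)

theorem card_place_lt (θ : Fin n → AgentType) (o : Fin n) :
    #(univ.filter fun l => place θ l < place θ o) = place θ o := by
  have : (univ.filter fun l => place θ l < place θ o) =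
      (univ.filter fun k : Fin n => k < place θ o).map (agentAt θ).toEmbedding := by
    ext l
    simp only [mem_filter, mem_univ, true_and, mem_map, Equiv.coe_toEmbedding]
    constructor
    · exact fun h => ⟨_, h, agentAt_place θ l⟩
    · rintro ⟨k, hk, rfl⟩
      rwa [place_agentAt]
  rw [this, card_map, filter_gt_eq_Iio, Fin.card_Iio]

theorem placeWithout_eq_of_lt (h : place θ o < place θ i) : placeWithout θ i o = place θ o := by
  rw [← card_place_lt, placeWithout]
  congr 1
  ext l
  simp only [mem_filter, mem_univ, true_and, and_iff_right_iff_imp]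
  rintro h' rfl
  exact absurd h h'.not_gt

theorem placeWithout_eq_of_gt (h : place θ i < place θ o) : placeWithout θ i o + 1 = place θ o := by
  rw [← card_place_lt, placeWithout]
  have : (univ.filter fun l => place θ l < place θ o) =
      insert i (univ.filter fun l => l ≠ i ∧ place θ l < place θ o) := by
    ext l
    simp only [mem_filter, mem_univ, true_and, mem_insert]
    constructor
    · intro h'
      by_cases hl : l = i
      · exact Or.inl hl
      · exact Or.inr ⟨hl, h'⟩
    · rintro (rfl | h')
      · exact h
      · exact h'.2
  rw [this, card_insert_of_notMem (by simp)]

theorem placeWithout_congr (h : ∀ l, l ≠ i → θ l = θ' l) (ho : o ≠ i) :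
    placeWithout θ i o = placeWithout θ' i o := by
  unfold placeWithout
  congr 1
  ext l
  simp only [mem_filter, mem_univ, true_and, and_congr_right_iff]
  intro hl
  rw [place_lt_iff, place_lt_iff, h l hl, h o ho]

theorem mem_firstAgents_of_mem (hi : i ∈ firstAgents θ k) (ho : o ≠ i) :
    o ∈ firstAgents θ k ↔ placeWithout θ i o + 1 < k := by
  rw [mem_firstAgents] at hi ⊢
  rcases lt_trichotomy (place θ o) (place θ i) with h | h | h
  · have h1 := placeWithout_eq_of_lt h
    have h2 : (place θ o : ℕ) < place θ i := h
    omega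
  · exact absurd (place_injective θ h) ho
  · have h1 := placeWithout_eq_of_gt h
    omega

theorem mem_firstAgents_of_notMem (hi : i ∉ firstAgents θ k) (ho : o ≠ i) :
    o ∈ firstAgents θ k ↔ placeWithout θ i o < k := by
  rw [mem_firstAgents] at hi ⊢
  rcases lt_trichotomy (place θ o) (place θ i) with h | h | h
  · have h1 := placeWithout_eq_of_lt h
    omega
  · exact absurd (place_injective θ h) ho
  · have h1 := placeWithout_eq_of_gt h
    have h2 : (place θ i : ℕ) < place θ o := h
    omega

theorem firstAgents_congr_of_mem (h : ∀ l, l ≠ i → θ l = θ' l) (hi : i ∈ firstAgents θ k)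
    (hi' : i ∈ firstAgents θ' k) : firstAgents θ k = firstAgents θ' k := by
  ext o
  rcases eq_or_ne o i with rfl | ho
  · exact ⟨fun _ => hi', fun _ => hi⟩
  · rw [mem_firstAgents_of_mem hi ho, mem_firstAgents_of_mem hi' ho, placeWithout_congr h ho]

theorem firstAgents_congr_of_notMem (h : ∀ l, l ≠ i → θ l = θ' l) (hi : i ∉ firstAgents θ k)
    (hi' : i ∉ firstAgents θ' k) : firstAgents θ k = firstAgents θ' k := by
  ext o
  rcases eq_or_ne o i with rfl | ho
  · exact ⟨fun h => absurd h hi, fun h => absurd h hi'⟩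
  · rw [mem_firstAgents_of_notMem hi ho, mem_firstAgents_of_notMem hi' ho, placeWithout_congr h ho]

/-- If the report of `i` moves her out of the first `k + 1` agents, those who arrive before the last
of them are the others that had been there. -/
theorem firstAgents_erase (h : ∀ l, l ≠ i → θ l = θ' l) (hi : i ∈ firstAgents θ (k + 1))
    (hi' : i ∉ firstAgents θ' (k + 1)) : (firstAgents θ (k + 1)).erase i = firstAgents θ' k := by
  have hi'' : i ∉ firstAgents θ' k := fun h => hi' (firstAgents_mono k.le_succ h)
  ext o
  rcases eq_or_ne o i with rfl | ho
  · simp [hi'']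
  · rw [mem_erase, mem_firstAgents_of_mem hi ho, mem_firstAgents_of_notMem hi'' ho,
      placeWithout_congr h ho]
    simp [ho]

/-- An agent who reports a later arrival does not overtake anybody. -/
theorem place_lt_of_later (h : ∀ l, l ≠ i → θ l = θ' l) (hi : (θ i).arrival ≤ (θ' i).arrival)
    (hl : place θ l < place θ i) : place θ' l < place θ' i := by
  have hne : l ≠ i := by
    rintro rfl
    exact lt_irrefl _ hl
  rw [place_lt_iff] at hl ⊢
  rw [← h l hne]
  rcases hl with hl | hl
  · exact Or.inl (hl.trans_le hi)
  · rcases hi.lt_or_eq with hi | hi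
    · exact Or.inl (hl.1.trans_lt hi)
    · exact Or.inr ⟨hl.1.trans hi, hl.2⟩

theorem notMem_firstAgents_of_later (h : ∀ l, l ≠ i → θ l = θ' l)
    (hi : (θ i).arrival ≤ (θ' i).arrival) (hk : i ∉ firstAgents θ k) : i ∉ firstAgents θ' k := by
  rw [mem_firstAgents, not_lt] at hk ⊢
  refine hk.trans ?_
  rw [← card_place_lt, ← card_place_lt]
  refine card_le_card fun l hl => ?_
  rw [mem_filter] at hl ⊢
  exact ⟨hl.1, place_lt_of_later h hi hl.2⟩

/-- If a false report moves `i` into the first `k` agents, then all of these (including `i`) report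
to arrive before `i` really does. -/
theorem arrival_lt_of_mem_firstAgents (h : ∀ l, l ≠ i → θ l = θ' l)
    (hinj : Function.Injective fun l => (θ l).arrival) (hi : i ∉ firstAgents θ k)
    (hi' : i ∈ firstAgents θ' k) (hl : l ∈ firstAgents θ' k) : (θ' l).arrival < (θ i).arrival := by
  rcases eq_or_ne l i with rfl | hli
  · by_contra! hle
    exact notMem_firstAgents_of_later h hle hi hi'
  · rw [mem_firstAgents_of_mem hi' hli, ← placeWithout_congr h hli] at hl
    have hl' : l ∈ firstAgents θ k := by
      rw [mem_firstAgents_of_notMem hi hli]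
      omega
    rw [← h l hli]
    rw [mem_firstAgents] at hi hl'
    have hpl : place θ l < place θ i := by
      show (place θ l : ℕ) < place θ i
      omega
    exact (arrival_le_of_place_le hpl.le).lt_of_ne fun he => hli (hinj he)

theorem firstAgents_succ (θ : Fin n → AgentType) (hk : k < n) :
    firstAgents θ (k + 1) = insert (agentAt θ ⟨k, hk⟩) (firstAgents θ k) := by
  ext o
  rw [mem_insert, mem_firstAgents, mem_firstAgents]
  have : o = agentAt θ ⟨k, hk⟩ ↔ (place θ o : ℕ) = k := by
    rw [← Equiv.symm_apply_eq]
    exact Fin.ext_iff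
  rw [this]
  omega

theorem agentAt_notMem_firstAgents (θ : Fin n → AgentType) (hk : k < n) :
    agentAt θ ⟨k, hk⟩ ∉ firstAgents θ k := by
  rw [mem_firstAgents, place_agentAt]
  exact lt_irrefl k

theorem agentAt_congr (h : ∀ l, l ≠ i → θ l = θ' l) (hi : i ∉ firstAgents θ (k + 1))
    (hi' : i ∉ firstAgents θ' (k + 1)) (hk : k < n) : agentAt θ ⟨k, hk⟩ = agentAt θ' ⟨k, hk⟩ := by
  have h1 := firstAgents_congr_of_notMem h hi hi'
  have h2 := firstAgents_congr_of_notMem h (fun h => hi (firstAgents_mono k.le_succ h))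
    (fun h => hi' (firstAgents_mono k.le_succ h))
  have h3 : agentAt θ ⟨k, hk⟩ ∈ firstAgents θ' (k + 1) := by
    rw [← h1, firstAgents_succ θ hk]
    exact mem_insert_self _ _
  rw [firstAgents_succ θ' hk, mem_insert] at h3
  exact h3.resolve_right fun h => agentAt_notMem_firstAgents θ hk (h2 ▸ h)

theorem arrival_le_agentAt (hk : k < n) (hl : l ∈ firstAgents θ (k + 1)) :
    (θ l).arrival ≤ (θ (agentAt θ ⟨k, hk⟩)).arrival := by
  apply arrival_le_of_place_le
  rw [place_agentAt]
  exact Nat.lt_succ_iff.1 (mem_firstAgents.1 hl)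

theorem agentAt_mem_firstAgents (θ : Fin n → AgentType) (hk : k < n) :
    agentAt θ ⟨k, hk⟩ ∈ firstAgents θ (k + 1) := by
  rw [firstAgents_succ θ hk]
  exact mem_insert_self _ _

theorem arrival_le_of_mem_of_notMem (hl : l ∈ firstAgents θ k) (hi : i ∉ firstAgents θ k) :
    (θ l).arrival ≤ (θ i).arrival := by
  rw [mem_firstAgents] at hl hi
  apply arrival_le_of_place_le
  show (place θ l : ℕ) ≤ place θ i
  omega

end Order

/-! ### Feasibility -/

section Feasible

variable {n : ℕ}

theorem mix_feasible {μ : ℝ} {h₀ : 0 ≤ μ} {h₁ : μ ≤ 1} {M M' : Mechanism n} (h : M.Feasible)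
    (h' : M'.Feasible) : (mix μ h₀ h₁ M M').Feasible := by
  rintro θ (ω | ω)
  · exact h θ ω
  · exact h' θ ω

variable [NeZero n]

theorem allocB_nonneg (θ : Fin n → AgentType) (ω : RSCoins n) (i : Fin n) : 0 ≤ allocB θ ω i :=
  serveB_nonneg θ ω _ (by norm_num) (by norm_num) i

theorem allocA_nonneg (θ : Fin n → AgentType) (ω : RSCoins n) (i : Fin n) : 0 ≤ allocA θ ω i := by
  unfold allocA
  split_ifs <;> exact divAlloc_nonneg (clearingPrice_nonneg _ _) (by norm_num) _ _ _

theorem rsOutcome_amount_nonneg (θ : Fin n → AgentType) (ω : RSCoins n) (i : Fin n) :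
    0 ≤ (rsOutcome θ ω i).amount := by
  unfold rsOutcome
  split_ifs
  · exact allocA_nonneg θ ω i
  · exact le_rfl
  · exact allocB_nonneg θ ω i

theorem rsLiquid_feasible : (rsLiquid n).Feasible := by
  intro θ ω
  have h4 : (0 : ℝ) ≤ 1 / 4 := by norm_num
  refine ⟨rsOutcome_amount_nonneg θ ω, ?_⟩
  have h1 := sum_divAlloc_le (θ := θ) (clearingPrice_nonneg θ (setA₂ θ ω)) h4 ω.order₁ (setA₁ θ ω)
  have h2 := sum_divAlloc_le (θ := θ) (clearingPrice_nonneg θ (setA₁ θ ω)) h4 ω.order₂ (setA₂ θ ω)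
  have h3 := sum_serveB_le θ ω ((List.ofFn (agentAt θ)).drop (ω.tails + 1)) h4 h4
  have hle : ∀ i, (rsOutcome θ ω i).amount ≤
      divAlloc θ ω.order₁ (setA₁ θ ω) (clearingPrice θ (setA₂ θ ω)) (1 / 4) i +
      divAlloc θ ω.order₂ (setA₂ θ ω) (clearingPrice θ (setA₁ θ ω)) (1 / 4) i + allocB θ ω i := by
    intro i
    have g1 := divAlloc_nonneg (θ := θ) (clearingPrice_nonneg θ (setA₂ θ ω)) h4 ω.order₁
      (setA₁ θ ω) i
    have g2 := divAlloc_nonneg (θ := θ) (clearingPrice_nonneg θ (setA₁ θ ω)) h4 ω.order₂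
      (setA₂ θ ω) i
    have g3 := allocB_nonneg θ ω i
    unfold rsOutcome allocA
    split_ifs <;> dsimp only <;> linarith
  refine (sum_le_sum fun i _ => hle i).trans ?_
  rw [sum_add_distrib, sum_add_distrib]
  have h5 : ∑ i, allocB θ ω i ≤ 1 / 4 + 1 / 4 := h3
  linarith

theorem mvcg_feasible (γ : ℝ) : (mvcg n γ).Feasible := by
  intro θ heads
  have hone : ∀ i, (mvcgOutcome γ θ heads i).amount = 0 ∨ (mvcgOutcome γ θ heads i).amount = 1 := by
    intro i
    unfold mvcgOutcome
    split_ifs <;> simp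
  refine ⟨fun i => ?_, ?_⟩
  · show 0 ≤ (mvcgOutcome γ θ heads i).amount
    rcases hone i with h | h <;> rw [h]
    exact zero_le_one
  show ∑ i, (mvcgOutcome γ θ heads i).amount ≤ 1
  have huniq : ∀ i l, (mvcgOutcome γ θ heads i).amount ≠ 0 →
      (mvcgOutcome γ θ heads l).amount ≠ 0 → i = l := by
    intro i l hi hl
    unfold mvcgOutcome at hi hl
    cases heads
    · simp only [Bool.false_eq_true, if_false] at hi hl
      split_ifs at hi hl with h1 h2
      · by_contra hne
        rcases lt_or_gt_of_ne fun h => hne (place_injective θ h) with h | h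
        · exact h2.2 i h h1.1
        · exact h1.2 l h h2.1
      all_goals simp at hi hl
    · simp only [if_true] at hi hl
      split_ifs at hi hl with h1 h2
      · exact rankIn_inj h2.1 h1.1 (h1.2.1.trans h2.2.1.symm)
      all_goals simp at hi hl
  by_cases h : ∃ i, (mvcgOutcome γ θ heads i).amount ≠ 0
  · obtain ⟨i, hi⟩ := h
    rw [sum_eq_single i (fun l _ hl => by_contra fun h => hl (huniq l i h hi))
      fun h => absurd (mem_univ i) h]
    rcases hone i with h | h <;> rw [h]
    exact zero_le_one
  · push Not at h
    rw [sum_eq_zero fun i _ => h i]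
    exact zero_le_one

end Feasible

/-! ### Incentives: couplings of the coins -/

section Coupling

variable {n : ℕ}

/-- Every outcome for agent `i` under a misreport is matched, by a measure-preserving permutation of
the coins, with an outcome under the truth that is at least as good for her. -/
def Mechanism.Coupled (M : Mechanism n) : Prop :=
  ∀ θ : Fin n → AgentType, Function.Injective (fun l => (θ l).arrival) →
    ∀ i, 0 < (θ i).budget → ∀ r : AgentType, ∃ e : Equiv.Perm M.Coins,
      (∀ ω, M.prob (e ω) = M.prob ω) ∧
      ∀ ω, utility (θ i) (M.outcome (Function.update θ i r) ω i) ≤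
        utility (θ i) (M.outcome θ (e ω) i)

theorem Mechanism.Coupled.truthful {M : Mechanism n} (h : M.Coupled) : M.Truthful := by
  intro θ hinj i hb r
  obtain ⟨e, he, hle⟩ := h θ hinj i hb r
  unfold Mechanism.expectedUtility
  rw [← Equiv.sum_comp e fun ω => (M.prob ω : EReal) * utility (θ i) (M.outcome θ ω i)]
  refine sum_le_sum fun ω _ => ?_
  rw [he]
  exact mul_le_mul_of_nonneg_left (hle ω) (by exact_mod_cast M.prob_nonneg ω)

theorem Mechanism.individuallyRational_of_forall {M : Mechanism n}
    (h : ∀ θ i ω, 0 ≤ utility (θ i) (M.outcome θ ω i)) : M.IndividuallyRational := fun θ i =>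
  sum_nonneg fun ω _ => mul_nonneg (by exact_mod_cast M.prob_nonneg ω) (h θ i ω)

theorem Mechanism.Coupled.mix {μ : ℝ} {h₀ : 0 ≤ μ} {h₁ : μ ≤ 1} {M M' : Mechanism n}
    (h : M.Coupled) (h' : M'.Coupled) : (mix μ h₀ h₁ M M').Coupled := by
  intro θ hinj i hb r
  obtain ⟨e, he, hle⟩ := h θ hinj i hb r
  obtain ⟨e', he', hle'⟩ := h' θ hinj i hb r
  refine ⟨Equiv.sumCongr e e', ?_, ?_⟩
  · rintro (ω | ω)
    · exact congrArg (μ * ·) (he ω)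
    · exact congrArg ((1 - μ) * ·) (he' ω)
  · rintro (ω | ω)
    · exact hle ω
    · exact hle' ω

end Coupling

/-! ### Incentives in `RS_Liquid` -/

section RSIncentives

variable {n : ℕ}

theorem mem_listB {θ : Fin n → AgentType} {t : ℕ} {i : Fin n} :
    i ∈ (List.ofFn (agentAt θ)).drop t ↔ i ∉ firstAgents θ t := by
  rw [mem_firstAgents, not_lt, List.mem_drop_iff_getElem]
  constructor
  · rintro ⟨k, hk, rfl⟩
    rw [List.getElem_ofFn, place_agentAt]
    simp
  · intro h
    refine ⟨place θ i - t, ?_, ?_⟩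
    · simpa using by omega
    · rw [List.getElem_ofFn]
      convert agentAt_place θ i using 2
      exact Fin.ext (by simpa using by omega)

theorem listB_nodup (θ : Fin n → AgentType) (t : ℕ) :
    ((List.ofFn (agentAt θ)).drop t).Nodup :=
  (List.nodup_ofFn.2 (agentAt θ).injective).sublist (List.drop_sublist _ _)

theorem listB_pairwise (θ : Fin n → AgentType) (t : ℕ) :
    ((List.ofFn (agentAt θ)).drop t).Pairwise fun l i => place θ l < place θ i := by
  refine List.Pairwise.sublist (List.drop_sublist _ _) ?_
  rw [List.pairwise_ofFn]
  intro a b hab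
  rwa [place_agentAt, place_agentAt]

variable [NeZero n]

theorem lastAgent_mem_setA (θ : Fin n → AgentType) (ω : RSCoins n) :
    lastAgent θ ω ∈ setA θ ω :=
  agentAt_mem_firstAgents θ ω.tails_lt

theorem setA_erase_lastAgent (θ : Fin n → AgentType) (ω : RSCoins n) :
    (setA θ ω).erase (lastAgent θ ω) = firstAgents θ ω.tails := by
  rw [setA, firstAgents_succ θ ω.tails_lt]
  exact erase_insert (agentAt_notMem_firstAgents θ ω.tails_lt)

/-- The permutation that orders the part of `A` to which `i` belongs. -/
def orderA (θ : Fin n → AgentType) (ω : RSCoins n) (i : Fin n) : Equiv.Perm (Fin n) :=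
  if ω.coin i ≠ ω.coin (lastAgent θ ω) then ω.order₁ else ω.order₂

/-- An agent of `A` faces the price of those members of `A` whose coins differ from hers, and
competes with those whose coins agree. -/
theorem rsOutcome_of_mem {θ : Fin n → AgentType} {ω : RSCoins n} {i : Fin n} (hi : i ∈ setA θ ω) :
    let p := clearingPrice θ ((setA θ ω).filter fun l => ω.coin l ≠ ω.coin i)
    let x := divAlloc θ (orderA θ ω i) ((setA θ ω).filter fun l => ω.coin l = ω.coin i) p (1 / 4) i
    rsOutcome θ ω i = if (θ (lastAgent θ ω)).arrival ≤ (θ i).departure then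
      ⟨x, x * p, (θ (lastAgent θ ω)).arrival⟩ else ⟨0, 0, (θ (lastAgent θ ω)).arrival⟩ := by
  have hmem : i ∈ setA₁ θ ω ↔ ω.coin i ≠ ω.coin (lastAgent θ ω) := by
    simp [setA₁, hi]
  have hsets : (setA₁ θ ω = if ω.coin i ≠ ω.coin (lastAgent θ ω) then
        (setA θ ω).filter fun l => ω.coin l = ω.coin i
        else (setA θ ω).filter fun l => ω.coin l ≠ ω.coin i) ∧
      (setA₂ θ ω = if ω.coin i ≠ ω.coin (lastAgent θ ω) then
        (setA θ ω).filter fun l => ω.coin l ≠ ω.coin i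
        else (setA θ ω).filter fun l => ω.coin l = ω.coin i) := by
    unfold setA₁ setA₂
    constructor <;> split_ifs with h <;> refine filter_congr fun l _ => ?_ <;>
      cases h1 : ω.coin i <;> cases h2 : ω.coin l <;> cases h3 : ω.coin (lastAgent θ ω) <;>
      simp_all
  intro p x
  rw [rsOutcome, if_pos hi]
  have hx : allocA θ ω i = x := by
    rw [allocA]
    simp only [hmem, x, p, orderA]
    split_ifs with h
    · rw [hsets.1, hsets.2, if_pos h, if_pos h]
    · rw [hsets.1, hsets.2, if_neg h, if_neg h]
  have hp : priceA θ ω i = p := by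
    rw [priceA]
    simp only [hmem, p]
    split_ifs with h
    · rw [hsets.2, if_pos h]
    · rw [hsets.1, if_neg h]
  rw [hx, hp]

/-- The coin that agent `i` of `B` would need in order to meet, as a member of `A`, the same
competitors and the same price. -/
def sideB (θ : Fin n → AgentType) (ω : RSCoins n) (i : Fin n) : Bool :=
  if ω.coin i = true then !ω.coin (lastAgent θ ω) else ω.coin (lastAgent θ ω)

theorem setA_sides (θ : Fin n → AgentType) (ω : RSCoins n) :
    (setA₁ θ ω = (firstAgents θ ω.tails).filter fun l => ω.coin l ≠ ω.coin (lastAgent θ ω)) ∧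
    ((setA₂ θ ω).erase (lastAgent θ ω) =
      (firstAgents θ ω.tails).filter fun l => ω.coin l = ω.coin (lastAgent θ ω)) := by
  rw [setA₁, setA₂, ← setA_erase_lastAgent]
  constructor
  · ext l
    simp only [mem_filter, mem_erase]
    exact ⟨fun h => ⟨⟨fun he => h.2 (by rw [he]), h.1⟩, h.2⟩, fun h => ⟨h.1.2, h.2⟩⟩
  · ext l
    simp only [mem_filter, mem_erase]
    tauto

theorem priceB_eq (θ : Fin n → AgentType) (ω : RSCoins n) (i : Fin n) :
    priceB θ ω i =
      clearingPrice θ ((firstAgents θ ω.tails).filter fun l => ω.coin l ≠ sideB θ ω i) := by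
  rw [priceB, (setA_sides θ ω).1, (setA_sides θ ω).2, sideB]
  split_ifs
  · congr 1
    refine filter_congr fun l _ => ?_
    cases ω.coin l <;> cases ω.coin (lastAgent θ ω) <;> simp
  · rfl

theorem requestB_eq (θ : Fin n → AgentType) (ω : RSCoins n) (i : Fin n) :
    requestB θ ω i = divAlloc θ (ω.orderB i)
      (insert i ((firstAgents θ ω.tails).filter fun l => ω.coin l = sideB θ ω i))
      (priceB θ ω i) (1 / 4) i := by
  rw [requestB, (setA_sides θ ω).1, (setA_sides θ ω).2, sideB]
  split_ifs
  · congr 2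
    refine filter_congr fun l _ => ?_
    cases ω.coin l <;> cases ω.coin (lastAgent θ ω) <;> simp
  · rfl

/-- The supply that agent `i` of `B` finds in her half of `B`. -/
def leftB (θ : Fin n → AgentType) (ω : RSCoins n) (i : Fin n) : ℝ :=
  max 0 (1 / 4 - ∑ l with l ∉ setA θ ω ∧ place θ l < place θ i ∧ ω.coin l = ω.coin i,
    requestB θ ω l)

theorem leftB_nonneg (θ : Fin n → AgentType) (ω : RSCoins n) (i : Fin n) : 0 ≤ leftB θ ω i :=
  le_max_left _ _

theorem allocB_eq {θ : Fin n → AgentType} {ω : RSCoins n} {i : Fin n} (hi : i ∉ setA θ ω) :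
    allocB θ ω i = min (requestB θ ω i) (leftB θ ω i) := by
  have h4 : (0 : ℝ) ≤ 1 / 4 := by norm_num
  rw [allocB, serveB_eq θ ω (R := fun l i => place θ l < place θ i) (fun a => lt_irrefl _)
    (fun a b h => h.not_gt) (listB_nodup θ _) (listB_pairwise θ _) h4 h4 (mem_listB.2 hi), ite_self,
    leftB]
  congr 4
  ext l
  rw [mem_filter, mem_filter, List.mem_toFinset, mem_listB, setA]
  simp

theorem rsOutcome_of_notMem {θ : Fin n → AgentType} {ω : RSCoins n} {i : Fin n}
    (hi : i ∉ setA θ ω) : rsOutcome θ ω i = ⟨min (requestB θ ω i) (leftB θ ω i),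
      min (requestB θ ω i) (leftB θ ω i) * priceB θ ω i, (θ i).arrival⟩ := by
  rw [rsOutcome, if_neg hi, allocB_eq hi]

/-- The outcome of buying at price `p` from `k` units at time `t`, unless one departs before. -/
def served (τ : AgentType) (p k t : ℝ) : Outcome :=
  if t ≤ τ.departure then ⟨purchase τ p k, purchase τ p k * p, t⟩ else ⟨0, 0, t⟩

theorem utility_served_nonneg {τ : AgentType} {p k t : ℝ} (hp : 0 ≤ p) (hk : 0 ≤ k)
    (ht : τ.arrival ≤ t) : 0 ≤ utility τ (served τ p k t) := by
  unfold served
  split_ifs with h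
  · exact utility_nonneg_of_le_purchase hp (purchase_nonneg hp hk) le_rfl ⟨ht, h⟩
  · rw [utility_zero]

theorem utility_le_served {τ : AgentType} {p k x t t' : ℝ} (hp : 0 ≤ p) (hx : 0 ≤ x) (hxk : x ≤ k)
    (ht : τ.arrival ≤ t) (h : τ.arrival ≤ t' → t' ≤ τ.departure → t ≤ τ.departure) :
    utility τ ⟨x, x * p, t'⟩ ≤ utility τ (served τ p k t) := by
  by_cases hf : τ.arrival ≤ t' ∧ t' ≤ τ.departure
  · have h' := h hf.1 hf.2
    rw [served, if_pos h']
    exact utility_le_utility_purchase hp hx hxk hf ⟨ht, h'⟩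
  · exact (utility_nonpos (mul_nonneg hx hp) hf).trans
      (utility_served_nonneg hp (hx.trans hxk) ht)

/-- What agent `i` of `A` gets, in terms of her type: there is a supply, independent of her report,
from which she is served. -/
theorem exists_served_of_mem {θ : Fin n → AgentType} {ω : RSCoins n} {i : Fin n}
    (hi : i ∈ setA θ ω) : ∃ k, 0 ≤ k ∧
      (∀ τ, divAlloc (Function.update θ i τ) (orderA θ ω i)
        ((setA θ ω).filter fun l => ω.coin l = ω.coin i)
        (clearingPrice θ ((setA θ ω).filter fun l => ω.coin l ≠ ω.coin i)) (1 / 4) i =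
        purchase τ (clearingPrice θ ((setA θ ω).filter fun l => ω.coin l ≠ ω.coin i)) k) ∧
      rsOutcome θ ω i = served (θ i)
        (clearingPrice θ ((setA θ ω).filter fun l => ω.coin l ≠ ω.coin i)) k
        (θ (lastAgent θ ω)).arrival := by
  set p := clearingPrice θ ((setA θ ω).filter fun l => ω.coin l ≠ ω.coin i)
  have hmem : i ∈ (setA θ ω).filter fun l => ω.coin l = ω.coin i := mem_filter.2 ⟨hi, rfl⟩
  obtain ⟨k, h0, -, -, h⟩ := exists_left_divAlloc θ (clearingPrice_nonneg θ _ : 0 ≤ p)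
    (by norm_num : (0 : ℝ) ≤ 1 / 4) (orderA θ ω i) hmem
  refine ⟨k, h0, h, ?_⟩
  have h' := h (θ i)
  rw [Function.update_eq_self] at h'
  rw [rsOutcome_of_mem hi, served, h']

/-- What agent `i` of `B` requests, in terms of her type. -/
theorem exists_requestB (θ : Fin n → AgentType) (ω : RSCoins n) (i : Fin n) : ∃ k, 0 ≤ k ∧
    ∀ τ, divAlloc (Function.update θ i τ) (ω.orderB i)
      (insert i ((firstAgents θ ω.tails).filter fun l => ω.coin l = sideB θ ω i))
      (priceB θ ω i) (1 / 4) i = purchase τ (priceB θ ω i) k := by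
  obtain ⟨k, h0, -, -, h⟩ := exists_left_divAlloc θ (priceB_nonneg θ ω i)
    (by norm_num : (0 : ℝ) ≤ 1 / 4) (ω.orderB i) (mem_insert_self i
      ((firstAgents θ ω.tails).filter fun l => ω.coin l = sideB θ ω i))
  exact ⟨k, h0, h⟩

theorem rsOutcome_utility_nonneg (θ : Fin n → AgentType) (ω : RSCoins n) (i : Fin n) :
    0 ≤ utility (θ i) (rsOutcome θ ω i) := by
  by_cases hi : i ∈ setA θ ω
  · obtain ⟨k, h0, -, h⟩ := exists_served_of_mem hi
    rw [h]
    exact utility_served_nonneg (clearingPrice_nonneg _ _) h0 (arrival_le_agentAt ω.tails_lt hi)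
  · obtain ⟨k, h0, h⟩ := exists_requestB θ ω i
    have h' := h (θ i)
    rw [Function.update_eq_self, ← requestB_eq] at h'
    rw [rsOutcome_of_notMem hi]
    refine utility_nonneg_of_le_purchase (k := k) (priceB_nonneg θ ω i)
      (le_min (requestB_nonneg θ ω i) (leftB_nonneg θ ω i)) ?_ ⟨le_rfl, (θ i).arrival_le_departure⟩
    exact (min_le_left _ _).trans h'.le

end RSIncentives

section RSTruthful

variable {n : ℕ}

/-- The orders used by the calls of the greedy allocation. -/
abbrev Orders (n : ℕ) : Type :=
  Equiv.Perm (Fin n) × Equiv.Perm (Fin n) × (Fin n → Equiv.Perm (Fin n))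

/-- Exchange the orders of `A₁` and `A₂`. -/
def swapA : Equiv.Perm (Orders n) :=
  Function.Involutive.toPerm (fun q => (q.2.1, q.1, q.2.2)) fun _ => rfl

/-- Exchange the order of `A₁` with the one used for agent `i` of `B`. -/
def swapA₁B (i : Fin n) : Equiv.Perm (Orders n) :=
  Function.Involutive.toPerm (fun q => (q.2.2 i, q.2.1, Function.update q.2.2 i q.1)) fun q => by
    simp

/-- Exchange the order of `A₂` with the one used for agent `i` of `B`. -/
def swapA₂B (i : Fin n) : Equiv.Perm (Orders n) :=
  Function.Involutive.toPerm (fun q => (q.1, q.2.2 i, Function.update q.2.2 i q.2.1)) fun q => by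
    simp

/-- Turn the coin of `i` if the coin of `j` shows heads. -/
def turnCoin {i j : Fin n} (h : j ≠ i) : Equiv.Perm (Fin n → Bool) :=
  Function.Involutive.toPerm
    (fun c => Function.update c i (if c i = true then !c j else c j)) fun c => by
      funext l
      rcases eq_or_ne l i with rfl | hl
      · cases h1 : c l <;> cases h2 : c j <;> simp [Function.update_of_ne h, h1, h2]
      · simp [Function.update_of_ne hl]

variable [NeZero n] {θ θ' : Fin n → AgentType} {i : Fin n} {r : AgentType}

/-- A misreport that leaves `i` in `A` changes at most her demand: the set `A` is the same, and the
new last member of `A`, if it is not `i`, was there before. -/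
theorem rs_utility_le_of_mem {ω ω' : RSCoins n} (hi : i ∈ setA θ ω)
    (hi' : i ∈ setA (Function.update θ i r) ω') (hA : setA θ ω = setA (Function.update θ i r) ω')
    (hcoin : ω.coin = ω'.coin)
    (hord : orderA θ ω i = orderA (Function.update θ i r) ω' i) :
    utility (θ i) (rsOutcome (Function.update θ i r) ω' i) ≤
      utility (θ i) (rsOutcome θ ω i) := by
  obtain ⟨k, h0, hk, hout⟩ := exists_served_of_mem hi
  have hoff : ∀ l, l ≠ i → θ l = Function.update θ i r l := fun l hl => by
    rw [Function.update_of_ne hl]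
  have ht : (θ i).arrival ≤ (θ (lastAgent θ ω)).arrival := arrival_le_agentAt ω.tails_lt hi
  have hp : clearingPrice (Function.update θ i r) ((setA θ ω).filter fun l => ω.coin l ≠ ω.coin i) =
      clearingPrice θ ((setA θ ω).filter fun l => ω.coin l ≠ ω.coin i) := by
    refine clearingPrice_congr fun l hl => (hoff l ?_).symm
    rintro rfl
    exact (mem_filter.1 hl).2 rfl
  rw [hout, rsOutcome_of_mem hi', ← hA, ← hcoin, hp, ← hord, hk]
  split_ifs with hdep
  · refine utility_le_served (clearingPrice_nonneg _ _)
      (purchase_nonneg (clearingPrice_nonneg _ _) h0) (purchase_le h0) ht fun h1 h2 => ?_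
    rcases eq_or_ne (lastAgent θ ω) i with hl | hl
    · rw [hl]
      exact (θ i).arrival_le_departure
    · refine le_trans ?_ h2
      have := arrival_le_agentAt (θ := Function.update θ i r) ω'.tails_lt
        (hA ▸ lastAgent_mem_setA θ ω : lastAgent θ ω ∈ setA (Function.update θ i r) ω')
      rwa [← hoff _ hl] at this
  · rw [utility_zero]
    exact utility_served_nonneg (clearingPrice_nonneg _ _) h0 ht

/-- If a misreport moves `i` from `A` to `B`, then `A` without its last member under the misreport
is `A` without `i` under the truth, so that, for matching coins and orders, she is offered the same
price and the same supply, of which earlier agents of `B` may have bought some. -/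
theorem rs_utility_le_of_mem_of_notMem {ω ω' : RSCoins n} (hi : i ∈ setA θ ω)
    (hi' : i ∉ setA (Function.update θ i r) ω') (htails : ω.tails = ω'.tails)
    (hcoin : ω.coin = Function.update ω'.coin i (sideB (Function.update θ i r) ω' i))
    (hord : orderA θ ω i = ω'.orderB i) :
    utility (θ i) (rsOutcome (Function.update θ i r) ω' i) ≤
      utility (θ i) (rsOutcome θ ω i) := by
  obtain ⟨k, h0, hk, hout⟩ := exists_served_of_mem hi
  have hoff : ∀ l, l ≠ i → θ l = Function.update θ i r l := fun l hl => by
    rw [Function.update_of_ne hl]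
  have ht : (θ i).arrival ≤ (θ (lastAgent θ ω)).arrival := arrival_le_agentAt ω.tails_lt hi
  have hF : (setA θ ω).erase i = firstAgents (Function.update θ i r) ω'.tails := by
    have h1 : i ∉ firstAgents (Function.update θ i r) (ω.tails + 1) := by
      rw [htails]
      exact hi'
    have := firstAgents_erase hoff hi h1
    unfold setA
    rwa [htails] at this ⊢
  have hci : ω.coin i = sideB (Function.update θ i r) ω' i := by
    rw [hcoin, Function.update_self]
  have hcl : ∀ l, l ≠ i → ω.coin l = ω'.coin l := fun l hl => by
    rw [hcoin, Function.update_of_ne hl]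
  have hopp : (firstAgents (Function.update θ i r) ω'.tails).filter
      (fun l => ω'.coin l ≠ sideB (Function.update θ i r) ω' i) =
      (setA θ ω).filter fun l => ω.coin l ≠ ω.coin i := by
    rw [← hF]
    ext l
    rw [mem_filter, mem_filter, mem_erase, ← hci]
    constructor
    · rintro ⟨⟨h1, h2⟩, h3⟩
      exact ⟨h2, by rwa [hcl l h1]⟩
    · rintro ⟨h2, h3⟩
      have h1 : l ≠ i := by
        rintro rfl
        exact h3 rfl
      exact ⟨⟨h1, h2⟩, by rwa [← hcl l h1]⟩
  have hsame : insert i ((firstAgents (Function.update θ i r) ω'.tails).filter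
      (fun l => ω'.coin l = sideB (Function.update θ i r) ω' i)) =
      (setA θ ω).filter fun l => ω.coin l = ω.coin i := by
    rw [← hF]
    ext l
    rw [mem_insert, mem_filter, mem_filter, mem_erase, ← hci]
    rcases eq_or_ne l i with rfl | hl
    · simp [hi]
    · rw [hcl l hl]
      simp [hl]
  have hp : priceB (Function.update θ i r) ω' i =
      clearingPrice θ ((setA θ ω).filter fun l => ω.coin l ≠ ω.coin i) := by
    rw [priceB_eq, hopp]
    refine clearingPrice_congr fun l hl => (hoff l ?_).symm
    rintro rfl
    exact (mem_filter.1 hl).2 rfl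
  have hreq : requestB (Function.update θ i r) ω' i =
      purchase r (clearingPrice θ ((setA θ ω).filter fun l => ω.coin l ≠ ω.coin i)) k := by
    rw [requestB_eq, hsame, hp, ← hord, hk]
  rw [hout, rsOutcome_of_notMem hi', hp, hreq]
  refine utility_le_served (clearingPrice_nonneg _ _)
    (le_min (purchase_nonneg (clearingPrice_nonneg _ _) h0) (leftB_nonneg _ _ _))
    ((min_le_left _ _).trans (purchase_le h0)) ht fun h1 h2 => ?_
  rcases eq_or_ne (lastAgent θ ω) i with hl | hl
  · rw [hl]
    exact (θ i).arrival_le_departure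
  · refine le_trans ?_ h2
    have hmem : lastAgent θ ω ∈ firstAgents (Function.update θ i r) ω'.tails := by
      rw [← hF]
      exact mem_erase.2 ⟨hl, lastAgent_mem_setA θ ω⟩
    have := arrival_le_of_mem_of_notMem hmem fun h => hi' (firstAgents_mono (Nat.le_succ _) h)
    rwa [← hoff _ hl] at this

/-- An agent of `B` who enters `A` by a misreport is served before she arrives. -/
theorem rs_utility_le_of_notMem_of_mem (hinj : Function.Injective fun l => (θ l).arrival)
    {ω : RSCoins n} (hi : i ∉ setA θ ω) (hi' : i ∈ setA (Function.update θ i r) ω) :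
    utility (θ i) (rsOutcome (Function.update θ i r) ω i) ≤
      utility (θ i) (rsOutcome θ ω i) := by
  refine le_trans ?_ (rsOutcome_utility_nonneg θ ω i)
  have hoff : ∀ l, l ≠ i → θ l = Function.update θ i r l := fun l hl => by
    rw [Function.update_of_ne hl]
  have ht : (Function.update θ i r (lastAgent (Function.update θ i r) ω)).arrival <
      (θ i).arrival :=
    arrival_lt_of_mem_firstAgents hoff hinj hi hi' (lastAgent_mem_setA _ ω)
  rw [rsOutcome, if_pos hi']
  split_ifs
  · exact utility_nonpos (mul_nonneg (allocA_nonneg _ _ _) (priceA_nonneg _ _ _))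
      fun h => absurd h.1 ht.not_ge
  · exact utility_nonpos le_rfl fun h => absurd h.1 ht.not_ge

/-- Within `B`, reporting an earlier arrival means to be served too early, and reporting a later one
means to find less supply. -/
theorem rs_utility_le_of_notMem {ω : RSCoins n} (hi : i ∉ setA θ ω)
    (hi' : i ∉ setA (Function.update θ i r) ω) :
    utility (θ i) (rsOutcome (Function.update θ i r) ω i) ≤
      utility (θ i) (rsOutcome θ ω i) := by
  have hoff : ∀ l, l ≠ i → θ l = Function.update θ i r l := fun l hl => by
    rw [Function.update_of_ne hl]
  rcases lt_or_ge r.arrival (θ i).arrival with hr | hr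
  · refine le_trans ?_ (rsOutcome_utility_nonneg θ ω i)
    rw [rsOutcome, if_neg hi', Function.update_self]
    exact utility_nonpos (mul_nonneg (allocB_nonneg _ _ _) (priceB_nonneg _ _ _))
      fun h => absurd h.1 hr.not_ge
  have hA : setA θ ω = setA (Function.update θ i r) ω := firstAgents_congr_of_notMem hoff hi hi'
  have hF : firstAgents θ ω.tails = firstAgents (Function.update θ i r) ω.tails :=
    firstAgents_congr_of_notMem hoff (fun h => hi (firstAgents_mono (Nat.le_succ _) h))
      fun h => hi' (firstAgents_mono (Nat.le_succ _) h)
  have hiF : i ∉ firstAgents θ ω.tails := fun h => hi (firstAgents_mono (Nat.le_succ _) h)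
  have hlast : lastAgent θ ω = lastAgent (Function.update θ i r) ω :=
    agentAt_congr hoff hi hi' ω.tails_lt
  have hside : ∀ l, sideB θ ω l = sideB (Function.update θ i r) ω l := fun l => by
    rw [sideB, sideB, hlast]
  have hprice : ∀ l, priceB (Function.update θ i r) ω l = priceB θ ω l := fun l => by
    rw [priceB_eq, priceB_eq, ← hside, ← hF]
    refine clearingPrice_congr fun l' hl' => (hoff l' ?_).symm
    rintro rfl
    exact hiF (mem_filter.1 hl').1
  have hreq : ∀ l, l ≠ i → requestB (Function.update θ i r) ω l = requestB θ ω l := by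
    intro l hl
    -- The type of `i` does not enter into the requests of the other agents of `B`
    obtain ⟨k, -, -, -, hk⟩ := exists_left_divAlloc θ (priceB_nonneg θ ω l)
      (by norm_num : (0 : ℝ) ≤ 1 / 4) (ω.orderB l) (mem_insert_self l
        ((firstAgents θ ω.tails).filter fun l' => ω.coin l' = sideB θ ω l))
    rw [requestB_eq, requestB_eq, ← hside, hprice, ← hF]
    have hni : i ∉ insert l ((firstAgents θ ω.tails).filter fun l' => ω.coin l' = sideB θ ω l) := by
      simp [hiF, hl.symm]
    have hcongr : ∀ (L : List (Fin n)) (p k : ℝ), i ∉ L →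
        sellAlong (Function.update θ i r) p L k = sellAlong θ p L k := by
      intro L p
      induction L with
      | nil => exact fun _ _ => rfl
      | cons a L ih =>
        intro k hiL
        rw [List.mem_cons, not_or] at hiL
        rw [sellAlong, sellAlong, ← hoff a (Ne.symm hiL.1), ih _ hiL.2]
    unfold divAlloc
    rw [hcongr]
    simp [hiF, hl.symm]
  have hleft : leftB (Function.update θ i r) ω i ≤ leftB θ ω i := by
    refine max_le_max_left _ (sub_le_sub_left ?_ _)
    rw [← hA]
    have h1 : ∑ l with l ∉ setA θ ω ∧ place θ l < place θ i ∧ ω.coin l = ω.coin i,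
        requestB θ ω l = ∑ l with l ∉ setA θ ω ∧ place θ l < place θ i ∧ ω.coin l = ω.coin i,
        requestB (Function.update θ i r) ω l := by
      refine sum_congr rfl fun l hl => (hreq l ?_).symm
      rintro rfl
      exact lt_irrefl _ (mem_filter.1 hl).2.2.1
    rw [h1]
    refine sum_le_sum_of_subset_of_nonneg (fun l hl => ?_) fun l _ _ => requestB_nonneg _ _ _
    rw [mem_filter] at hl ⊢
    refine ⟨hl.1, hl.2.1, place_lt_of_later hoff ?_ hl.2.2.1, hl.2.2.2⟩
    rwa [Function.update_self]
  obtain ⟨k, h0, hk⟩ := exists_requestB θ ω i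
  have h1 : requestB θ ω i = purchase (θ i) (priceB θ ω i) k := by
    have := hk (θ i)
    rwa [Function.update_eq_self, ← requestB_eq] at this
  have h2 : requestB (Function.update θ i r) ω i = purchase r (priceB θ ω i) k := by
    rw [requestB_eq, ← hside, hprice, ← hF, hk]
  have hl0 := leftB_nonneg θ ω i
  rw [rsOutcome_of_notMem hi, rsOutcome_of_notMem hi', h1, h2, hprice, min_purchase hl0,
    Function.update_self]
  have hserved : (⟨purchase (θ i) (priceB θ ω i) (min k (leftB θ ω i)),
      purchase (θ i) (priceB θ ω i) (min k (leftB θ ω i)) * priceB θ ω i,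
      (θ i).arrival⟩ : Outcome) =
      served (θ i) (priceB θ ω i) (min k (leftB θ ω i)) (θ i).arrival := by
    rw [served, if_pos (θ i).arrival_le_departure]
  rw [hserved]
  refine utility_le_served (priceB_nonneg _ _ _)
    (le_min (purchase_nonneg (priceB_nonneg _ _ _) h0) (leftB_nonneg _ _ _))
    (min_le_min (purchase_le h0) hleft) le_rfl fun _ _ => (θ i).arrival_le_departure

/-- The coins of `i` and the orders are rearranged according to the phases in which `i` is served
under the truth and under the misreport; these phases depend on the first tosses only. -/
theorem rsLiquid_coupled : (rsLiquid n).Coupled := by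
  intro θ hinj i _ r
  have hoff : ∀ l, l ≠ i → θ l = Function.update θ i r l := fun l hl => by
    rw [Function.update_of_ne hl]
  have main : ∀ τ : Fin (n - 1) → Bool, ∃ e : Equiv.Perm ((Fin n → Bool) × Orders n), ∀ x,
      utility (θ i) (rsOutcome (Function.update θ i r) (τ, x) i) ≤
        utility (θ i) (rsOutcome θ (τ, e x) i) := by
    intro τ
    set ω₀ : RSCoins n := (τ, fun _ => true, 1, 1, fun _ => 1)
    by_cases hi : i ∈ setA θ ω₀ <;> by_cases hi' : i ∈ setA (Function.update θ i r) ω₀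
    · classical
      set j := lastAgent θ ω₀
      set j' := lastAgent (Function.update θ i r) ω₀
      refine ⟨Equiv.prodShear (Equiv.refl _) fun c =>
        if (c i = c j ↔ c i = c j') then Equiv.refl _ else swapA, ?_⟩
      rintro ⟨c, q⟩
      refine rs_utility_le_of_mem hi hi' (firstAgents_congr_of_mem hoff hi hi') rfl ?_
      show (if c i ≠ c j then _ else _) = if c i ≠ c j' then q.1 else q.2.1
      by_cases h1 : c i = c j <;> by_cases h2 : c i = c j' <;>
        simp [h1, h2, RSCoins.order₁, RSCoins.order₂, swapA] <;>
        simp_all <;> rfl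
    · set j := lastAgent θ ω₀
      set j' := lastAgent (Function.update θ i r) ω₀
      have hm : j' ∈ setA (Function.update θ i r) ω₀ := lastAgent_mem_setA _ ω₀
      have hji : j' ≠ i := fun h => hi' (by rwa [h] at hm)
      refine ⟨Equiv.prodShear (turnCoin hji) fun c =>
        if turnCoin hji c i ≠ turnCoin hji c j then swapA₁B i else swapA₂B i, ?_⟩
      rintro ⟨c, q⟩
      refine rs_utility_le_of_mem_of_notMem hi hi' rfl rfl ?_
      show (if turnCoin hji c i ≠ turnCoin hji c j then _ else _) = q.2.2 i
      by_cases h1 : turnCoin hji c i = turnCoin hji c j <;>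
        simp [h1, RSCoins.order₁, RSCoins.order₂, swapA₁B, swapA₂B] <;> rfl
    · exact ⟨Equiv.refl _, fun x => rs_utility_le_of_notMem_of_mem hinj hi hi'⟩
    · exact ⟨Equiv.refl _, fun x => rs_utility_le_of_notMem hi hi'⟩
  choose e he using main
  exact ⟨Equiv.prodShear (Equiv.refl _) e, fun _ => rfl, fun ω => he ω.1 ω.2⟩

end RSTruthful

/-! ### Incentives in `MVCG` -/

section MVCGTruthful

variable {n : ℕ} {τ : AgentType} {P P' t t' γ : ℝ}

theorem liquid_nonneg (τ : AgentType) : 0 ≤ τ.liquid := le_min τ.value_nonneg τ.budget_nonneg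

theorem utility_item_eq (hP : P ≤ τ.liquid) (ht : τ.arrival ≤ t ∧ t ≤ τ.departure) :
    utility τ ⟨1, P, t⟩ = ((τ.value - P : ℝ) : EReal) := by
  rw [utility_of_le_budget (o := ⟨1, P, t⟩) (hP.trans (min_le_right _ _)) ht]
  simp only [mul_one]

theorem utility_item_nonneg (hP : P ≤ τ.liquid) (ht : τ.arrival ≤ t ∧ t ≤ τ.departure) :
    0 ≤ utility τ ⟨1, P, t⟩ := by
  rw [utility_item_eq hP ht]
  exact_mod_cast sub_nonneg.2 (hP.trans (min_le_left _ _))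

theorem utility_item_nonpos (h0 : 0 ≤ P) (hP : τ.liquid < P) : utility τ ⟨1, P, t⟩ ≤ 0 := by
  by_cases ht : τ.arrival ≤ t ∧ t ≤ τ.departure
  · by_cases hb : τ.budget < P
    · rw [utility, if_pos hb]
      exact bot_le
    · rw [utility_of_le_budget (o := ⟨1, P, t⟩) (not_lt.1 hb) ht]
      have hv : τ.value < P := by
        rcases min_lt_iff.1 hP with h | h
        · exact h
        · exact absurd h hb
      simp only [mul_one]
      exact_mod_cast sub_nonpos.2 hv.le
  · exact utility_nonpos h0 ht

theorem mvcgPrice_nonneg (hγ : 1 < γ) (θ : Fin n → AgentType) (k : ℕ) : 0 ≤ mvcgPrice γ θ k :=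
  mul_nonneg (by linarith) (kthLargest_nonneg (fun i => liquid_nonneg (θ i)) k)

variable [NeZero n] {θ : Fin n → AgentType} {i l : Fin n}

theorem halfTime_mem (hi : i ∈ firstAgents θ (n / 2)) : ∃ j ∈ firstAgents θ (n / 2),
    halfTime θ = (θ j).arrival ∧ ∀ l ∈ firstAgents θ (n / 2), (θ l).arrival ≤ halfTime θ := by
  have hpos : n / 2 - 1 + 1 = n / 2 := by
    have := mem_firstAgents.1 hi
    omega
  have hlt : n / 2 - 1 < n := by
    have := NeZero.pos n
    omega
  have h1 := agentAt_mem_firstAgents θ hlt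
  rw [hpos] at h1
  refine ⟨_, h1, rfl, fun l hl => ?_⟩
  exact arrival_le_agentAt hlt (by rwa [hpos])

theorem mvcgOutcome_utility_nonneg (θ : Fin n → AgentType) (heads : Bool)
    (i : Fin n) : 0 ≤ utility (θ i) (mvcgOutcome γ θ heads i) := by
  unfold mvcgOutcome
  split_ifs with h1 h2 h2
  · obtain ⟨j, -, -, h⟩ := halfTime_mem h2.1
    exact utility_item_nonneg h2.2.2.1 ⟨h i h2.1, h2.2.2.2⟩
  · rw [utility_zero]
  · exact utility_item_nonneg h2.1.2 ⟨le_rfl, (θ i).arrival_le_departure⟩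
  · rw [utility_zero]

/-- To an agent of `A` who is still there when `A` is complete, the truth gives on heads at least
what she can get from the item at any price that is not below `γ` times the best competing liquid
value in `A`. -/
theorem utility_item_le_heads (hγ : 1 < γ) (hb : 0 < (θ i).budget)
    (hi : i ∈ firstAgents θ (n / 2)) {M : ℝ}
    (hM : IsTop ((firstAgents θ (n / 2)).erase i) (fun l => (θ l).liquid) M) (hP : γ * M ≤ P)
    (ht : (θ i).arrival ≤ t → t ≤ (θ i).departure → halfTime θ ≤ (θ i).departure) :
    utility (θ i) ⟨1, P, t⟩ ≤ utility (θ i) (mvcgOutcome γ θ true i) := by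
  have hu := mvcgOutcome_utility_nonneg (γ := γ) θ true i
  have hP0 : 0 ≤ P := (mul_nonneg (by linarith) hM.2.1).trans hP
  by_cases hf : (θ i).arrival ≤ t ∧ t ≤ (θ i).departure
  swap
  · exact (utility_nonpos hP0 hf).trans hu
  rcases lt_or_ge (θ i).liquid P with hlt | hge
  · exact (utility_item_nonpos hP0 hlt).trans hu
  rcases (liquid_nonneg (θ i)).eq_or_lt with h0 | h0
  · -- a positive budget: the liquid value vanishes only together with the value
    refine le_trans ?_ hu
    rw [utility_item_eq hge hf]
    have hv : (θ i).value = 0 := by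
      rcases min_choice (θ i).value (θ i).budget with h | h
      · exact h.symm.trans h0.symm
      · exact absurd (h.symm.trans h0.symm) hb.ne'
    rw [hv]
    exact_mod_cast (by linarith : (0 : ℝ) - P ≤ 0)
  have hrank : rankIn (firstAgents θ (n / 2)) (fun l => (θ l).liquid) i = 1 := by
    refine rankIn_eq_one hi fun l hl hli => ?_
    refine (hM.1 l (mem_erase.2 ⟨hli, hl⟩)).trans_lt ?_
    rcases hM.2.1.eq_or_lt with hM0 | hM0
    · rwa [← hM0]
    · refine lt_of_lt_of_le ?_ (hP.trans hge)
      nlinarith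
  have hp2 : mvcgPrice γ θ 2 = γ * M := by
    rw [mvcgPrice, (isTop_kthLargest_two (fun l => liquid_nonneg (θ l)) hi hrank).unique hM]
  have hdep := ht hf.1 hf.2
  obtain ⟨j, -, -, hj⟩ := halfTime_mem hi
  have hout : mvcgOutcome γ θ true i = ⟨1, γ * M, halfTime θ⟩ := by
    rw [mvcgOutcome, if_pos rfl, if_pos ⟨hi, hrank, by rw [hp2]; exact hP.trans hge, hdep⟩, hp2]
  rw [hout, utility_item_eq hge hf, utility_item_eq (hP.trans hge) ⟨hj i hi, hdep⟩]
  exact_mod_cast sub_le_sub_left hP _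

/-- Let `M` be the best liquid value of the others in `A`. An agent of `A` is offered the item at
price `γ M` on heads; if a misreport moves her to `B`, another agent joins `A`, and she is offered
the item at `γ M` or more on tails. An agent of `B` can enter `A` only by being served too early;
as long as she stays in `B`, the price is fixed, and a later arrival overtakes nobody. -/
theorem mvcg_coupled (hγ : 1 < γ) : (mvcg n γ).Coupled := by
  intro θ hinj i hb r
  set θ' := Function.update θ i r with hθ'
  have hoff : ∀ l, l ≠ i → θ l = θ' l := fun l hl => by
    rw [hθ', Function.update_of_ne hl]
  have hθi : θ' i = r := Function.update_self _ _ _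
  set h := n / 2 with hh
  have hu := mvcgOutcome_utility_nonneg (γ := γ) θ (i := i)
  have hliq : ∀ (S : Finset (Fin n)) (M : ℝ), i ∉ S → IsTop S (fun l => (θ' l).liquid) M →
      IsTop S (fun l => (θ l).liquid) M := fun S M hS hM =>
    hM.congr fun l hl => by
      rw [hoff l]
      rintro rfl
      exact hS hl
  have hzero : ∀ (heads : Bool) (ω : Bool), (mvcgOutcome γ θ' heads i = ⟨0, 0, halfTime θ'⟩ ∨
      mvcgOutcome γ θ' heads i = ⟨0, 0, (θ' i).arrival⟩) →
      utility (θ i) (mvcgOutcome γ θ' heads i) ≤ utility (θ i) (mvcgOutcome γ θ ω i) := by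
    rintro heads ω (h | h) <;> rw [h, utility_zero] <;> exact hu ω
  obtain ⟨M, hM⟩ : ∃ M, IsTop ((firstAgents θ h).erase i) (fun l => (θ l).liquid) M :=
    ⟨_, isTop_kthLargest_one fun l => liquid_nonneg (θ l)⟩
  by_cases hi : i ∈ firstAgents θ h <;> by_cases hi' : i ∈ firstAgents θ' h
  · refine ⟨Equiv.refl _, fun _ => rfl, fun heads => ?_⟩
    show utility (θ i) (mvcgOutcome γ θ' heads i) ≤ utility (θ i) (mvcgOutcome γ θ heads i)
    have hA := firstAgents_congr_of_mem hoff hi hi'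
    cases heads
    · refine hzero _ _ (Or.inr ?_)
      rw [mvcgOutcome, if_neg Bool.false_ne_true, if_neg fun h' => h'.1.1 hi']
    by_cases hw : i ∈ firstAgents θ' h ∧
        rankIn (firstAgents θ' h) (fun l => (θ' l).liquid) i = 1 ∧
        mvcgPrice γ θ' 2 ≤ (θ' i).liquid ∧ halfTime θ' ≤ (θ' i).departure
    swap
    · refine hzero _ _ (Or.inl ?_)
      rw [mvcgOutcome, if_pos rfl, if_neg hw]
    have hout : mvcgOutcome γ θ' true i = ⟨1, mvcgPrice γ θ' 2, halfTime θ'⟩ := by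
      rw [mvcgOutcome, if_pos rfl, if_pos hw]
    have hM' := hliq _ _ (notMem_erase _ _)
      (isTop_kthLargest_two (fun l => liquid_nonneg (θ' l)) hi' hw.2.1)
    rw [← hA] at hM'
    rw [hout]
    refine utility_item_le_heads hγ hb hi hM ?_ fun _ h2 => ?_
    · rw [mvcgPrice, ← hh, ← hA, hM.unique hM']
    · obtain ⟨j, hj, hjt, -⟩ := halfTime_mem hi
      obtain ⟨-, -, -, hj'⟩ := halfTime_mem hi'
      rw [hjt]
      rcases eq_or_ne j i with rfl | hji
      · exact (θ j).arrival_le_departure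
      · rw [hoff j hji]
        exact (hj' j (hA ▸ hj)).trans h2
  · refine ⟨Equiv.boolNot, fun _ => rfl, fun heads => ?_⟩
    show utility (θ i) (mvcgOutcome γ θ' heads i) ≤ utility (θ i) (mvcgOutcome γ θ (!heads) i)
    cases heads
    swap
    · refine hzero _ _ (Or.inl ?_)
      rw [mvcgOutcome, if_pos rfl, if_neg fun h' => hi' h'.1]
    by_cases hw : Surpasses γ θ' i ∧ ∀ l, place θ' l < place θ' i → ¬ Surpasses γ θ' l
    swap
    · refine hzero _ _ (Or.inr ?_)
      rw [mvcgOutcome, if_neg Bool.false_ne_true, if_neg hw]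
    have hout : mvcgOutcome γ θ' false i = ⟨1, mvcgPrice γ θ' 1, (θ' i).arrival⟩ := by
      rw [mvcgOutcome, if_neg Bool.false_ne_true, if_pos hw]
    have hsub : (firstAgents θ h).erase i ⊆ firstAgents θ' h := by
      intro l hl
      rw [mem_erase] at hl
      rw [mem_firstAgents_of_notMem hi' hl.1, ← placeWithout_congr hoff hl.1]
      have := (mem_firstAgents_of_mem hi hl.1).1 hl.2
      omega
    have hM' := hliq _ _ hi' (isTop_kthLargest_one fun l => liquid_nonneg (θ' l))
    rw [hout]
    refine utility_item_le_heads hγ hb hi hM ?_ fun _ h2 => ?_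
    · exact mul_le_mul_of_nonneg_left (hM.mono hM' hsub) (by linarith)
    · obtain ⟨j, hj, hjt, -⟩ := halfTime_mem hi
      rw [hjt]
      rcases eq_or_ne j i with rfl | hji
      · exact (θ j).arrival_le_departure
      · rw [hoff j hji]
        exact (arrival_le_of_mem_of_notMem (hsub (mem_erase.2 ⟨hji, hj⟩)) hi').trans h2
  · refine ⟨Equiv.refl _, fun _ => rfl, fun heads => ?_⟩
    show utility (θ i) (mvcgOutcome γ θ' heads i) ≤ utility (θ i) (mvcgOutcome γ θ heads i)
    cases heads
    · refine hzero _ _ (Or.inr ?_)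
      rw [mvcgOutcome, if_neg Bool.false_ne_true, if_neg fun h' => h'.1.1 hi']
    obtain ⟨j, hj, hjt, -⟩ := halfTime_mem hi'
    have ht : halfTime θ' < (θ i).arrival := by
      rw [hjt]
      exact arrival_lt_of_mem_firstAgents hoff hinj hi hi' hj
    refine le_trans (utility_nonpos ?_ ?_) (hu true) <;> rw [mvcgOutcome, if_pos rfl] <;> split_ifs
    · exact mvcgPrice_nonneg hγ _ _
    · exact le_rfl
    · exact fun h' => absurd h'.1 ht.not_ge
    · exact fun h' => absurd h'.1 ht.not_ge
  · refine ⟨Equiv.refl _, fun _ => rfl, fun heads => ?_⟩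
    show utility (θ i) (mvcgOutcome γ θ' heads i) ≤ utility (θ i) (mvcgOutcome γ θ heads i)
    have hA := firstAgents_congr_of_notMem hoff hi hi'
    cases heads
    swap
    · refine hzero _ _ (Or.inl ?_)
      rw [mvcgOutcome, if_pos rfl, if_neg fun h' => hi' h'.1]
    by_cases hw : Surpasses γ θ' i ∧ ∀ l, place θ' l < place θ' i → ¬ Surpasses γ θ' l
    swap
    · refine hzero _ _ (Or.inr ?_)
      rw [mvcgOutcome, if_neg Bool.false_ne_true, if_neg hw]
    have hout : mvcgOutcome γ θ' false i = ⟨1, mvcgPrice γ θ' 1, (θ' i).arrival⟩ := by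
      rw [mvcgOutcome, if_neg Bool.false_ne_true, if_pos hw]
    have hp1 : mvcgPrice γ θ' 1 = mvcgPrice γ θ 1 := by
      have h1 := hliq _ _ hi' (isTop_kthLargest_one fun l => liquid_nonneg (θ' l))
      have h2 := isTop_kthLargest_one (S := firstAgents θ h) fun l => liquid_nonneg (θ l)
      rw [← hA] at h1
      rw [mvcgPrice, mvcgPrice, ← hh, ← hA, h1.unique h2]
    rw [hout, hp1]
    rcases lt_or_ge (θ' i).arrival (θ i).arrival with hr | hr
    · exact (utility_nonpos (mvcgPrice_nonneg hγ _ _) fun h' => absurd h'.1 hr.not_ge).trans (hu _)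
    rcases lt_or_ge (θ i).liquid (mvcgPrice γ θ 1) with hlt | hge
    · exact (utility_item_nonpos (mvcgPrice_nonneg hγ _ _) hlt).trans (hu _)
    by_cases hf : (θ i).arrival ≤ (θ' i).arrival ∧ (θ' i).arrival ≤ (θ i).departure
    swap
    · exact (utility_nonpos (mvcgPrice_nonneg hγ _ _) hf).trans (hu _)
    have hwin : Surpasses γ θ i ∧ ∀ l, place θ l < place θ i → ¬ Surpasses γ θ l := by
      refine ⟨⟨hi, hge⟩, fun l hl hs => hw.2 l (place_lt_of_later hoff hr hl) ⟨?_, ?_⟩⟩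
      · rw [← hh, ← hA]
        exact hs.1
      · have hli : l ≠ i := by
          rintro rfl
          exact lt_irrefl _ hl
        rw [hp1, ← hoff l hli]
        exact hs.2
    have hout' : mvcgOutcome γ θ false i = ⟨1, mvcgPrice γ θ 1, (θ i).arrival⟩ := by
      rw [mvcgOutcome, if_neg Bool.false_ne_true, if_pos hwin]
    rw [hout', utility_item_eq hge hf,
      utility_item_eq hge ⟨le_rfl, (θ i).arrival_le_departure⟩]

end MVCGTruthful

/-! ### Random orders -/

section RandomOrder

variable {n : ℕ}

/-- The number of members of `T` that precede `i` in the order `σ`. -/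
def numBefore (T : Finset (Fin n)) (σ : Equiv.Perm (Fin n)) (i : Fin n) : ℕ :=
  #(T.filter fun l => σ.symm l < σ.symm i)

theorem symm_swap_mul (σ : Equiv.Perm (Fin n)) (a b l : Fin n) :
    (Equiv.swap a b * σ).symm l = σ.symm (Equiv.swap a b l) := by
  rw [Equiv.symm_apply_eq, Equiv.Perm.mul_apply, Equiv.apply_symm_apply, Equiv.swap_apply_self]

theorem swap_mem_iff {T : Finset (Fin n)} {a b : Fin n} (ha : a ∈ T) (hb : b ∈ T) (l : Fin n) :
    Equiv.swap a b l ∈ T ↔ l ∈ T := by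
  rw [Equiv.swap_apply_def]
  split_ifs with h1 h2
  · simp [h1, ha, hb]
  · simp [h2, ha, hb]
  · rfl

theorem numBefore_swap_mul {T : Finset (Fin n)} {a b : Fin n} (ha : a ∈ T) (hb : b ∈ T)
    (σ : Equiv.Perm (Fin n)) (i : Fin n) :
    numBefore T (Equiv.swap a b * σ) i = numBefore T σ (Equiv.swap a b i) := by
  unfold numBefore
  refine card_bij (fun l _ => Equiv.swap a b l) ?_ ?_ ?_
  · intro l hl
    rw [mem_filter] at hl ⊢
    rw [symm_swap_mul, symm_swap_mul] at hl
    exact ⟨(swap_mem_iff ha hb l).2 hl.1, hl.2⟩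
  · exact fun _ _ _ _ h => (Equiv.swap a b).injective h
  · intro l hl
    refine ⟨Equiv.swap a b l, ?_, Equiv.swap_apply_self _ _ _⟩
    rw [mem_filter] at hl ⊢
    rw [symm_swap_mul, symm_swap_mul, Equiv.swap_apply_self]
    exact ⟨(swap_mem_iff ha hb l).2 hl.1, hl.2⟩

theorem sum_numBefore_eq (T : Finset (Fin n)) (σ : Equiv.Perm (Fin n)) (φ : ℕ → ℝ) :
    ∑ i ∈ T, φ (numBefore T σ i) = ∑ k ∈ range #T, φ k := by
  have hrank : ∀ i ∈ T, rankIn T (fun l => -((σ.symm l : ℕ) : ℝ)) i = numBefore T σ i + 1 := by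
    intro i hi
    have : topUpTo T (fun l => -((σ.symm l : ℕ) : ℝ)) i =
        insert i (T.filter fun l => σ.symm l < σ.symm i) := by
      ext l
      simp only [topUpTo, mem_filter, mem_insert, neg_lt_neg_iff, Nat.cast_lt, neg_inj,
        Nat.cast_inj, Fin.val_fin_lt]
      constructor
      · rintro ⟨hl, h | ⟨h, -⟩⟩
        · exact Or.inr ⟨hl, h⟩
        · exact Or.inl (σ.symm.injective (Fin.ext h))
      · rintro (rfl | h)
        · exact ⟨hi, Or.inr ⟨rfl, le_rfl⟩⟩
        · exact ⟨h.1, Or.inl h.2⟩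
    rw [rankIn, this, card_insert_of_notMem (by simp), numBefore]
  have himg : T.image (numBefore T σ) = range #T := by
    ext k
    have := congrArg (k + 1 ∈ ·) (image_rankIn T fun l => -((σ.symm l : ℕ) : ℝ))
    simp only [mem_image, mem_Icc, eq_iff_iff] at this
    rw [mem_image, mem_range]
    constructor
    · rintro ⟨i, hi, h⟩
      have := (this.1 ⟨i, hi, by rw [hrank i hi, h]⟩).2
      omega
    · intro h
      obtain ⟨i, hi, h'⟩ := this.2 ⟨by omega, by omega⟩
      rw [hrank i hi] at h'
      exact ⟨i, hi, by omega⟩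
  rw [← himg, sum_image]
  intro a ha b hb h
  refine rankIn_inj (f := fun l => -((σ.symm l : ℕ) : ℝ)) hb ha ?_
  rw [hrank a ha, hrank b hb]
  exact congrArg (· + 1) h

/-- The place of a member of `T` in a random order of `T` is uniformly distributed. -/
theorem sum_perm_numBefore {T : Finset (Fin n)} {i : Fin n} (hi : i ∈ T) (φ : ℕ → ℝ) :
    (#T : ℝ) * ∑ σ : Equiv.Perm (Fin n), φ (numBefore T σ i) =
      Fintype.card (Equiv.Perm (Fin n)) * ∑ k ∈ range #T, φ k := by
  have hsymm : ∀ a ∈ T, ∑ σ : Equiv.Perm (Fin n), φ (numBefore T σ a) =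
      ∑ σ : Equiv.Perm (Fin n), φ (numBefore T σ i) := by
    intro a ha
    rw [← Equiv.sum_comp (Equiv.mulLeft (Equiv.swap i a))
      fun σ : Equiv.Perm (Fin n) => φ (numBefore T σ a)]
    refine sum_congr rfl fun σ _ => ?_
    rw [Equiv.coe_mulLeft, numBefore_swap_mul hi ha, Equiv.swap_apply_right]
  calc (#T : ℝ) * ∑ σ : Equiv.Perm (Fin n), φ (numBefore T σ i)
      = ∑ a ∈ T, ∑ σ : Equiv.Perm (Fin n), φ (numBefore T σ a) := by
        rw [sum_congr rfl hsymm, sum_const, nsmul_eq_mul]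
    _ = ∑ σ : Equiv.Perm (Fin n), ∑ k ∈ range #T, φ k := by
        rw [sum_comm]
        exact sum_congr rfl fun σ _ => sum_numBefore_eq T σ φ
    _ = _ := by rw [sum_const, card_univ, nsmul_eq_mul]

theorem numBefore_insert (W : Finset (Fin n)) (σ : Equiv.Perm (Fin n)) (i : Fin n) :
    numBefore (insert i W) σ i = numBefore W σ i := by
  rw [numBefore, numBefore, filter_insert, if_neg (lt_irrefl _)]

/-- The arithmetic of truncating a uniform place at `k = ⌊x⌋`, where `w = M x`. -/
theorem le_of_truncated_moments {w x M N S S1 h k : ℝ} (hw : 0 < w) (hM : 1 ≤ M) (hN0 : 0 ≤ N)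
    (hwx : w = M * x) (hk1 : k ≤ x) (hk2 : x < k + 1) (hk0 : 0 ≤ k)
    (hS1 : (w + 1) * S1 = N * (k + 1)) (hS2 : (w + 1) * (w * h) = N * ((k + 1) * k / 2))
    (hSge : S1 - M * h ≤ S) : N ≤ 2 * M * S := by
  have hM0 : 0 < M := by linarith
  have hx0 : 0 ≤ x := hk0.trans hk1
  have e1 : w * (w + 1) * (S1 - M * h) = N * ((k + 1) * (w - M * k / 2)) := by
    linear_combination w * hS1 - M * hS2
  have e2 : w * (w + 1) ≤ 2 * M * ((k + 1) * (w - M * k / 2)) := by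
    have h1 : M * x * (M * x + 1) ≤ M * (M * ((k + 1) * (2 * x - k))) := by
      have h3 : x ≤ (k + 1) * (2 * x - k) - x ^ 2 := by nlinarith
      have h4 : (k + 1) * (2 * x - k) - x ^ 2 ≤ M * ((k + 1) * (2 * x - k) - x ^ 2) := by
        nlinarith
      have h5 : x * (M * x + 1) ≤ M * ((k + 1) * (2 * x - k)) := by linarith
      calc M * x * (M * x + 1) = M * (x * (M * x + 1)) := by ring
        _ ≤ _ := mul_le_mul_of_nonneg_left h5 hM0.le
    rw [hwx]
    linarith
  have e3 : w * (w + 1) * N ≤ w * (w + 1) * (2 * M * S) := by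
    calc w * (w + 1) * N ≤ 2 * M * ((k + 1) * (w - M * k / 2)) * N :=
          mul_le_mul_of_nonneg_right e2 hN0
      _ = 2 * M * (w * (w + 1) * (S1 - M * h)) := by rw [e1]; ring
      _ ≤ 2 * M * (w * (w + 1) * S) := by
          have : 0 ≤ w * (w + 1) := by positivity
          gcongr
      _ = _ := by ring
  exact le_of_mul_le_mul_left e3 (by positivity)

/-- If the members of `W` together want `M ≥ 1` times the supply, then a newcomer in a random place
still finds, on average, the fraction `1 / (2 M)` of it. The proof counts only those orders in which
at most `⌊#W / M⌋` members of `W` precede `i`: the bound `1 - Z` for the fraction left is positive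
on average up to this place. -/
theorem card_le_sum_left {W : Finset (Fin n)} {i : Fin n} (hi : i ∉ W) {z : Fin n → ℝ} {M : ℝ}
    (hM : 1 ≤ M) (hzM : ∑ l ∈ W, z l ≤ M) :
    (Fintype.card (Equiv.Perm (Fin n)) : ℝ) ≤ 2 * M * ∑ σ : Equiv.Perm (Fin n),
      max 0 (1 - ∑ l ∈ W with σ.symm l < σ.symm i, z l) := by
  set N : ℝ := (Fintype.card (Equiv.Perm (Fin n)) : ℝ) with hN
  have hN0 : 0 ≤ N := Nat.cast_nonneg _
  rcases W.eq_empty_or_nonempty with rfl | hW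
  · simp only [filter_empty, sum_empty, sub_zero, sum_const, card_univ, nsmul_eq_mul]
    rw [← hN]
    norm_num
    nlinarith
  have hw : 0 < (#W : ℝ) := by exact_mod_cast hW.card_pos
  set w : ℝ := (#W : ℝ) with hw'
  set x : ℝ := w / M with hx
  have hM0 : 0 < M := by linarith
  have hwx : w = M * x := by
    rw [hx]
    field_simp
  have hx0 : 0 ≤ x := by positivity
  set k₀ : ℕ := ⌊x⌋₊ with hk₀
  have hk1 : (k₀ : ℝ) ≤ x := Nat.floor_le hx0
  have hk2 : x < k₀ + 1 := Nat.lt_floor_add_one x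
  have hkw : k₀ + 1 ≤ #W + 1 := by
    have : (k₀ : ℝ) ≤ #W := by
      rw [← hw']
      nlinarith
    have : k₀ ≤ #W := by exact_mod_cast this
    omega
  set I : ℕ → ℝ := fun k => if k < k₀ + 1 then 1 else 0 with hI
  have hcard : #(insert i W) = #W + 1 := card_insert_of_notMem hi
  have hfil : (range (#W + 1)).filter (fun k => k < k₀ + 1) = range (k₀ + 1) := by
    ext k
    simp only [mem_filter, mem_range]
    omega
  have hS1 : (w + 1) * ∑ σ : Equiv.Perm (Fin n), I (numBefore W σ i) = N * (k₀ + 1) := by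
    have := sum_perm_numBefore (mem_insert_self i W) I
    simp only [numBefore_insert, hcard] at this
    rw [hw', hN]
    push_cast at this
    rw [this, hI, ← sum_filter, hfil]
    simp
  have hS2 : (w + 1) * ∑ σ : Equiv.Perm (Fin n), I (numBefore W σ i) * numBefore W σ i =
      N * ((k₀ + 1) * k₀ / 2) := by
    have := sum_perm_numBefore (mem_insert_self i W) fun k => I k * k
    simp only [numBefore_insert, hcard] at this
    rw [hw', hN]
    push_cast at this
    rw [this]
    congr 1
    simp only [hI, ite_mul, one_mul, zero_mul]
    rw [← sum_filter, hfil, ← Nat.cast_sum, eq_div_iff two_ne_zero]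
    have := sum_range_id_mul_two (k₀ + 1)
    exact_mod_cast this
  -- By symmetry all members of `W` are equally likely to precede `i`
  set H : Fin n → ℝ := fun l => ∑ σ : Equiv.Perm (Fin n),
    I (numBefore W σ i) * (if σ.symm l < σ.symm i then 1 else 0) with hH
  have hHsymm : ∀ a ∈ W, ∀ b ∈ W, H a = H b := by
    intro a ha b hb
    rw [hH]
    simp only
    rw [← Equiv.sum_comp (Equiv.mulLeft (Equiv.swap a b))
      fun σ : Equiv.Perm (Fin n) => I (numBefore W σ i) * (if σ.symm a < σ.symm i then 1 else 0)]
    refine sum_congr rfl fun σ _ => ?_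
    have hia : i ≠ a := fun h => hi (h ▸ ha)
    have hib : i ≠ b := fun h => hi (h ▸ hb)
    rw [Equiv.coe_mulLeft, numBefore_swap_mul ha hb, symm_swap_mul, symm_swap_mul,
      Equiv.swap_apply_left, Equiv.swap_apply_of_ne_of_ne hia hib]
  have hHsum : ∑ l ∈ W, H l = ∑ σ : Equiv.Perm (Fin n), I (numBefore W σ i) * numBefore W σ i := by
    rw [hH, sum_comm]
    refine sum_congr rfl fun σ _ => ?_
    rw [← mul_sum, numBefore, ← sum_filter, sum_const, nsmul_eq_mul, mul_one]
  obtain ⟨a, ha⟩ := hW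
  have hHa : w * H a = ∑ σ : Equiv.Perm (Fin n), I (numBefore W σ i) * numBefore W σ i := by
    rw [← hHsum, sum_congr rfl fun l hl => hHsymm l hl a ha, sum_const, nsmul_eq_mul]
  have hHa0 : 0 ≤ H a := sum_nonneg fun σ _ => by
    simp only [hI]
    split_ifs <;> norm_num
  have hS3 : ∑ σ : Equiv.Perm (Fin n),
      I (numBefore W σ i) * (1 - ∑ l ∈ W with σ.symm l < σ.symm i, z l) ≥
      ∑ σ : Equiv.Perm (Fin n), I (numBefore W σ i) - M * H a := by
    have : ∑ σ : Equiv.Perm (Fin n),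
        I (numBefore W σ i) * ∑ l ∈ W with σ.symm l < σ.symm i, z l = ∑ l ∈ W, z l * H l := by
      simp only [hH, mul_sum]
      rw [sum_comm]
      refine sum_congr rfl fun σ _ => ?_
      rw [sum_filter]
      refine sum_congr rfl fun l _ => ?_
      split_ifs <;> ring
    simp only [mul_sub, mul_one, sum_sub_distrib]
    have hz' : ∑ l ∈ W, z l * H l = (∑ l ∈ W, z l) * H a := by
      rw [sum_mul]
      exact sum_congr rfl fun l hl => by rw [hHsymm l hl a ha]
    rw [this, hz']
    linarith [mul_le_mul_of_nonneg_right hzM hHa0]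
  have hS4 : ∑ σ : Equiv.Perm (Fin n),
      I (numBefore W σ i) * (1 - ∑ l ∈ W with σ.symm l < σ.symm i, z l) ≤
      ∑ σ : Equiv.Perm (Fin n), max 0 (1 - ∑ l ∈ W with σ.symm l < σ.symm i, z l) := by
    refine sum_le_sum fun σ _ => ?_
    simp only [hI]
    split_ifs
    · rw [one_mul]
      exact le_max_right _ _
    · rw [zero_mul]
      exact le_max_left _ _
  set S := ∑ σ : Equiv.Perm (Fin n), max 0 (1 - ∑ l ∈ W with σ.symm l < σ.symm i, z l)
  set S1 := ∑ σ : Equiv.Perm (Fin n), I (numBefore W σ i)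
  rw [← hHa] at hS2
  have hSge : S1 - M * H a ≤ S := hS3.le.trans hS4
  exact le_of_truncated_moments hw hM hN0 hwx hk1 hk2 (Nat.cast_nonneg _) hS1 hS2 hSge

/-- A newcomer to the greedy allocation gets on average at least the fraction `1 / (2 M)` of what
she would get alone, if the demand of the others is at most `M ≥ 1` times the supply. -/
theorem purchase_le_sum_divAlloc {θ : Fin n → AgentType} {W : Finset (Fin n)} {i : Fin n}
    (hi : i ∉ W) {p q : ℝ} (hp : 0 < p) (hq : 0 < q) {M : ℝ} (hM : 1 ≤ M)
    (hW : ∑ l ∈ W, purchase (θ l) p q ≤ M * q) :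
    Fintype.card (Equiv.Perm (Fin n)) * purchase (θ i) p q ≤
      2 * M * ∑ σ : Equiv.Perm (Fin n), divAlloc θ σ (insert i W) p q i := by
  have hz : ∑ l ∈ W, purchase (θ l) p q / q ≤ M := by
    rw [← sum_div, div_le_iff₀ hq]
    exact hW
  have h := card_le_sum_left hi hM hz
  have hle : ∀ σ : Equiv.Perm (Fin n), purchase (θ i) p q *
      max 0 (1 - ∑ l ∈ W with σ.symm l < σ.symm i, purchase (θ l) p q / q) ≤
      divAlloc θ σ (insert i W) p q i := by
    intro σ
    obtain ⟨k, h0, h1, h2, h3⟩ := exists_left_divAlloc θ hp.le hq.le σ (mem_insert_self i W)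
    have h4 := h3 (θ i)
    rw [Function.update_eq_self] at h4
    rw [h4]
    rw [erase_insert hi] at h2
    have hk : max 0 (1 - ∑ l ∈ W with σ.symm l < σ.symm i, purchase (θ l) p q / q) ≤ k / q := by
      refine max_le (by positivity) ?_
      rw [← sum_div, le_div_iff₀ hq, sub_mul, one_mul, div_mul_cancel₀ _ hq.ne']
      exact h2
    refine (mul_le_mul_of_nonneg_left hk (purchase_nonneg hp.le hq.le)).trans ?_
    unfold purchase
    split_ifs with g1 g2
    · exact absurd g2 hp.ne'
    · have hb := (θ i).budget_nonneg
      have hkq : k / q ≤ 1 := (div_le_one hq).2 h1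
      have hkq0 : 0 ≤ k / q := by positivity
      refine le_min ?_ ?_
      · calc min ((θ i).budget / p) q * (k / q) ≤ (θ i).budget / p * 1 := by
              apply mul_le_mul (min_le_left _ _) hkq hkq0 (by positivity)
          _ = _ := mul_one _
      · calc min ((θ i).budget / p) q * (k / q) ≤ q * (k / q) :=
              mul_le_mul_of_nonneg_right (min_le_right _ _) hkq0
          _ = k := by field_simp
    · simp
  calc (Fintype.card (Equiv.Perm (Fin n)) : ℝ) * purchase (θ i) p q
      ≤ (2 * M * ∑ σ : Equiv.Perm (Fin n),
        max 0 (1 - ∑ l ∈ W with σ.symm l < σ.symm i, purchase (θ l) p q / q)) *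
          purchase (θ i) p q :=
        mul_le_mul_of_nonneg_right h (purchase_nonneg hp.le hq.le)
    _ = 2 * M * ∑ σ : Equiv.Perm (Fin n), purchase (θ i) p q *
        max 0 (1 - ∑ l ∈ W with σ.symm l < σ.symm i, purchase (θ l) p q / q) := by
        rw [mul_assoc, sum_mul]
        congr 1
        exact sum_congr rfl fun _ _ => mul_comm _ _
    _ ≤ _ := mul_le_mul_of_nonneg_left (sum_le_sum fun σ _ => hle σ) (by linarith)

end RandomOrder

/-! ### Independent requests -/

section Independent

theorem one_sub_prod_le_sum {ι : Type*} (s : Finset ι) {t : ι → ℝ} (h0 : ∀ i ∈ s, 0 ≤ t i)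
    (h1 : ∀ i ∈ s, t i ≤ 1) : 1 - ∏ i ∈ s, (1 - t i) ≤ ∑ i ∈ s, t i := by
  classical
  induction s using Finset.induction_on with
  | empty => simp
  | insert a s ha ih =>
    rw [prod_insert ha, sum_insert ha]
    have h := ih (fun i hi => h0 i (mem_insert_of_mem hi)) fun i hi => h1 i (mem_insert_of_mem hi)
    have ha0 := h0 a (mem_insert_self a s)
    have hp : ∏ i ∈ s, (1 - t i) ≤ 1 := prod_le_one
      (fun i hi => sub_nonneg.2 (h1 i (mem_insert_of_mem hi)))
      fun i hi => sub_le_self _ (h0 i (mem_insert_of_mem hi))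
    nlinarith

/-- The expected value of the minimum of `1` and a sum of independent random variables in `[0, 1]`
is at least `1 - exp (-y)`, where `y` is the expected value of the sum. -/
theorem sum_min_one_sum_ge {ι α : Type*} [Fintype ι] [DecidableEq ι] [Fintype α] [DecidableEq α]
    [Nonempty α] (s : Finset ι) {t : ι → α → ℝ} (h0 : ∀ i a, 0 ≤ t i a) (h1 : ∀ i a, t i a ≤ 1)
    {y : ℝ} (hy : Fintype.card α * y ≤ ∑ i ∈ s, ∑ a, t i a) :
    Fintype.card (ι → α) * (1 - Real.exp (-y)) ≤ ∑ f : ι → α, min 1 (∑ i ∈ s, t i (f i)) := by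
  have hN : 0 < (Fintype.card α : ℝ) := by exact_mod_cast Fintype.card_pos
  set N : ℝ := (Fintype.card α : ℝ) with hN'
  have hprod : ∑ f : ι → α, ∏ i ∈ s, (1 - t i (f i)) ≤ N ^ Fintype.card ι * Real.exp (-y) := by
    have h2 : ∑ f : ι → α, ∏ i ∈ s, (1 - t i (f i)) =
        ∏ i, ∑ a, (if i ∈ s then 1 - t i a else 1) := by
      rw [prod_univ_sum, Fintype.piFinset_univ]
      refine sum_congr rfl fun f _ => ?_
      rw [prod_ite_mem, univ_inter]
    have h3 : ∀ i, ∑ a, (if i ∈ s then 1 - t i a else 1) ≤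
        N * Real.exp (-(if i ∈ s then (∑ a, t i a) / N else 0)) := by
      intro i
      split_ifs with hi
      · rw [sum_sub_distrib, sum_const, card_univ, nsmul_eq_mul, mul_one, ← hN']
        have := Real.add_one_le_exp (-((∑ a, t i a) / N))
        calc N - ∑ a, t i a = N * (-((∑ a, t i a) / N) + 1) := by field_simp; ring
          _ ≤ _ := mul_le_mul_of_nonneg_left this hN.le
      · simp [hN']
    rw [h2]
    refine (prod_le_prod (fun i _ => sum_nonneg fun a _ => ?_) fun i _ => h3 i).trans ?_
    · split_ifs
      · exact sub_nonneg.2 (h1 i a)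
      · exact zero_le_one
    · rw [prod_mul_distrib, prod_const, card_univ, ← Real.exp_sum, sum_neg_distrib, sum_ite_mem,
        univ_inter, ← sum_div]
      have : y ≤ (∑ i ∈ s, ∑ a, t i a) / N := by
        rw [le_div_iff₀ hN]
        linarith
      gcongr
  have hcard : (Fintype.card (ι → α) : ℝ) = N ^ Fintype.card ι := by
    rw [Fintype.card_fun]
    push_cast
    rfl
  calc (Fintype.card (ι → α) : ℝ) * (1 - Real.exp (-y))
      ≤ ∑ f : ι → α, (1 - ∏ i ∈ s, (1 - t i (f i))) := by
        rw [sum_sub_distrib, sum_const, card_univ, nsmul_eq_mul, mul_one, hcard]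
        linarith
    _ ≤ _ := by
        refine sum_le_sum fun f _ => le_min ?_ ?_
        · have : 0 ≤ ∏ i ∈ s, (1 - t i (f i)) := prod_nonneg fun i _ => sub_nonneg.2 (h1 i _)
          linarith
        · exact one_sub_prod_le_sum s (fun i _ => h0 i _) fun i _ => h1 i _

end Independent

/-! ### Revenue of `RS_Liquid` for a fixed sample -/

section Revenue

variable {n : ℕ}

/-- The amount that the members of `S` want at price `p` if each of them is faced with a supply of
`1 / 4`. -/
def demand (θ : Fin n → AgentType) (S : Finset (Fin n)) (p : ℝ) : ℝ :=
  ∑ l ∈ S, purchase (θ l) p (1 / 4)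

variable [NeZero n]

/-- The agents of `B₁`. -/
def setB₁ (θ : Fin n → AgentType) (ω : RSCoins n) : Finset (Fin n) :=
  univ.filter fun i => i ∉ setA θ ω ∧ ω.coin i = true

theorem requestB_of_mem_setB₁ {θ : Fin n → AgentType} {ω : RSCoins n} {i : Fin n}
    (hi : i ∈ setB₁ θ ω) : requestB θ ω i = divAlloc θ (ω.orderB i) (insert i (setA₁ θ ω))
      (clearingPrice θ ((setA₂ θ ω).erase (lastAgent θ ω))) (1 / 4) i := by
  have h := (mem_filter.1 hi).2.2
  rw [requestB, if_pos h, priceB, if_pos h]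

theorem sum_allocB_setB₁ (θ : Fin n → AgentType) (ω : RSCoins n) :
    ∑ i ∈ setB₁ θ ω, allocB θ ω i = min (1 / 4) (∑ i ∈ setB₁ θ ω, requestB θ ω i) := by
  have hset : setB₁ θ ω = ((List.ofFn (agentAt θ)).drop (ω.tails + 1)).toFinset.filter
      fun i => ω.coin i = true := by
    ext i
    rw [setB₁, mem_filter, mem_filter, List.mem_toFinset, mem_listB, setA]
    simp
  rw [hset]
  exact sum_serveB_heads θ ω (listB_nodup θ _) (by norm_num)

/-- The liquid welfare is at least the revenue from `B₁`. -/
theorem revenue_le_liquidWelfare (θ : Fin n → AgentType) (ω : RSCoins n) :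
    clearingPrice θ ((setA₂ θ ω).erase (lastAgent θ ω)) *
      min (1 / 4) (∑ i ∈ setB₁ θ ω, requestB θ ω i) ≤
    liquidWelfare (fun i => (θ i).value) (fun i => (θ i).budget)
      fun i => (rsOutcome θ ω i).amount := by
  set p := clearingPrice θ ((setA₂ θ ω).erase (lastAgent θ ω)) with hp
  have hp0 : 0 ≤ p := clearingPrice_nonneg _ _
  rw [← sum_allocB_setB₁, mul_sum]
  refine (sum_le_sum fun i hi => ?_).trans (sum_le_sum_of_subset_of_nonneg (subset_univ _)
    fun i _ _ => le_min (mul_nonneg (θ i).value_nonneg (rsOutcome_amount_nonneg θ ω i))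
      (θ i).budget_nonneg)
  have hiA := (mem_filter.1 hi).2.1
  have hc := (mem_filter.1 hi).2.2
  have hpi : priceB θ ω i = p := by rw [priceB, if_pos hc]
  obtain ⟨k, h0, hk⟩ := exists_requestB θ ω i
  have hreq := hk (θ i)
  rw [Function.update_eq_self, ← requestB_eq, hpi] at hreq
  have hx : allocB θ ω i ≤ purchase (θ i) p k := by
    rw [allocB_eq hiA, hreq]
    exact min_le_left _ _
  have hx0 := allocB_nonneg θ ω i
  have hamt : (rsOutcome θ ω i).amount = allocB θ ω i := by rw [rsOutcome, if_neg hiA]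
  show p * allocB θ ω i ≤ min ((θ i).value * (rsOutcome θ ω i).amount) (θ i).budget
  rw [hamt]
  refine le_min ?_ ?_
  · rcases le_or_gt p (θ i).value with h | h
    · exact mul_le_mul_of_nonneg_right h hx0
    · rw [purchase_eq_zero h] at hx
      rw [le_antisymm hx hx0]
      simp
  · calc p * allocB θ ω i ≤ p * purchase (θ i) p k := mul_le_mul_of_nonneg_left hx hp0
      _ = purchase (θ i) p k * p := mul_comm _ _
      _ ≤ _ := purchase_mul_le hp0

/-- Given the sample, the revenue from `B₁` is at least a constant fraction of the price, provided
that `B₁` wants at least the supply of `1 / 4` and at least as much as the competing half `A₁` of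
the sample. -/
theorem card_orders_mul_le (θ : Fin n → AgentType) (τ : Fin (n - 1) → Bool) (c : Fin n → Bool)
    {Y W U : Finset (Fin n)} {p : ℝ}
    (hY : ∀ q : Orders n, (setA₂ θ (τ, c, q)).erase (lastAgent θ (τ, c, q)) = Y)
    (hW : ∀ q : Orders n, setA₁ θ (τ, c, q) = W) (hU : ∀ q : Orders n, setB₁ θ (τ, c, q) = U)
    (hp : p = clearingPrice θ Y) (h1 : 1 / 4 ≤ demand θ U p) (h2 : demand θ W p ≤ demand θ U p) :
    Fintype.card (Orders n) * ((1 - Real.exp (-(1 / 2))) / 4 * p) ≤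
      ∑ q : Orders n, liquidWelfare (fun i => (θ i).value) (fun i => (θ i).budget)
        fun i => (rsOutcome θ (τ, c, q) i).amount := by
  have hp0 : 0 ≤ p := hp ▸ clearingPrice_nonneg _ _
  rcases hp0.eq_or_lt with hp00 | hppos
  · rw [← hp00, mul_zero, mul_zero]
    exact sum_nonneg fun q _ => sum_nonneg fun i _ => le_min
      (mul_nonneg (θ i).value_nonneg (rsOutcome_amount_nonneg θ _ i)) (θ i).budget_nonneg
  set N : ℝ := (Fintype.card (Equiv.Perm (Fin n)) : ℝ) with hN
  set t : Fin n → Equiv.Perm (Fin n) → ℝ := fun i σ => 4 * divAlloc θ σ (insert i W) p (1 / 4) i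
    with ht
  have h4 : (0 : ℝ) ≤ 1 / 4 := by norm_num
  have ht0 : ∀ i σ, 0 ≤ t i σ := fun i σ =>
    mul_nonneg (by norm_num) (divAlloc_nonneg hp0 h4 _ _ _)
  have ht1 : ∀ i σ, t i σ ≤ 1 := by
    intro i σ
    have := (single_le_sum (f := divAlloc θ σ (insert i W) p (1 / 4))
      (fun l _ => divAlloc_nonneg hp0 h4 _ _ l) (mem_univ i)).trans
      (sum_divAlloc_le (θ := θ) hp0 h4 σ (insert i W))
    simp only [ht]
    linarith
  set D := demand θ U p with hD
  have hUW : ∀ i ∈ U, i ∉ W := by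
    intro i hi hiW
    rw [← hU 1, setB₁] at hi
    rw [← hW 1, setA₁] at hiW
    exact (mem_filter.1 hi).2.1 (mem_filter.1 hiW).1
  have hy : N * (1 / 2) ≤ ∑ i ∈ U, ∑ σ, t i σ := by
    have h3 : ∀ i ∈ U, N * purchase (θ i) p (1 / 4) ≤ 2 * D * ∑ σ, t i σ := by
      intro i hi
      have := purchase_le_sum_divAlloc (θ := θ) (hUW i hi) hppos (by norm_num : (0 : ℝ) < 1 / 4)
        (M := 4 * D) (by linarith) (by rw [← demand]; linarith)
      rw [← hN] at this
      simp only [ht, ← mul_sum]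
      linarith
    have h5 := sum_le_sum h3
    rw [← mul_sum, ← mul_sum, ← demand, ← hD] at h5
    have hDpos : 0 < D := by linarith
    refine le_of_mul_le_mul_left (a := 2 * D) ?_ (by linarith)
    linarith
  have hind := sum_min_one_sum_ge U ht0 ht1 hy
  have hq : ∀ q : Orders n, p / 4 * min 1 (∑ i ∈ U, t i (q.2.2 i)) ≤
      liquidWelfare (fun i => (θ i).value) (fun i => (θ i).budget)
        fun i => (rsOutcome θ (τ, c, q) i).amount := by
    intro q
    refine le_trans (le_of_eq ?_) (revenue_le_liquidWelfare θ (τ, c, q))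
    have hsum : ∑ i ∈ setB₁ θ (τ, c, q), requestB θ (τ, c, q) i =
        1 / 4 * ∑ i ∈ U, t i (q.2.2 i) := by
      rw [mul_sum, hU]
      refine sum_congr rfl fun i hi => ?_
      rw [requestB_of_mem_setB₁ (by rw [hU]; exact hi), hY, hW, ← hp]
      simp only [ht, RSCoins.orderB]
      ring
    rw [hY, ← hp, hsum]
    have : min (1 / 4) (1 / 4 * ∑ i ∈ U, t i (q.2.2 i)) =
        1 / 4 * min 1 (∑ i ∈ U, t i (q.2.2 i)) := by
      rw [mul_min_of_nonneg _ _ h4, mul_one]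
    rw [this]
    ring
  refine le_trans ?_ (sum_le_sum fun q _ => hq q)
  rw [← mul_sum, Fintype.sum_prod_type]
  simp only [Fintype.sum_prod_type, sum_const, card_univ, nsmul_eq_mul, Fintype.card_prod,
    Nat.cast_mul]
  rw [← hN]
  calc N * (N * (Fintype.card (Fin n → Equiv.Perm (Fin n)) : ℝ)) *
        ((1 - Real.exp (-(1 / 2))) / 4 * p)
      = p / 4 * (N * (N * ((Fintype.card (Fin n → Equiv.Perm (Fin n)) : ℝ) *
        (1 - Real.exp (-(1 / 2)))))) := by ring
    _ ≤ _ := by gcongr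

end Revenue

/-! ### The law of the sample -/

section Law

variable {n : ℕ}

/-- The number of tails among the tosses `τ`. -/
def numTails (τ : Fin (n - 1) → Bool) : ℕ := #(univ.filter fun k => τ k = false)

/-- The first `t` positions are filled with the agents of `s`, the next one with `j`. -/
theorem exists_perm_of_notMem {j : Fin n} {s : Finset (Fin n)} (hj : j ∉ s) (h : #s < n) :
    ∃ σ : Equiv.Perm (Fin n), σ ⟨#s, h⟩ = j ∧
      (univ.filter fun k : Fin n => (k : ℕ) < #s).image σ = s := by
  set f : Option s → Fin n := fun o => o.elim ⟨#s, h⟩ fun x => Fin.castLE h.le (s.equivFin x)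
    with hf
  set g : Option s → Fin n := fun o => o.elim j fun x => x with hg
  have hfinj : Function.Injective f := by
    rintro (_ | x) (_ | y) hxy
    · rfl
    · have := congrArg Fin.val hxy
      simp only [hf, Option.elim, Fin.val_castLE] at this
      have h2 := (s.equivFin y).isLt
      omega
    · have := congrArg Fin.val hxy
      simp only [hf, Option.elim, Fin.val_castLE] at this
      have h2 := (s.equivFin x).isLt
      omega
    · exact congrArg some (s.equivFin.injective (Fin.castLE_injective h.le hxy))
  have hginj : Function.Injective g := by
    rintro (_ | x) (_ | y) hxy
    · rfl
    · exact absurd y.2 (by rw [← show j = y from hxy]; exact hj)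
    · exact absurd x.2 (by rw [show (x : Fin n) = j from hxy]; exact hj)
    · exact congrArg some (Subtype.ext hxy)
  obtain ⟨σ, hσ⟩ := Equiv.Perm.exists_extending_pair f g hfinj hginj
  refine ⟨σ, hσ none, ?_⟩
  ext l
  simp only [mem_image, mem_filter, mem_univ, true_and]
  constructor
  · rintro ⟨k, hk, rfl⟩
    have := hσ (some (s.equivFin.symm ⟨k, hk⟩))
    simp only [hf, hg, Option.elim, Equiv.apply_symm_apply] at this
    have hkk : (Fin.castLE h.le ⟨(k : ℕ), hk⟩ : Fin n) = k := rfl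
    rw [hkk] at this
    rw [this]
    exact Subtype.coe_prop _
  · intro hl
    exact ⟨f (some ⟨l, hl⟩), (s.equivFin ⟨l, hl⟩).isLt, hσ (some ⟨l, hl⟩)⟩

/-- The number of tails is distributed like the number of elements of a random set of agents other
than `j`. -/
theorem sum_tosses (g : ℕ → ℝ) {j : Fin n} :
    ∑ τ : Fin (n - 1) → Bool, g (numTails τ) = ∑ s ∈ (univ.erase j).powerset, g #s := by
  have hcard : #((univ : Finset (Fin n)).erase j) = n - 1 := by
    rw [card_erase_of_mem (mem_univ j), card_univ, Fintype.card_fin]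
  have h1 : ∑ τ : Fin (n - 1) → Bool, g (numTails τ) =
      ∑ s ∈ (univ : Finset (Fin (n - 1))).powerset, g #s := by
    refine sum_bij' (fun τ _ => univ.filter fun k => τ k = false)
      (fun s _ k => if k ∈ s then false else true) ?_ ?_ ?_ ?_ ?_
    · simp
    · simp
    · intro τ _
      funext k
      cases h : τ k <;> simp [h]
    · intro s _
      ext k
      simp
    · exact fun _ _ => rfl
  rw [h1, sum_powerset_apply_card, sum_powerset_apply_card, hcard, card_univ, Fintype.card_fin]

theorem sum_powerset_erase {j : Fin n} (H : Finset (Fin n) → ℝ) :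
    ∑ s ∈ (univ.erase j).powerset, H s = ∑ s : Finset (Fin n), if j ∉ s then H s else 0 := by
  rw [← sum_filter]
  refine sum_congr ?_ fun _ _ => rfl
  ext s
  simp only [mem_powerset, mem_filter, mem_univ, true_and]
  exact ⟨fun h hj => notMem_erase j _ (h hj), fun h l hl =>
    mem_erase.2 ⟨fun he => h (he ▸ hl), mem_univ l⟩⟩

variable [NeZero n]

theorem numTails_lt (τ : Fin (n - 1) → Bool) : numTails τ < n :=
  RSCoins.tails_lt (n := n) (τ, fun _ => true, 1, 1, fun _ => 1)

/-- In a random arrival order, the last agent `j` of the sample is uniformly distributed, and each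
of the others joins the sample with probability `1 / 2`, independently. -/
theorem sum_perm_sum_tosses (H : Fin n → Finset (Fin n) → ℝ) :
    n * ∑ π : Equiv.Perm (Fin n), ∑ τ : Fin (n - 1) → Bool,
      H (π ⟨numTails τ, numTails_lt τ⟩)
        ((univ.filter fun k : Fin n => (k : ℕ) < numTails τ).image π) =
    Fintype.card (Equiv.Perm (Fin n)) * ∑ j, ∑ s ∈ (univ.erase j).powerset, H j s := by
  set g : ℕ → ℝ := fun t => if h : t < n then ∑ π : Equiv.Perm (Fin n),
    H (π ⟨t, h⟩) ((univ.filter fun k : Fin n => (k : ℕ) < t).image π) else 0 with hg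
  have h1 : ∑ π : Equiv.Perm (Fin n), ∑ τ : Fin (n - 1) → Bool,
      H (π ⟨numTails τ, numTails_lt τ⟩)
        ((univ.filter fun k : Fin n => (k : ℕ) < numTails τ).image π) =
      ∑ τ : Fin (n - 1) → Bool, g (numTails τ) := by
    rw [sum_comm]
    refine sum_congr rfl fun τ _ => ?_
    simp only [hg]
    rw [dif_pos (numTails_lt τ)]
  have h2 : ∀ j, ∑ τ : Fin (n - 1) → Bool, g (numTails τ) =
      ∑ s ∈ (univ.erase j).powerset, ∑ ρ : Equiv.Perm (Fin n), H (ρ j) (s.image ρ) := by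
    intro j
    rw [sum_tosses g (j := j)]
    refine sum_congr rfl fun s hs => ?_
    have hjs : j ∉ s := fun h => notMem_erase j _ (mem_powerset.1 hs h)
    have hlt : #s < n := by
      have := card_lt_univ_of_notMem hjs
      rwa [Fintype.card_fin] at this
    obtain ⟨σ, hσ1, hσ2⟩ := exists_perm_of_notMem hjs hlt
    simp only [hg]
    rw [dif_pos hlt, ← Equiv.sum_comp (Equiv.mulRight σ)]
    refine sum_congr rfl fun ρ _ => ?_
    rw [Equiv.coe_mulRight, Equiv.Perm.mul_apply, hσ1]
    congr 1
    conv_rhs => rw [← hσ2, image_image]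
    rfl
  have h3 : (n : ℝ) * ∑ τ : Fin (n - 1) → Bool, g (numTails τ) =
      ∑ j, ∑ s ∈ (univ.erase j).powerset, ∑ ρ : Equiv.Perm (Fin n), H (ρ j) (s.image ρ) := by
    rw [← sum_congr rfl fun j _ => h2 j, sum_const, card_univ, Fintype.card_fin, nsmul_eq_mul]
  rw [h1, h3]
  have h4 : ∀ ρ : Equiv.Perm (Fin n), ∑ j, ∑ s ∈ (univ.erase j).powerset, H (ρ j) (s.image ρ) =
      ∑ j, ∑ s ∈ (univ.erase j).powerset, H j s := by
    intro ρ
    rw [← Equiv.sum_comp ρ fun j => ∑ s ∈ (univ.erase j).powerset, H j s]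
    refine sum_congr rfl fun j _ => ?_
    rw [sum_powerset_erase, sum_powerset_erase, ← Equiv.sum_comp ρ.finsetCongr
      fun s => if ρ j ∉ s then H (ρ j) s else 0]
    refine sum_congr rfl fun s _ => ?_
    rw [Equiv.finsetCongr_apply, map_eq_image]
    have : ρ j ∉ s.image ρ ↔ j ∉ s := by simp
    simp only [Equiv.coe_toEmbedding, this]
  rw [sum_congr rfl fun j _ => sum_comm, sum_comm, sum_congr rfl fun ρ _ => h4 ρ, sum_const,
    card_univ, nsmul_eq_mul]

end Law

/-! ### Cells of a random partition into four classes -/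

section Cells

variable {n : ℕ}

/-- The agents other than `j` that `κ` puts into class `x`. -/
def cell (j : Fin n) (κ : Fin n → Bool × Bool) (x : Bool × Bool) : Finset (Fin n) :=
  univ.filter fun l => l ≠ j ∧ κ l = x

/-- The class of agent `l`, relative to the coin of `j`: the first component tells whether she is in
the sample; the second one is her coin, which in the sample is compared with the one of `j`. -/
def classOf (j : Fin n) (s : Finset (Fin n)) (c : Fin n → Bool) (l : Fin n) : Bool × Bool :=
  (decide (l ∈ s), if l ≠ j ∧ l ∈ s then xor (c l) (c j) else c l)

/-- Given the last agent `j` of the sample, sample and coins partition the other agents uniformly at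
random into the four classes. -/
theorem sum_classOf (j : Fin n) (f : Finset (Fin n) → Finset (Fin n) → Finset (Fin n) → ℝ) :
    2 * ∑ s ∈ (univ.erase j).powerset, ∑ c : Fin n → Bool,
      f (s.filter fun l => c l = c j) (s.filter fun l => c l ≠ c j)
        (univ.filter fun l => l ∉ s ∧ l ≠ j ∧ c l = true) =
    ∑ κ : Fin n → Bool × Bool, f (cell j κ (true, false)) (cell j κ (true, true))
      (cell j κ (false, true)) := by
  set G : Finset (Fin n) → (Fin n → Bool) → ℝ := fun s c =>
    f (cell j (classOf j s c) (true, false)) (cell j (classOf j s c) (true, true))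
      (cell j (classOf j s c) (false, true)) with hG
  have h1 : ∀ s ∈ (univ.erase j).powerset, ∀ c : Fin n → Bool,
      f (s.filter fun l => c l = c j) (s.filter fun l => c l ≠ c j)
        (univ.filter fun l => l ∉ s ∧ l ≠ j ∧ c l = true) = G s c ∧ G (insert j s) c = G s c := by
    intro s hs c
    have hjs : j ∉ s := fun h => notMem_erase j _ (mem_powerset.1 hs h)
    have hne : ∀ l ∈ s, l ≠ j := by
      rintro l hl rfl
      exact hjs hl
    have hins : ∀ x, cell j (classOf j (insert j s) c) x = cell j (classOf j s c) x := by
      intro x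
      refine filter_congr fun l _ => ?_
      rw [and_congr_right_iff]
      intro hl
      simp [classOf, hl]
    refine ⟨?_, by simp only [hG, hins]⟩
    simp only [hG]
    congr 1
    · ext l
      simp only [cell, classOf, mem_filter, mem_univ, true_and, Prod.mk.injEq, decide_eq_true_eq]
      constructor
      · rintro ⟨h, h'⟩
        simp [hne l h, h, h']
      · rintro ⟨h, h', h''⟩
        rw [if_pos ⟨h, h'⟩] at h''
        exact ⟨h', by cases h3 : c l <;> cases h4 : c j <;> simp_all⟩
    · ext l
      simp only [cell, classOf, mem_filter, mem_univ, true_and, Prod.mk.injEq, decide_eq_true_eq]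
      constructor
      · rintro ⟨h, h'⟩
        simp only [hne l h, h, ne_eq, not_false_eq_true, and_self, if_true, true_and]
        cases h3 : c l <;> cases h4 : c j <;> simp_all
      · rintro ⟨h, h', h''⟩
        rw [if_pos ⟨h, h'⟩] at h''
        exact ⟨h', by cases h3 : c l <;> cases h4 : c j <;> simp_all⟩
    · ext l
      simp only [cell, classOf, mem_filter, mem_univ, true_and, Prod.mk.injEq,
        decide_eq_false_iff_not]
      constructor
      · rintro ⟨h, h', h''⟩
        simp [h, h', h'']
      · rintro ⟨h, h', h''⟩
        rw [if_neg fun h => h' h.2] at h''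
        exact ⟨h', h, h''⟩
  have h2 : ∑ s : Finset (Fin n), ∑ c : Fin n → Bool, G s c =
      2 * ∑ s ∈ (univ.erase j).powerset, ∑ c : Fin n → Bool, G s c := by
    have huniv : (univ : Finset (Finset (Fin n))) = (insert j (univ.erase j)).powerset := by
      rw [insert_erase (mem_univ j)]
      ext
      simp
    rw [huniv, sum_powerset_insert (notMem_erase j _), two_mul]
    congr 1
    exact sum_congr rfl fun s hs => sum_congr rfl fun c _ => (h1 s hs c).2
  rw [sum_congr rfl fun s hs => sum_congr rfl fun c _ => (h1 s hs c).1, ← h2,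
    ← Fintype.sum_prod_type']
  refine sum_bij' (fun x _ => classOf j x.1 x.2)
    (fun κ _ => (univ.filter fun l => (κ l).1 = true,
      fun l => if l ≠ j ∧ (κ l).1 = true then xor (κ l).2 (κ j).2 else (κ l).2)) ?_ ?_ ?_ ?_ ?_
  · simp
  · simp
  · rintro ⟨s, c⟩ _
    refine Prod.ext ?_ ?_
    · ext l
      simp [classOf]
    · funext l
      by_cases h : l ≠ j ∧ l ∈ s <;> simp [classOf, h]
  · intro κ _
    funext l
    refine Prod.ext ?_ ?_
    · simp [classOf]
    · by_cases h : l ≠ j ∧ (κ l).1 = true <;> simp [classOf, h]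
  · exact fun _ _ => rfl

/-- Permuting the classes does not change the distribution of the partition. -/
theorem sum_cell_perm (j : Fin n) (e : Equiv.Perm (Bool × Bool))
    (G : ((Bool × Bool) → Finset (Fin n)) → ℝ) :
    ∑ κ, G (cell j κ) = ∑ κ, G fun x => cell j κ (e x) := by
  rw [← Equiv.sum_comp (Equiv.arrowCongr (Equiv.refl (Fin n)) e.symm)]
  refine sum_congr rfl fun κ _ => congrArg G (funext fun x => ?_)
  refine filter_congr fun l _ => ?_
  simp [Equiv.arrowCongr, Equiv.symm_apply_eq]

end Cells

/-! ### Expected price of a random sample -/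

section Price

variable {n : ℕ}

theorem card_class_eq {l k : Fin n} (hlk : l ≠ k) (a b : Bool × Bool) :
    (16 : ℝ) * #(univ.filter fun κ : Fin n → Bool × Bool => κ l = a ∧ κ k = b) = 4 ^ n := by
  have hset : (univ.filter fun κ : Fin n → Bool × Bool => κ l = a ∧ κ k = b) =
      Fintype.piFinset fun i => if i = l then {a} else if i = k then {b} else univ := by
    ext κ
    simp only [mem_filter, mem_univ, true_and, Fintype.mem_piFinset]
    constructor
    · rintro ⟨h1, h2⟩ i
      split_ifs with h3 h4
      · rw [h3, h1, mem_singleton]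
      · rw [h4, h2, mem_singleton]
      · exact mem_univ _
    · intro h
      have h1 := h l
      have h2 := h k
      rw [if_pos rfl, mem_singleton] at h1
      rw [if_neg hlk.symm, if_pos rfl, mem_singleton] at h2
      exact ⟨h1, h2⟩
  have h16 : (16 : ℕ) = ∏ i : Fin n, if i ∈ ({l, k} : Finset (Fin n)) then 4 else 1 := by
    rw [prod_ite_mem, univ_inter, prod_const, card_pair hlk]
    norm_num
  have : 16 * #(univ.filter fun κ : Fin n → Bool × Bool => κ l = a ∧ κ k = b) = 4 ^ n := by
    rw [hset, Fintype.card_piFinset, h16, ← prod_mul_distrib]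
    have : ∀ i : Fin n, ((if i ∈ ({l, k} : Finset (Fin n)) then 4 else 1) *
        #(if i = l then {a} else if i = k then {b} else (univ : Finset (Bool × Bool)))) = 4 := by
      intro i
      by_cases h1 : i = l
      · simp [h1]
      · by_cases h2 : i = k
        · simp [h2, hlk.symm]
        · simp [h1, h2]
    rw [prod_congr rfl fun i _ => this i, prod_const, card_univ, Fintype.card_fin]
  exact_mod_cast this

/-- Two different classes of a random partition: the expected product of their weights. -/
theorem sum_weight_mul_weight (j : Fin n) (w : Fin n → ℝ) {a b : Bool × Bool} (hab : a ≠ b) :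
    16 * ∑ κ, (∑ l ∈ cell j κ a, w l) * ∑ k ∈ cell j κ b, w k =
      4 ^ n * ∑ l, ∑ k, if l ≠ k ∧ l ≠ j ∧ k ≠ j then w l * w k else 0 := by
  have h1 : ∀ κ : Fin n → Bool × Bool, (∑ l ∈ cell j κ a, w l) * ∑ k ∈ cell j κ b, w k =
      ∑ l, ∑ k, (if l ≠ k ∧ l ≠ j ∧ k ≠ j then w l * w k else 0) *
        if κ l = a ∧ κ k = b then 1 else 0 := by
    intro κ
    rw [cell, cell, sum_filter, sum_filter, sum_mul_sum]
    refine sum_congr rfl fun l _ => sum_congr rfl fun k _ => ?_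
    by_cases h3 : κ l = a ∧ κ k = b
    · have hlk : l ≠ k := by
        rintro rfl
        exact hab (h3.1.symm.trans h3.2)
      rw [if_pos h3, mul_one]
      by_cases h1 : l = j <;> by_cases h2 : k = j <;> simp [h1, h2, h3, hlk]
    · rw [if_neg h3, mul_zero]
      by_cases h1 : κ l = a
      · have h2 : κ k ≠ b := fun h => h3 ⟨h1, h⟩
        simp [h2]
      · simp [h1]
  simp only [h1]
  rw [sum_comm, mul_sum, mul_sum]
  refine sum_congr rfl fun l _ => ?_
  rw [sum_comm, mul_sum, mul_sum]
  refine sum_congr rfl fun k _ => ?_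
  rw [← mul_sum]
  by_cases hlk : l ≠ k
  · rw [← card_class_eq hlk a b, sum_boole]
    ring
  · simp [hlk]

theorem sum_pairs (w : Fin n → ℝ) (hw : ∑ l, w l = 1) :
    ∑ j, ∑ l, ∑ k, (if l ≠ k ∧ l ≠ j ∧ k ≠ j then w l * w k else 0) =
      (n - 2) * (1 - ∑ l, w l ^ 2) := by
  have h1 : ∀ l k : Fin n, ∑ j, (if l ≠ k ∧ l ≠ j ∧ k ≠ j then w l * w k else 0) =
      (n - 2) * (w l * w k) - if l = k then (n - 2) * (w l * w k) else 0 := by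
    intro l k
    by_cases hlk : l = k
    · simp [hlk]
    · have hset : (univ.filter fun j => l ≠ j ∧ k ≠ j) = (univ.erase l).erase k := by
        ext j
        simp only [mem_filter, mem_univ, true_and, mem_erase, ne_eq, eq_comm, and_comm]
      have hcard : (#(univ.filter fun j => l ≠ j ∧ k ≠ j) : ℝ) = n - 2 := by
        have h2 := card_erase_add_one (mem_erase.2 ⟨Ne.symm hlk, mem_univ k⟩ : k ∈ univ.erase l)
        have h3 := card_erase_add_one (mem_univ l)
        rw [card_univ, Fintype.card_fin] at h3
        rw [hset, eq_sub_iff_add_eq]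
        have : #((univ.erase l).erase k) + 2 = n := by omega
        exact_mod_cast this
      simp only [ne_eq, hlk, not_false_eq_true, true_and, if_false, sub_zero]
      rw [← sum_filter, sum_const, nsmul_eq_mul, hcard]
  rw [sum_comm, sum_congr rfl fun l _ => sum_comm]
  simp only [h1, sum_sub_distrib, sum_ite_eq, mem_univ, if_true]
  simp only [← mul_sum, hw, mul_one]
  have : ∑ l, w l ^ 2 = ∑ l, w l * w l := sum_congr rfl fun l _ => sq (w l)
  rw [this]
  ring

variable (θ : Fin n → AgentType)

/-- The expected revenue from `B₁` that is guaranteed if the price is determined by `Y`, and the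
members of `U` compete with those of `W`; see `card_orders_mul_le`. -/
def guarantee (Y W U : Finset (Fin n)) : ℝ :=
  if 1 / 4 ≤ demand θ U (clearingPrice θ Y) ∧
      demand θ W (clearingPrice θ Y) ≤ demand θ U (clearingPrice θ Y) then
    (1 - Real.exp (-(1 / 2))) / 4 * clearingPrice θ Y
  else 0

/-- The clearing price of `Y` if one of `W` and `U` has at least this clearing price. -/
def secondPrice (Y W U : Finset (Fin n)) : ℝ :=
  if clearingPrice θ Y ≤ max (clearingPrice θ W) (clearingPrice θ U) then clearingPrice θ Y else 0

theorem exp_const_nonneg : 0 ≤ (1 - Real.exp (-(1 / 2))) / 4 := by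
  have : Real.exp (-(1 / 2)) ≤ 1 := Real.exp_le_one_iff.2 (by norm_num)
  linarith

theorem guarantee_nonneg (Y W U : Finset (Fin n)) : 0 ≤ guarantee θ Y W U := by
  unfold guarantee
  split_ifs
  · exact mul_nonneg exp_const_nonneg (clearingPrice_nonneg _ _)
  · exact le_rfl

/-- At any positive price up to its clearing price, a set of agents wants the whole supply. -/
theorem one_quarter_le_demand {p : ℝ} (hp : 0 < p) {U : Finset (Fin n)}
    (h : p ≤ clearingPrice θ U) : 1 / 4 ≤ demand θ U p := by
  by_cases hbig : ∃ i ∈ U, 1 / 4 ≤ purchase (θ i) p (1 / 4)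
  · obtain ⟨i, hi, hle⟩ := hbig
    exact hle.trans (single_le_sum (f := fun i => purchase (θ i) p (1 / 4))
      (fun l _ => purchase_nonneg hp.le (by norm_num)) hi)
  · push Not at hbig
    have h1 : demand θ U p =
        weakDemand (fun l => (θ l).value) (fun l => (θ l).budget) U p / p := by
      rw [demand, weakDemand, sum_filter, sum_div]
      refine sum_congr rfl fun i hi => ?_
      have hlt := hbig i hi
      unfold purchase at hlt ⊢
      split_ifs at hlt ⊢ with g1 g2
      · exact absurd g2 hp.ne'
      · rcases min_lt_iff.1 hlt with h | h
        · exact min_eq_left h.le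
        · exact absurd h (lt_irrefl _)
      · simp
    have h2 : p ≤ weakDemand (fun l => (θ l).value) (fun l => (θ l).budget) U p := by
      rcases h.lt_or_eq with h' | h'
      · refine h.trans ((clears_clearingPrice θ U).2.trans ?_)
        refine sum_le_sum_of_subset_of_nonneg (fun l hl => ?_) fun i _ _ => (θ i).budget_nonneg
        rw [mem_filter] at hl ⊢
        exact ⟨hl.1, h.trans hl.2⟩
      · have := (clears_clearingPrice θ U).2
        rwa [← h'] at this
    rw [h1, le_div_iff₀ hp]
    linarith

theorem secondPrice_le (Y W U : Finset (Fin n)) :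
    (1 - Real.exp (-(1 / 2))) / 4 * secondPrice θ Y W U ≤
      guarantee θ Y W U + guarantee θ Y U W := by
  have h1 := guarantee_nonneg θ Y W U
  have h2 := guarantee_nonneg θ Y U W
  unfold secondPrice
  split_ifs with h
  swap
  · linarith
  rcases (clearingPrice_nonneg θ Y).eq_or_lt with h0 | h0
  · rw [← h0]
    linarith
  have hmax : 1 / 4 ≤ max (demand θ W (clearingPrice θ Y)) (demand θ U (clearingPrice θ Y)) := by
    rcases le_max_iff.1 h with h' | h'
    · exact le_max_of_le_left (one_quarter_le_demand θ h0 h')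
    · exact le_max_of_le_right (one_quarter_le_demand θ h0 h')
  rcases le_total (demand θ W (clearingPrice θ Y)) (demand θ U (clearingPrice θ Y)) with h' | h'
  · rw [max_eq_right h'] at hmax
    have : guarantee θ Y W U = (1 - Real.exp (-(1 / 2))) / 4 * clearingPrice θ Y :=
      if_pos ⟨hmax, h'⟩
    linarith
  · rw [max_eq_left h'] at hmax
    have : guarantee θ Y U W = (1 - Real.exp (-(1 / 2))) / 4 * clearingPrice θ Y :=
      if_pos ⟨hmax, h'⟩
    linarith

/-- Of three prices, all but the largest one count. -/
theorem pair_products_le_secondPrice {ρ : ℝ} (hρ : 0 ≤ ρ) {Y W U : Finset (Fin n)} {y w u : ℝ}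
    (hy : 0 ≤ y) (hw : 0 ≤ w) (hu : 0 ≤ u) (hsum : y + w + u ≤ 1)
    (hY : ρ * y ≤ clearingPrice θ Y) (hW : ρ * w ≤ clearingPrice θ W)
    (hU : ρ * u ≤ clearingPrice θ U) :
    ρ * (y * w + w * u + u * y) ≤
      secondPrice θ Y W U + secondPrice θ W U Y + secondPrice θ U Y W := by
  have key : ∀ a b c : ℝ, 0 ≤ a → 0 ≤ b → 0 ≤ c → a + b + c ≤ 1 →
      ρ * (a * b + b * c + c * a) ≤ ρ * b + ρ * c := by
    intro a b c ha hb hc h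
    rw [← mul_add]
    refine mul_le_mul_of_nonneg_left ?_ hρ
    nlinarith [mul_nonneg hb hc]
  have h0 := clearingPrice_nonneg θ Y
  have h1 := clearingPrice_nonneg θ W
  have h2 := clearingPrice_nonneg θ U
  have n1 : 0 ≤ secondPrice θ Y W U := by unfold secondPrice; split_ifs <;> simp [h0]
  have n2 : 0 ≤ secondPrice θ W U Y := by unfold secondPrice; split_ifs <;> simp [h1]
  have n3 : 0 ≤ secondPrice θ U Y W := by unfold secondPrice; split_ifs <;> simp [h2]
  set a := clearingPrice θ Y
  set b := clearingPrice θ W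
  set c := clearingPrice θ U
  rcases le_total a b with hab | hab
  · have e1 : secondPrice θ Y W U = a := if_pos (le_max_of_le_left hab)
    rcases le_total b c with hbc | hbc
    · have e2 : secondPrice θ W U Y = b := if_pos (le_max_of_le_left hbc)
      linarith [key u y w hu hy hw (by linarith)]
    · have e2 : secondPrice θ U Y W = c := if_pos (le_max_of_le_right hbc)
      linarith [key w u y hw hu hy (by linarith)]
  · have e1 : secondPrice θ W U Y = b := if_pos (le_max_of_le_right hab)
    rcases le_total a c with hac | hac
    · have e2 : secondPrice θ Y W U = a := if_pos (le_max_of_le_right hac)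
      linarith [key u y w hu hy hw (by linarith)]
    · have e2 : secondPrice θ U Y W = c := if_pos (le_max_of_le_left hac)
      linarith [key y w u hy hw hu (by linarith)]

/-- If clearing prices are bounded below by `ρ` times an additive weight of total mass `1`, then the
guaranteed revenue is at least a constant times `ρ`, unless a single agent carries almost all of the
weight. -/
theorem sum_guarantee_ge {w : Fin n → ℝ} (hw0 : ∀ l, 0 ≤ w l) (hw1 : ∑ l, w l = 1) {ρ : ℝ}
    (hρ : 0 ≤ ρ) (h : ∀ S, ρ * ∑ l ∈ S, w l ≤ clearingPrice θ S) :
    4 ^ n * ((1 - Real.exp (-(1 / 2))) / 128 * ((n - 2) * (1 - ∑ l, w l ^ 2)) * ρ) ≤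
      ∑ j, ∑ κ : Fin n → Bool × Bool, guarantee θ (cell j κ (true, false))
        (cell j κ (true, true)) (cell j κ (false, true)) := by
  set a : Bool × Bool := (true, false) with ha
  set b : Bool × Bool := (true, true) with hb
  set c : Bool × Bool := (false, true) with hc
  have hab : a ≠ b := by simp [ha, hb]
  have hbc : b ≠ c := by simp [hb, hc]
  have hca : c ≠ a := by simp [hc, ha]
  set k₀ := (1 - Real.exp (-(1 / 2))) / 4 with hk₀
  have hk0 : 0 ≤ k₀ := exp_const_nonneg
  have hj : ∀ j, 4 ^ n * (k₀ / 32 * ρ *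
      ∑ l, ∑ k, (if l ≠ k ∧ l ≠ j ∧ k ≠ j then w l * w k else 0)) ≤
      ∑ κ : Fin n → Bool × Bool, guarantee θ (cell j κ a) (cell j κ b) (cell j κ c) := by
    intro j
    have hswap : ∑ κ, guarantee θ (cell j κ a) (cell j κ c) (cell j κ b) =
        ∑ κ, guarantee θ (cell j κ a) (cell j κ b) (cell j κ c) := by
      have := sum_cell_perm j (Equiv.swap b c) fun C => guarantee θ (C a) (C b) (C c)
      rw [this]
      simp only [Equiv.swap_apply_left, Equiv.swap_apply_right,
        Equiv.swap_apply_of_ne_of_ne hab hca.symm]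
    have hrot1 : ∑ κ, secondPrice θ (cell j κ b) (cell j κ c) (cell j κ a) =
        ∑ κ, secondPrice θ (cell j κ a) (cell j κ b) (cell j κ c) := by
      have := sum_cell_perm j (Equiv.swap a b * Equiv.swap b c)
        fun C => secondPrice θ (C a) (C b) (C c)
      rw [this]
      simp only [Equiv.Perm.mul_apply, Equiv.swap_apply_left, Equiv.swap_apply_right,
        Equiv.swap_apply_of_ne_of_ne hab hca.symm, Equiv.swap_apply_of_ne_of_ne hca hbc.symm]
    have hrot2 : ∑ κ, secondPrice θ (cell j κ c) (cell j κ a) (cell j κ b) =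
        ∑ κ, secondPrice θ (cell j κ b) (cell j κ c) (cell j κ a) := by
      have := sum_cell_perm j (Equiv.swap a b * Equiv.swap b c)
        fun C => secondPrice θ (C b) (C c) (C a)
      rw [this]
      simp only [Equiv.Perm.mul_apply, Equiv.swap_apply_left, Equiv.swap_apply_right,
        Equiv.swap_apply_of_ne_of_ne hab hca.symm, Equiv.swap_apply_of_ne_of_ne hca hbc.symm]
    have h1 : k₀ * ∑ κ, secondPrice θ (cell j κ a) (cell j κ b) (cell j κ c) ≤
        2 * ∑ κ, guarantee θ (cell j κ a) (cell j κ b) (cell j κ c) := by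
      rw [two_mul]
      nth_rewrite 2 [← hswap]
      rw [← sum_add_distrib, mul_sum]
      exact sum_le_sum fun κ _ => secondPrice_le θ _ _ _
    have hdisj : ∀ κ : Fin n → Bool × Bool, ∑ l ∈ cell j κ a, w l + ∑ l ∈ cell j κ b, w l +
        ∑ l ∈ cell j κ c, w l ≤ 1 := by
      intro κ
      rw [cell, cell, cell, sum_filter, sum_filter, sum_filter, ← sum_add_distrib,
        ← sum_add_distrib, ← hw1]
      refine sum_le_sum fun l _ => ?_
      have := hw0 l
      by_cases e1 : κ l = a
      · have e2 : κ l ≠ b := e1 ▸ hab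
        have e3 : κ l ≠ c := e1 ▸ hca.symm
        simp only [e1, hab, hca.symm, and_true, and_false, if_false]
        split_ifs <;> linarith
      · by_cases e2 : κ l = b
        · simp only [e2, hab.symm, hbc, and_true, and_false, if_false]
          split_ifs <;> linarith
        · simp only [e1, e2, and_false, if_false]
          split_ifs <;> linarith
    have h2 : ρ * ∑ κ, ((∑ l ∈ cell j κ a, w l) * (∑ l ∈ cell j κ b, w l) +
        (∑ l ∈ cell j κ b, w l) * (∑ l ∈ cell j κ c, w l) +
        (∑ l ∈ cell j κ c, w l) * (∑ l ∈ cell j κ a, w l)) ≤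
        3 * ∑ κ, secondPrice θ (cell j κ a) (cell j κ b) (cell j κ c) := by
      have : 3 * ∑ κ, secondPrice θ (cell j κ a) (cell j κ b) (cell j κ c) =
          ∑ κ, (secondPrice θ (cell j κ a) (cell j κ b) (cell j κ c) +
            secondPrice θ (cell j κ b) (cell j κ c) (cell j κ a) +
            secondPrice θ (cell j κ c) (cell j κ a) (cell j κ b)) := by
        rw [sum_add_distrib, sum_add_distrib, hrot2, hrot1]
        ring
      rw [this, mul_sum]
      exact sum_le_sum fun κ _ => pair_products_le_secondPrice θ hρ
        (sum_nonneg fun l _ => hw0 l) (sum_nonneg fun l _ => hw0 l) (sum_nonneg fun l _ => hw0 l)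
        (hdisj κ) (h _) (h _) (h _)
    rw [sum_add_distrib, sum_add_distrib] at h2
    have m1 := sum_weight_mul_weight j w hab
    have m2 := sum_weight_mul_weight j w hbc
    have m3 := sum_weight_mul_weight j w hca
    set T := ∑ l, ∑ k, (if l ≠ k ∧ l ≠ j ∧ k ≠ j then w l * w k else 0)
    set Sec := ∑ κ, secondPrice θ (cell j κ a) (cell j κ b) (cell j κ c)
    set Gu := ∑ κ, guarantee θ (cell j κ a) (cell j κ b) (cell j κ c)
    set p1 := ∑ κ, (∑ l ∈ cell j κ a, w l) * ∑ k ∈ cell j κ b, w k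
    set p2 := ∑ κ, (∑ l ∈ cell j κ b, w l) * ∑ k ∈ cell j κ c, w k
    set p3 := ∑ κ, (∑ l ∈ cell j κ c, w l) * ∑ k ∈ cell j κ a, w k
    have h3 := mul_le_mul_of_nonneg_left h2 hk0
    have e1 : p1 + p2 + p3 = 3 * (4 ^ n * T) / 16 := by linarith
    rw [e1] at h3
    have e2 : k₀ * (ρ * (3 * (4 ^ n * T) / 16)) = 6 * (4 ^ n * (k₀ / 32 * ρ * T)) := by ring
    linarith
  have hs := sum_le_sum fun j (_ : j ∈ univ) => hj j
  rw [← mul_sum, ← mul_sum, sum_pairs w hw1] at hs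
  refine le_trans (le_of_eq ?_) hs
  rw [hk₀]
  ring

end Price

/-! ### Truthful reports in random order -/

section RandomInput

variable {n : ℕ} (I : Input n) (π : Equiv.Perm (Fin n))

theorem agentAt_types : agentAt (I.types π) = 1 :=
  Tuple.sort_eq_refl_iff_monotone.2 I.arrival_strictMono.monotone

theorem place_types (i : Fin n) : place (I.types π) i = i := by
  rw [place, agentAt_types]
  rfl

theorem firstAgents_types (k : ℕ) :
    firstAgents (I.types π) k = univ.filter fun i : Fin n => (i : ℕ) < k := by
  simp only [firstAgents, place_types]

theorem demand_types (S : Finset (Fin n)) (p : ℝ) :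
    demand (I.types π) S p = demand (I.types 1) (S.image π) p := by
  rw [demand, demand, sum_image fun _ _ _ _ h => π.injective h]
  rfl

theorem clearingPrice_types (S : Finset (Fin n)) :
    clearingPrice (I.types π) S = clearingPrice (I.types 1) (S.image π) := by
  have h := clears_clearingPrice (I.types π) S
  refine Clears.unique (v := I.value) (b := I.budget) (S := S.image π)
    (fun i => (I.budget_pos i).le) ⟨?_, ?_⟩ (clears_clearingPrice (I.types 1) (S.image π))
  · convert h.1 using 1
    rw [strictDemand, strictDemand, sum_filter, sum_filter,
      sum_image fun _ _ _ _ h => π.injective h]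
    rfl
  · convert h.2 using 1
    rw [weakDemand, weakDemand, sum_filter, sum_filter, sum_image fun _ _ _ _ h => π.injective h]
    rfl

theorem liquidWelfare_nonneg {x : Fin n → ℝ} (hx : ∀ i, 0 ≤ x i) :
    0 ≤ liquidWelfare (fun i => I.value (π i)) (fun i => I.budget (π i)) x :=
  sum_nonneg fun i _ => le_min (mul_nonneg (I.value_pos _).le (hx i)) (I.budget_pos _).le

theorem expectedLiquidWelfare_nonneg {M : Mechanism n} (hM : M.Feasible) :
    0 ≤ M.expectedLiquidWelfare I :=
  mul_nonneg (by positivity) (sum_nonneg fun π _ => sum_nonneg fun ω _ =>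
    mul_nonneg (M.prob_nonneg ω) (liquidWelfare_nonneg I π (hM _ ω).1))

theorem expectedLiquidWelfare_mix {μ : ℝ} {h₀ : 0 ≤ μ} {h₁ : μ ≤ 1} (M M' : Mechanism n) :
    (mix μ h₀ h₁ M M').expectedLiquidWelfare I =
      μ * M.expectedLiquidWelfare I + (1 - μ) * M'.expectedLiquidWelfare I := by
  have : ∀ π : Equiv.Perm (Fin n), ∑ ω, (mix μ h₀ h₁ M M').prob ω *
      liquidWelfare (fun i => I.value (π i)) (fun i => I.budget (π i))
        (fun i => ((mix μ h₀ h₁ M M').outcome (I.types π) ω i).amount) =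
      μ * ∑ ω, M.prob ω * liquidWelfare (fun i => I.value (π i)) (fun i => I.budget (π i))
        (fun i => (M.outcome (I.types π) ω i).amount) +
      (1 - μ) * ∑ ω, M'.prob ω * liquidWelfare (fun i => I.value (π i)) (fun i => I.budget (π i))
        (fun i => (M'.outcome (I.types π) ω i).amount) := by
    intro π
    rw [mul_sum, mul_sum]
    simp only [← mul_assoc]
    exact Fintype.sum_sum_type _
  unfold Mechanism.expectedLiquidWelfare
  simp only [this, sum_add_distrib, ← mul_sum]
  ring

variable [NeZero n]

/-- The sample in terms of the pairs (value, budget): the guaranteed revenue, averaged over the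
orders used by the greedy allocation. -/
theorem card_orders_mul_guarantee_le (τ : Fin (n - 1) → Bool) (c : Fin n → Bool) :
    let j := π ⟨numTails τ, numTails_lt τ⟩
    let s := (univ.filter fun k : Fin n => (k : ℕ) < numTails τ).image π
    let c' := c ∘ π.symm
    Fintype.card (Orders n) * guarantee (I.types 1) (s.filter fun l => c' l = c' j)
      (s.filter fun l => c' l ≠ c' j) (univ.filter fun l => l ∉ s ∧ l ≠ j ∧ c' l = true) ≤
    ∑ q : Orders n, liquidWelfare (fun i => I.value (π i)) (fun i => I.budget (π i))
      fun i => (rsOutcome (I.types π) (τ, c, q) i).amount := by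
  intro j s c'
  set j₀ : Fin n := ⟨numTails τ, numTails_lt τ⟩ with hj₀
  set F := univ.filter fun k : Fin n => (k : ℕ) < numTails τ with hF
  have hnonneg : 0 ≤ ∑ q : Orders n, liquidWelfare (fun i => I.value (π i))
      (fun i => I.budget (π i)) fun i => (rsOutcome (I.types π) (τ, c, q) i).amount :=
    sum_nonneg fun q _ => liquidWelfare_nonneg I π (rsOutcome_amount_nonneg _ _)
  have hlast : ∀ q : Orders n, lastAgent (I.types π) (τ, c, q) = j₀ := by
    intro q
    rw [lastAgent, agentAt_types]
    rfl
  have hfirst : ∀ q : Orders n, firstAgents (I.types π) (RSCoins.tails (τ, c, q)) = F := by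
    intro q
    rw [firstAgents_types]
    rfl
  have hY : (F.filter fun i => c i = c j₀).image π = s.filter fun l => c' l = c' j := by
    rw [filter_image]
    congr 1
    refine filter_congr fun i _ => ?_
    simp [c', j, hj₀]
  have hW : (F.filter fun i => c i ≠ c j₀).image π = s.filter fun l => c' l ≠ c' j := by
    rw [filter_image]
    congr 1
    refine filter_congr fun i _ => ?_
    simp [c', j, hj₀]
  have hU : (univ.filter fun i => (i ∉ F ∧ i ≠ j₀) ∧ c i = true).image π =
      univ.filter fun l => l ∉ s ∧ l ≠ j ∧ c' l = true := by
    ext l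
    simp only [mem_image, mem_filter, mem_univ, true_and]
    constructor
    · rintro ⟨i, ⟨⟨h1, h2⟩, h3⟩, rfl⟩
      refine ⟨?_, fun h => h2 (π.injective h), by simpa [c'] using h3⟩
      intro h
      obtain ⟨k, hk, hki⟩ := mem_image.1 h
      exact h1 (π.injective hki ▸ hk)
    · rintro ⟨h1, h2, h3⟩
      refine ⟨π.symm l, ⟨⟨fun h => h1 ?_, fun h => h2 ?_⟩, h3⟩, π.apply_symm_apply l⟩
      · exact mem_image.2 ⟨_, h, π.apply_symm_apply l⟩
      · rw [← π.apply_symm_apply l, h]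
  rw [← hY, ← hW, ← hU]
  unfold guarantee
  rw [← clearingPrice_types, ← demand_types, ← demand_types]
  split_ifs with h
  swap
  · rw [mul_zero]
    exact hnonneg
  refine card_orders_mul_le (I.types π) τ c ?_ ?_ ?_ rfl h.1 h.2
  · intro q
    rw [(setA_sides _ _).2, hfirst, hlast]
    rfl
  · intro q
    rw [(setA_sides _ _).1, hfirst, hlast]
    rfl
  · intro q
    refine filter_congr fun i _ => and_congr ?_ Iff.rfl
    rw [← hfirst q, ← hlast q, ← setA_erase_lastAgent, mem_erase]
    have := lastAgent_mem_setA (I.types π) (τ, c, q)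
    constructor
    · exact fun h => ⟨fun h' => h h'.2, fun h' => h (h' ▸ this)⟩
    · exact fun h h' => h.1 ⟨h.2, h'⟩

/-- The expected liquid welfare is at least the average of the guaranteed revenue over the last
agent `j` of the sample and the partition `κ` of the other agents. -/
theorem rsLiquid_expectedLiquidWelfare_ge :
    ∑ j, ∑ κ : Fin n → Bool × Bool, guarantee (I.types 1) (cell j κ (true, false))
      (cell j κ (true, true)) (cell j κ (false, true)) ≤
    n * 4 ^ n * (rsLiquid n).expectedLiquidWelfare I := by
  set θ₀ := I.types 1 with hθ₀
  set H : Fin n → Finset (Fin n) → ℝ := fun j s => ∑ c : Fin n → Bool,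
    guarantee θ₀ (s.filter fun l => c l = c j) (s.filter fun l => c l ≠ c j)
      (univ.filter fun l => l ∉ s ∧ l ≠ j ∧ c l = true) with hH
  set LW : Equiv.Perm (Fin n) → RSCoins n → ℝ := fun π ω =>
    liquidWelfare (fun i => I.value (π i)) (fun i => I.budget (π i))
      fun i => (rsOutcome (I.types π) ω i).amount with hLW
  set N : ℝ := (Fintype.card (Equiv.Perm (Fin n)) : ℝ) with hN
  set Q : ℝ := (Fintype.card (Orders n) : ℝ) with hQ
  have hNpos : 0 < N := by
    rw [hN]
    exact_mod_cast Fintype.card_pos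
  have hQpos : 0 < Q := by
    rw [hQ]
    exact_mod_cast Fintype.card_pos
  have h1 : ∀ π : Equiv.Perm (Fin n), Q * ∑ τ : Fin (n - 1) → Bool,
      H (π ⟨numTails τ, numTails_lt τ⟩)
        ((univ.filter fun k : Fin n => (k : ℕ) < numTails τ).image π) ≤ ∑ ω, LW π ω := by
    intro π
    rw [Fintype.sum_prod_type, mul_sum]
    refine sum_le_sum fun τ _ => ?_
    rw [Fintype.sum_prod_type]
    simp only [hH]
    rw [← Equiv.sum_comp (Equiv.arrowCongr π (Equiv.refl Bool)), mul_sum]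
    exact sum_le_sum fun c _ => card_orders_mul_guarantee_le I π τ c
  have h2 := sum_perm_sum_tosses H
  have h3 : ∑ j, ∑ κ : Fin n → Bool × Bool, guarantee θ₀ (cell j κ (true, false))
      (cell j κ (true, true)) (cell j κ (false, true)) =
      2 * ∑ j, ∑ s ∈ (univ.erase j).powerset, H j s := by
    rw [mul_sum]
    exact sum_congr rfl fun j _ => (sum_classOf j (guarantee θ₀)).symm
  have h4 : (rsLiquid n).expectedLiquidWelfare I =
      N⁻¹ * ((2 ^ (n - 1) * (2 ^ n * Q))⁻¹ * ∑ π, ∑ ω, LW π ω) := by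
    have hcard : (Fintype.card (RSCoins n) : ℝ) = 2 ^ (n - 1) * (2 ^ n * Q) := by
      rw [hQ, Fintype.card_prod, Fintype.card_prod, Fintype.card_fun, Fintype.card_fun,
        Fintype.card_bool, Fintype.card_fin, Fintype.card_fin]
      push_cast
      rfl
    rw [← hcard, mul_sum]
    simp only [mul_sum]
    unfold Mechanism.expectedLiquidWelfare
    simp only [mul_sum]
    rfl
  have h5 := sum_le_sum fun π (_ : π ∈ univ) => h1 π
  rw [← mul_sum] at h5
  have hn : (0 : ℝ) < n := by exact_mod_cast NeZero.pos n
  have h6 : (4 : ℝ) ^ n = 2 ^ (n - 1) * 2 ^ n * 2 := by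
    have : n = n - 1 + 1 := by
      have := NeZero.pos n
      omega
    have h7 : (2 : ℝ) ^ n = 2 ^ (n - 1) * 2 := by
      conv_lhs => rw [this, pow_succ]
    rw [show (4 : ℝ) = 2 * 2 by norm_num, mul_pow]
    nth_rewrite 1 [h7]
    ring
  rw [h3, h4, h6]
  set A := ∑ j, ∑ s ∈ (univ.erase j).powerset, H j s
  set B := ∑ π : Equiv.Perm (Fin n), ∑ τ : Fin (n - 1) → Bool,
    H (π ⟨numTails τ, numTails_lt τ⟩)
      ((univ.filter fun k : Fin n => (k : ℕ) < numTails τ).image π)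
  set C := ∑ π, ∑ ω, LW π ω
  have h8 : (n : ℝ) * (2 ^ (n - 1) * 2 ^ n * 2) *
      (N⁻¹ * ((2 ^ (n - 1) * (2 ^ n * Q))⁻¹ * C)) = 2 * (n * C / (N * Q)) := by
    field_simp
  rw [h8]
  refine mul_le_mul_of_nonneg_left ?_ zero_le_two
  rw [le_div_iff₀ (by positivity)]
  calc A * (N * Q) = Q * (N * A) := by ring
    _ = Q * (n * B) := by rw [← h2]
    _ = n * (Q * B) := by ring
    _ ≤ n * C := mul_le_mul_of_nonneg_left h5 hn.le

end RandomInput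

/-! ### The optimum and the clearing price -/

section Optimum

variable {n : ℕ} (I : Input n)

theorem types_liquid (π : Equiv.Perm (Fin n)) (i : Fin n) :
    (I.types π i).liquid = min (I.value (π i)) (I.budget (π i)) := rfl

theorem liquid_pos (i : Fin n) : 0 < min (I.value i) (I.budget i) :=
  lt_min (I.value_pos i) (I.budget_pos i)

theorem optLiquidWelfare_le {v b : Fin n → ℝ} {B : ℝ}
    (h : ∀ x : Fin n → ℝ, (∀ i, 0 ≤ x i) → ∑ i, x i ≤ 1 → liquidWelfare v b x ≤ B) :
    optLiquidWelfare v b ≤ B := by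
  refine csSup_le ⟨_, 0, fun i => le_rfl, by simp, rfl⟩ ?_
  rintro W ⟨x, h0, h1, rfl⟩
  exact h x h0 h1

/-- Units that go to agents with value at most `p` are worth at most `p` in total, and the budgets
of the other agents sum up to at most `p`. -/
theorem optLiquidWelfare_le_two_mul_clearingPrice :
    optLiquidWelfare I.value I.budget ≤ 2 * clearingPrice (I.types 1) univ := by
  set p := clearingPrice (I.types 1) univ
  have hp : 0 ≤ p := clearingPrice_nonneg _ _
  have hclear : strictDemand I.value I.budget univ p ≤ p :=
    (clears_clearingPrice (I.types 1) univ).1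
  refine optLiquidWelfare_le fun x h0 h1 => ?_
  calc liquidWelfare I.value I.budget x
      ≤ ∑ i, (p * x i + if p < I.value i then I.budget i else 0) := by
        refine sum_le_sum fun i _ => ?_
        split_ifs with h
        · exact (min_le_right _ _).trans (le_add_of_nonneg_left (mul_nonneg hp (h0 i)))
        · rw [add_zero]
          exact (min_le_left _ _).trans (mul_le_mul_of_nonneg_right (not_lt.1 h) (h0 i))
    _ = p * ∑ i, x i + strictDemand I.value I.budget univ p := by
        rw [sum_add_distrib, ← mul_sum, strictDemand, sum_filter]
    _ ≤ p * 1 + p := add_le_add (mul_le_mul_of_nonneg_left h1 hp) hclear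
    _ = 2 * p := by ring

/-- The bound that does without a clearing price: nobody is worth more than her liquid value. -/
theorem optLiquidWelfare_le_card_mul {M : ℝ} (hM : ∀ i, min (I.value i) (I.budget i) ≤ M) :
    optLiquidWelfare I.value I.budget ≤ n * M := by
  refine optLiquidWelfare_le fun x h0 h1 => ?_
  have : ∑ _i : Fin n, M = n * M := by simp
  rw [← this]
  refine sum_le_sum fun i _ => le_trans (min_le_min_right _ ?_) (hM i)
  exact mul_le_of_le_one_right (I.value_pos i).le
    ((single_le_sum (fun l _ => h0 l) (mem_univ i)).trans h1)

/-- Each member of `S` alone can pay her liquid value for the item. -/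
theorem liquid_le_clearingPrice {S : Finset (Fin n)} {l : Fin n} (hl : l ∈ S) :
    min (I.value l) (I.budget l) ≤ clearingPrice (I.types 1) S := by
  refine (clears_clearingPrice (I.types 1) S).le_of_le_weakDemand
    (fun i => (I.budget_pos _).le) ?_
  refine (min_le_right _ _).trans ?_
  exact single_le_sum (f := fun l => I.budget l) (fun i _ => (I.budget_pos i).le)
    (mem_filter.2 ⟨hl, min_le_left _ _⟩)

/-- A sample that holds a fraction of the weak demand at price `P` has a clearing price of at least
that fraction of `P`. -/
theorem mul_sum_le_clearingPrice {P : ℝ} (hP : 0 < P)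
    (hPW : P ≤ weakDemand I.value I.budget univ P) (S : Finset (Fin n)) :
    P * ∑ l ∈ S, (if P ≤ I.value l then I.budget l else 0) /
      weakDemand I.value I.budget univ P ≤ clearingPrice (I.types 1) S := by
  set W := weakDemand I.value I.budget univ P
  have hb : ∀ i, 0 ≤ I.budget i := fun i => (I.budget_pos i).le
  have hW : 0 < W := hP.trans_le hPW
  set D := weakDemand I.value I.budget S P with hD
  have hDW : D ≤ W := weakDemand_mono hb (subset_univ S)
  have hD0 : 0 ≤ D := weakDemand_nonneg hb
  rw [← sum_div, ← sum_filter]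
  change P * (D / W) ≤ _
  have hclear : Clears I.value I.budget S (clearingPrice (I.types 1) S) :=
    clears_clearingPrice (I.types 1) S
  have h1 : min P D ≤ clearingPrice (I.types 1) S := by
    refine hclear.le_of_le_weakDemand hb ((min_le_right _ _).trans ?_)
    refine sum_le_sum_of_subset_of_nonneg (fun l hl => ?_) fun i _ _ => hb i
    rw [mem_filter] at hl ⊢
    exact ⟨hl.1, (min_le_left _ _).trans hl.2⟩
  refine le_trans (le_min ?_ ?_) h1
  · exact mul_le_of_le_one_right hP.le ((div_le_one hW).2 hDW)
  · rw [mul_div_assoc', div_le_iff₀ hW, mul_comm]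
    exact mul_le_mul_of_nonneg_left hPW hD0

end Optimum

/-! ### Two agents in random places -/

/-- Two distinct agents in random order occupy each pair of distinct places equally often. -/
theorem sum_perm_pair {n : ℕ} {f : Fin n → Fin n → ℝ} (hf : ∀ a, f a a = 0) {x s : Fin n}
    (hxs : x ≠ s) :
    (n * (n - 1) : ℝ) * ∑ π : Equiv.Perm (Fin n), f (π.symm x) (π.symm s) =
      Fintype.card (Equiv.Perm (Fin n)) * ∑ a, ∑ b, f a b := by
  set c : Fin n → Fin n → ℝ := fun y t => ∑ π : Equiv.Perm (Fin n), f (π.symm y) (π.symm t)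
    with hc
  have hinv : ∀ (σ : Equiv.Perm (Fin n)) y t, c (σ y) (σ t) = c y t := by
    intro σ y t
    simp only [hc]
    rw [← Equiv.sum_comp (Equiv.mulLeft σ)]
    refine sum_congr rfl fun π _ => ?_
    congr 1 <;> simp [Equiv.Perm.mul_def]
  have hconst : ∀ y t, y ≠ t → c y t = c x s := by
    intro y t hyt
    set s' := Equiv.swap x y s with hs'
    have hys : s' ≠ y := by
      rw [hs']
      intro h
      have : s = x := by
        rw [← Equiv.swap_apply_right x y] at h
        simpa using congrArg (Equiv.swap x y) h
      exact hxs this.symm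
    have h := hinv (Equiv.swap s' t * Equiv.swap x y) x s
    rw [Equiv.Perm.mul_apply, Equiv.Perm.mul_apply, Equiv.swap_apply_left, ← hs',
      Equiv.swap_apply_left, Equiv.swap_apply_of_ne_of_ne hys.symm hyt] at h
    exact h
  have hdiag : ∀ y, c y y = 0 := fun y => sum_eq_zero fun π _ => hf _
  have h1 : ∑ y, ∑ t, c y t = n * (n - 1) * c x s := by
    have : ∀ y, ∑ t, c y t = (n - 1) * c x s := by
      intro y
      rw [← add_sum_erase _ _ (mem_univ y), hdiag, zero_add,
        sum_congr rfl fun t ht => hconst y t (ne_of_mem_erase ht).symm, sum_const,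
        card_erase_of_mem (mem_univ y), card_univ, Fintype.card_fin, nsmul_eq_mul,
        Nat.cast_sub (by have := y.2; omega), Nat.cast_one]
    simp only [this, sum_const, card_univ, Fintype.card_fin, nsmul_eq_mul]
    ring
  have h2 : ∑ y, ∑ t, c y t = Fintype.card (Equiv.Perm (Fin n)) * ∑ a, ∑ b, f a b := by
    simp only [hc]
    have : ∀ y, ∑ t, ∑ π : Equiv.Perm (Fin n), f (π.symm y) (π.symm t) =
        ∑ π : Equiv.Perm (Fin n), ∑ t, f (π.symm y) t := by
      intro y
      rw [sum_comm]
      exact sum_congr rfl fun π _ => Equiv.sum_comp π.symm fun t => f (π.symm y) t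
    simp only [this]
    rw [sum_comm]
    have : ∀ π : Equiv.Perm (Fin n), ∑ y, ∑ t, f (π.symm y) t = ∑ a, ∑ b, f a b :=
      fun π => Equiv.sum_comp π.symm fun a => ∑ b, f a b
    simp only [this, sum_const, card_univ, nsmul_eq_mul]
  rw [← h1, h2]

/-- A given agent arrives in the second half, and another given one in the first half, with
probability at least `1 / 4`. -/
theorem card_perm_le_sum_halves {n : ℕ} (hn : 2 ≤ n) {x s : Fin n} (hxs : x ≠ s) :
    (Fintype.card (Equiv.Perm (Fin n)) : ℝ) ≤ 4 * ∑ π : Equiv.Perm (Fin n),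
      if n / 2 ≤ (π.symm x : ℕ) ∧ (π.symm s : ℕ) < n / 2 then 1 else 0 := by
  have hf : ∀ a : Fin n, (if n / 2 ≤ (a : ℕ) ∧ (a : ℕ) < n / 2 then (1 : ℝ) else 0) = 0 :=
    fun a => if_neg fun h => absurd h.2 h.1.not_gt
  have h := sum_perm_pair (f := fun a b : Fin n =>
    if n / 2 ≤ (a : ℕ) ∧ (b : ℕ) < n / 2 then (1 : ℝ) else 0) hf hxs
  have hlow : ∑ b : Fin n, (if (b : ℕ) < n / 2 then (1 : ℝ) else 0) = (n / 2 : ℕ) := by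
    rw [Fin.sum_univ_eq_sum_range (fun b => if b < n / 2 then (1 : ℝ) else 0) n, sum_boole]
    congr 1
    rw [show (range n).filter (fun b => b < n / 2) = range (n / 2) by
      ext b; simp only [mem_filter, mem_range]; omega, card_range]
  have hup : ∑ a : Fin n, (if n / 2 ≤ (a : ℕ) then (1 : ℝ) else 0) = n - (n / 2 : ℕ) := by
    rw [eq_sub_iff_add_eq, ← hlow, ← sum_add_distrib]
    rw [sum_congr rfl fun a _ => show _ = (1 : ℝ) from ?_, sum_const, card_univ,
      Fintype.card_fin, nsmul_eq_mul, mul_one]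
    by_cases ha : n / 2 ≤ (a : ℕ)
    · rw [if_pos ha, if_neg ha.not_gt, add_zero]
    · rw [if_neg ha, if_pos (not_le.1 ha), zero_add]
  have hprod : ∑ a : Fin n, ∑ b : Fin n,
      (if n / 2 ≤ (a : ℕ) ∧ (b : ℕ) < n / 2 then (1 : ℝ) else 0) =
      (n - (n / 2 : ℕ)) * (n / 2 : ℕ) := by
    rw [← hup, ← hlow, sum_mul_sum]
    refine sum_congr rfl fun a _ => sum_congr rfl fun b _ => ?_
    split_ifs <;> simp_all
  rw [hprod] at h
  set N := (Fintype.card (Equiv.Perm (Fin n)) : ℝ)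
  have hN : 0 ≤ N := Nat.cast_nonneg _
  have hn' : (2 : ℝ) ≤ n := by exact_mod_cast hn
  -- `n - 1 ≤ 2 * (n / 2) ≤ n`
  have hh1 : (n : ℝ) - 1 ≤ 2 * (n / 2 : ℕ) := by
    rw [sub_le_iff_le_add]
    exact_mod_cast (by omega : n ≤ 2 * (n / 2) + 1)
  have hh2 : 2 * ((n / 2 : ℕ) : ℝ) ≤ n := by exact_mod_cast (by omega : 2 * (n / 2) ≤ n)
  have hh3 : (n * (n - 1) : ℝ) ≤ 4 * ((n - (n / 2 : ℕ)) * (n / 2 : ℕ)) := by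
    nlinarith [mul_nonneg (sub_nonneg.2 hh1) (sub_nonneg.2 hh2)]
  have hpos : (0 : ℝ) < n * (n - 1) := by nlinarith
  refine le_of_mul_le_mul_left ?_ hpos
  rw [mul_left_comm, h]
  nlinarith [mul_le_mul_of_nonneg_left hh3 hN]

/-! ### The welfare of `MVCG` if one agent dominates -/

section Dominant

variable {n : ℕ} [NeZero n] {I : Input n} {γ : ℝ} {x : Fin n}

/-- If the agent with the dominant pair arrives in the second half, and the best of the others in
the first half, then she is the only one to reach the threshold. -/
theorem le_liquidWelfare_mvcg (hγ : 1 < γ)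
    (hx : ∀ l, l ≠ x → γ * min (I.value l) (I.budget l) ≤ min (I.value x) (I.budget x))
    {s : Fin n} (hs : ∀ l, l ≠ x → min (I.value l) (I.budget l) ≤ min (I.value s) (I.budget s))
    {π : Equiv.Perm (Fin n)} (hπx : n / 2 ≤ (π.symm x : ℕ)) (hπs : (π.symm s : ℕ) < n / 2) :
    min (I.value x) (I.budget x) ≤ liquidWelfare (fun i => I.value (π i))
      (fun i => I.budget (π i)) fun i => (mvcgOutcome γ (I.types π) false i).amount := by
  set θ := I.types π with hθ
  have hmem : ∀ i, i ∈ firstAgents θ (n / 2) ↔ (i : ℕ) < n / 2 := by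
    intro i
    rw [hθ, firstAgents_types]
    simp
  have htop : IsTop (firstAgents θ (n / 2)) (fun l => (θ l).liquid)
      (kthLargest (firstAgents θ (n / 2)) (fun l => (θ l).liquid) 1) :=
    isTop_kthLargest_one fun i => liquid_nonneg _
  have hle : mvcgPrice γ θ 1 ≤ min (I.value x) (I.budget x) := by
    unfold mvcgPrice
    rcases htop.2.2 with h | ⟨l, hl, h⟩
    · rw [h, mul_zero]
      exact (liquid_pos I x).le
    · rw [← h]
      refine hx (π l) fun h' => ?_
      rw [hmem] at hl
      rw [← h', Equiv.symm_apply_apply] at hπx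
      omega
  have hlt : ∀ i, π i ≠ x → (θ i).liquid < mvcgPrice γ θ 1 := by
    intro i hi
    have h1 := htop.1 (π.symm s) ((hmem _).2 hπs)
    have h2 : (θ (π.symm s)).liquid = min (I.value s) (I.budget s) := by
      rw [hθ, types_liquid, Equiv.apply_symm_apply]
    have h3 : (θ i).liquid ≤ min (I.value s) (I.budget s) := hs (π i) hi
    have h4 : 0 < (θ i).liquid := liquid_pos I (π i)
    unfold mvcgPrice
    calc (θ i).liquid < γ * (θ i).liquid := lt_mul_of_one_lt_left h4 hγ
      _ ≤ _ := mul_le_mul_of_nonneg_left (h3.trans (h2 ▸ h1)) (by linarith)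
  have hamount : (mvcgOutcome γ θ false (π.symm x)).amount = 1 := by
    have : Surpasses γ θ (π.symm x) ∧
        ∀ l, place θ l < place θ (π.symm x) → ¬ Surpasses γ θ l := by
      refine ⟨⟨fun h => ?_, ?_⟩, fun l hl h => ?_⟩
      · rw [hmem] at h
        omega
      · rw [hθ, types_liquid, Equiv.apply_symm_apply]
        exact hle
      · refine absurd h.2 (hlt l fun h' => hl.ne ?_).not_ge
        rw [← h', Equiv.symm_apply_apply]
    unfold mvcgOutcome
    rw [if_neg Bool.false_ne_true, if_pos this]
  have hterm : min (I.value (π (π.symm x)) * (mvcgOutcome γ θ false (π.symm x)).amount)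
      (I.budget (π (π.symm x))) = min (I.value x) (I.budget x) := by
    rw [hamount, mul_one, Equiv.apply_symm_apply]
  rw [← hterm]
  unfold liquidWelfare
  exact single_le_sum (f := fun i => min (I.value (π i) * (mvcgOutcome γ θ false i).amount)
    (I.budget (π i))) (fun i _ => le_min (mul_nonneg (I.value_pos _).le
      ((mvcg_feasible γ θ false).1 i)) (I.budget_pos _).le) (mem_univ _)

/-- The factor `1 / 8` is `1 / 2` for tails, times `1 / 4` for the places of the two best agents. -/
theorem mvcg_expectedLiquidWelfare_ge (hn : 2 ≤ n) (hγ : 1 < γ)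
    (hx : ∀ l, l ≠ x → γ * min (I.value l) (I.budget l) ≤ min (I.value x) (I.budget x)) :
    min (I.value x) (I.budget x) / 8 ≤ (mvcg n γ).expectedLiquidWelfare I := by
  have : Nontrivial (Fin n) := Fin.nontrivial_iff_two_le.2 hn
  obtain ⟨y, hy⟩ := exists_ne x
  obtain ⟨s, hs, hmax⟩ := exists_max_image (univ.erase x)
    (fun l => min (I.value l) (I.budget l)) ⟨y, mem_erase.2 ⟨hy, mem_univ y⟩⟩
  have hcount := card_perm_le_sum_halves hn (ne_of_mem_erase hs).symm
  set N := (Fintype.card (Equiv.Perm (Fin n)) : ℝ) with hN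
  have hNpos : 0 < N := by
    rw [hN]
    exact_mod_cast Fintype.card_pos
  set M := min (I.value x) (I.budget x) with hM
  have hM0 : 0 < M := liquid_pos I x
  have hπ : ∀ π : Equiv.Perm (Fin n),
      (if n / 2 ≤ (π.symm x : ℕ) ∧ (π.symm s : ℕ) < n / 2 then 1 else 0) * (M / 2) ≤
      ∑ ω, (mvcg n γ).prob ω * liquidWelfare (fun i => I.value (π i)) (fun i => I.budget (π i))
        (fun i => ((mvcg n γ).outcome (I.types π) ω i).amount) := by
    intro π
    have hnonneg : ∀ ω : Bool, 0 ≤ (mvcg n γ).prob ω * liquidWelfare (fun i => I.value (π i))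
        (fun i => I.budget (π i)) (fun i => ((mvcg n γ).outcome (I.types π) ω i).amount) :=
      fun ω => mul_nonneg ((mvcg n γ).prob_nonneg ω)
        (liquidWelfare_nonneg I π (mvcg_feasible γ _ ω).1)
    split_ifs with h
    · have h1 := le_liquidWelfare_mvcg hγ hx (s := s)
        (fun l hl => hmax l (mem_erase.2 ⟨hl, mem_univ l⟩)) h.1 h.2
      refine le_trans ?_ (single_le_sum (fun ω _ => hnonneg ω) (mem_univ false))
      have h2 : (mvcg n γ).prob false = 1 / 2 := by
        simp [mvcg, uniformMechanism]
      rw [h2, one_mul, div_eq_mul_one_div, mul_comm]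
      exact mul_le_mul_of_nonneg_left h1 (by norm_num)
    · rw [zero_mul]
      exact sum_nonneg fun ω _ => hnonneg ω
  have hsum := sum_le_sum fun π (_ : π ∈ univ) => hπ π
  rw [← sum_mul] at hsum
  unfold Mechanism.expectedLiquidWelfare
  rw [← hN, inv_mul_eq_div, le_div_iff₀ hNpos]
  refine le_trans ?_ hsum
  nlinarith [mul_le_mul_of_nonneg_right hcount hM0.le]

end Dominant

section Ratio

variable {n : ℕ} (I : Input n)

/-! ### The welfare of `RS_Liquid` if no agent dominates -/

/-- Shares `w` and a price scale `ρ`, as `sum_guarantee_ge` needs them, unless the agent `x` with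
the highest liquid value dominates. The constants are a compromise between a highest liquid value
below `0.65` times the clearing price, where the shares are proportional to the budgets, and two
almost equal high liquid values, which get one half each; `0.3249` is a lower bound for both `0.35`
and `0.65 / (2 * 1.0001)`. -/
theorem exists_shares {x : Fin n}
    (hmax : ∀ l, min (I.value l) (I.budget l) ≤ min (I.value x) (I.budget x))
    (hdom : min (I.value x) (I.budget x) < 0.65 * clearingPrice (I.types 1) univ ∨
      ∃ y, y ≠ x ∧ min (I.value x) (I.budget x) < 1.0001 * min (I.value y) (I.budget y)) :
    ∃ (w : Fin n → ℝ) (ρ : ℝ), (∀ l, 0 ≤ w l) ∧ ∑ l, w l = 1 ∧ 0 ≤ ρ ∧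
      (∀ S, ρ * ∑ l ∈ S, w l ≤ clearingPrice (I.types 1) S) ∧
      0.3249 * clearingPrice (I.types 1) univ ≤ (1 - ∑ l, w l ^ 2) * ρ := by
  set P := clearingPrice (I.types 1) univ with hP
  have hPpos : 0 < P := (liquid_pos I x).trans_le (liquid_le_clearingPrice I (mem_univ x))
  by_cases hsmall : min (I.value x) (I.budget x) < 0.65 * P
  · have hPW : P ≤ weakDemand I.value I.budget univ P := (clears_clearingPrice (I.types 1) univ).2
    have hW : 0 < weakDemand I.value I.budget univ P := hPpos.trans_le hPW
    set w : Fin n → ℝ := fun l =>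
      (if P ≤ I.value l then I.budget l else 0) / weakDemand I.value I.budget univ P with hw
    have hw0 : ∀ l, 0 ≤ w l := by
      intro l
      refine div_nonneg ?_ hW.le
      split_ifs
      · exact (I.budget_pos l).le
      · exact le_rfl
    have hw1 : ∑ l, w l = 1 := by
      rw [hw, ← sum_div, ← sum_filter]
      exact div_self hW.ne'
    have hwle : ∀ l, w l ≤ 0.65 := by
      intro l
      simp only [hw]
      rw [div_le_iff₀ hW]
      refine le_trans ?_ (mul_le_mul_of_nonneg_left hPW (by norm_num))
      split_ifs with h
      · have h1 := (hmax l).trans hsmall.le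
        rcases min_le_iff.1 h1 with h2 | h2
        · linarith
        · exact h2
      · positivity
    refine ⟨w, P, hw0, hw1, hPpos.le, mul_sum_le_clearingPrice I hPpos hPW, ?_⟩
    have hsq : ∑ l, w l ^ 2 ≤ 0.65 := by
      calc ∑ l, w l ^ 2 ≤ ∑ l, 0.65 * w l := sum_le_sum fun l _ => by
            rw [sq]
            exact mul_le_mul_of_nonneg_right (hwle l) (hw0 l)
        _ = 0.65 := by rw [← mul_sum, hw1, mul_one]
    exact mul_le_mul_of_nonneg_right (by linarith) hPpos.le
  · obtain ⟨y, hyx, hy⟩ := hdom.resolve_left hsmall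
    rw [not_lt] at hsmall
    set w : Fin n → ℝ := fun l => (if l = x then 1 / 2 else 0) + if l = y then 1 / 2 else 0
      with hw
    have hw0 : ∀ l, 0 ≤ w l := fun l => by
      simp only [hw]
      split_ifs <;> norm_num
    have hw1 : ∑ l, w l = 1 := by
      rw [hw, sum_add_distrib, sum_ite_eq' univ x, sum_ite_eq' univ y, if_pos (mem_univ x),
        if_pos (mem_univ y)]
      norm_num
    have hsq : ∑ l, w l ^ 2 = 1 / 2 := by
      have : ∀ l, w l ^ 2 = 1 / 2 * w l := by
        intro l
        simp only [hw]
        by_cases h1 : l = x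
        · rw [if_pos h1, if_neg fun h2 => hyx (h2.symm.trans h1)]
          norm_num
        · rw [if_neg h1]
          split_ifs <;> norm_num
      simp only [this, ← mul_sum, hw1, mul_one]
    have hρ : 0 ≤ 0.65 * P / 1.0001 := by positivity
    refine ⟨w, 0.65 * P / 1.0001, hw0, hw1, hρ, fun S => ?_, ?_⟩
    · by_cases hS : ∃ l ∈ S, l = x ∨ l = y
      · obtain ⟨l, hl, hlxy⟩ := hS
        have h1 : ∑ l ∈ S, w l ≤ 1 :=
          (sum_le_univ_sum_of_nonneg hw0).trans_eq hw1
        refine (mul_le_of_le_one_right hρ h1).trans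
          (le_trans ?_ (liquid_le_clearingPrice I hl))
        rw [div_le_iff₀ (by norm_num)]
        have := liquid_pos I x
        rcases hlxy with rfl | rfl <;> linarith
      · have : ∑ l ∈ S, w l = 0 := by
          refine sum_eq_zero fun l hl => ?_
          simp only [hw]
          rw [if_neg fun h => hS ⟨l, hl, Or.inl h⟩, if_neg fun h => hS ⟨l, hl, Or.inr h⟩,
            add_zero]
        rw [this, mul_zero]
        exact clearingPrice_nonneg _ _
    · rw [hsq, mul_div_assoc', le_div_iff₀ (by norm_num)]
      linarith

theorem exp_neg_half_le : Real.exp (-(1 / 2)) ≤ 0.6066 := by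
  have h : Real.exp (-(1 / 2)) * Real.exp (-(1 / 2)) * Real.exp 1 = 1 := by
    rw [← Real.exp_add, ← Real.exp_add]
    norm_num
  have h1 := Real.exp_one_gt_d9
  have h2 := Real.exp_pos (-(1 / 2))
  by_contra! h3
  nlinarith [mul_lt_mul'' h3 h3 (by norm_num) (by norm_num)]

/-- The constant is a lower bound for `(1 - exp (-1 / 2)) / 128 * 0.3249`. -/
theorem rsLiquid_expectedLiquidWelfare_ge_clearingPrice [NeZero n] (hn : 2 ≤ n) {x : Fin n}
    (hmax : ∀ l, min (I.value l) (I.budget l) ≤ min (I.value x) (I.budget x))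
    (hdom : min (I.value x) (I.budget x) < 0.65 * clearingPrice (I.types 1) univ ∨
      ∃ y, y ≠ x ∧ min (I.value x) (I.budget x) < 1.0001 * min (I.value y) (I.budget y)) :
    0.00099 * (n - 2) * clearingPrice (I.types 1) univ ≤
      n * (rsLiquid n).expectedLiquidWelfare I := by
  obtain ⟨w, ρ, hw0, hw1, hρ, hS, hwρ⟩ := exists_shares I hmax hdom
  have h1 := (sum_guarantee_ge (I.types 1) hw0 hw1 hρ hS).trans
    (rsLiquid_expectedLiquidWelfare_ge I)
  rw [mul_right_comm (n : ℝ), mul_comm _ ((4 : ℝ) ^ n)] at h1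
  have h2 := le_of_mul_le_mul_left h1 (by positivity)
  refine le_trans ?_ h2
  have hP : 0 ≤ clearingPrice (I.types 1) univ := clearingPrice_nonneg _ _
  have hn' : (0 : ℝ) ≤ n - 2 := sub_nonneg.2 (by exact_mod_cast hn)
  calc 0.00099 * (n - 2) * clearingPrice (I.types 1) univ
      ≤ (1 - 0.6066) / 128 * (n - 2) * (0.3249 * clearingPrice (I.types 1) univ) := by
        nlinarith [mul_nonneg hn' hP]
    _ ≤ (1 - Real.exp (-(1 / 2))) / 128 * (n - 2) * ((1 - ∑ l, w l ^ 2) * ρ) := by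
        have := exp_neg_half_le
        refine mul_le_mul ?_ hwρ (by positivity) ?_
        · exact mul_le_mul_of_nonneg_right (by linarith) hn'
        · exact mul_nonneg (by linarith) hn'
    _ = (1 - Real.exp (-(1 / 2))) / 128 * ((n - 2) * (1 - ∑ l, w l ^ 2)) * ρ := by ring

/-! ### The ratio -/

/-- The first condition on the ratio serves the case of a dominant agent, where `MVCG` would allow
for a much better one, and the second one is what `RS_Liquid`, run with probability `0.9`, needs. -/
theorem liquidDiv_approximates [NeZero n] (hn : 2 ≤ n) {K : ℝ} (hK : 2443 ≤ K)
    (hKn : 2 * n ≤ 0.9 * 0.00099 * (n - 2) * K) :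
    (liquidDiv n (1 / 10) 1.0001 (by norm_num) (by norm_num)).Approximates K := by
  intro I
  obtain ⟨x, -, hmax⟩ := exists_max_image univ (fun l => min (I.value l) (I.budget l))
    ⟨0, mem_univ (0 : Fin n)⟩
  refine (optLiquidWelfare_le_two_mul_clearingPrice I).trans ?_
  set P := clearingPrice (I.types 1) univ with hP
  have hP0 : 0 ≤ P := clearingPrice_nonneg _ _
  unfold liquidDiv
  rw [expectedLiquidWelfare_mix]
  set EM := (mvcg n 1.0001).expectedLiquidWelfare I with hEM
  set ER := (rsLiquid n).expectedLiquidWelfare I with hER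
  have hEM0 : 0 ≤ EM := expectedLiquidWelfare_nonneg I (mvcg_feasible _)
  have hER0 : 0 ≤ ER := expectedLiquidWelfare_nonneg I rsLiquid_feasible
  have hn' : (2 : ℝ) ≤ n := by exact_mod_cast hn
  by_cases hdom : min (I.value x) (I.budget x) < 0.65 * P ∨
      ∃ y, y ≠ x ∧ min (I.value x) (I.budget x) < 1.0001 * min (I.value y) (I.budget y)
  · have h1 := rsLiquid_expectedLiquidWelfare_ge_clearingPrice I hn
      (fun l => hmax l (mem_univ l)) hdom
    have hnpos : (0 : ℝ) < n := by linarith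
    have h2 : n * (2 * P) ≤ n * (K * (9 / 10 * ER)) := by
      calc n * (2 * P) = 2 * n * P := by ring
        _ ≤ 0.9 * 0.00099 * (n - 2) * K * P := mul_le_mul_of_nonneg_right hKn hP0
        _ = 9 / 10 * K * (0.00099 * (n - 2) * P) := by ring
        _ ≤ 9 / 10 * K * (n * ER) := mul_le_mul_of_nonneg_left h1 (by linarith)
        _ = n * (K * (9 / 10 * ER)) := by ring
    refine (le_of_mul_le_mul_left h2 hnpos).trans
      (mul_le_mul_of_nonneg_left ?_ (by linarith))
    linarith
  · push Not at hdom
    have h1 := mvcg_expectedLiquidWelfare_ge (I := I) (γ := 1.0001) hn (by norm_num) hdom.2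
    have h2 : 2 * P ≤ 2443 * (1 / 10 * EM + (1 - 1 / 10) * ER) := by linarith [hdom.1]
    exact h2.trans (mul_le_mul_of_nonneg_right hK (by linarith))

theorem clearingPrice_empty (θ : Fin n → AgentType) : clearingPrice θ ∅ = 0 :=
  le_antisymm (clears_clearingPrice θ ∅).2 (clearingPrice_nonneg θ ∅)

/-- If no toss shows tails, then the first agent is the whole sample, and a quarter of the item is
hers for free. -/
theorem rsOutcome_amount_first [NeZero n] (π : Equiv.Perm (Fin n)) {ω : RSCoins n}
    (hω : ω.tails = 0) : (rsOutcome (I.types π) ω 0).amount = 1 / 4 := by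
  have hlast : lastAgent (I.types π) ω = 0 := by
    rw [lastAgent, agentAt_types]
    exact Fin.ext hω
  have hA : setA (I.types π) ω = {0} := by
    ext i
    rw [setA, firstAgents_types, hω, mem_filter, mem_singleton, Fin.ext_iff, Fin.val_zero]
    simp
  have hA₁ : setA₁ (I.types π) ω = ∅ := by
    rw [setA₁, hA, hlast]
    simp
  have hA₂ : setA₂ (I.types π) ω = {0} := by
    rw [setA₂, hA, hlast]
    simp
  have hmem : (0 : Fin n) ∈ setA (I.types π) ω := by simp [hA]
  rw [rsOutcome, if_pos hmem, if_pos (by rw [hlast]; exact (I.types π 0).arrival_le_departure)]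
  change allocA _ _ _ = _
  rw [allocA, hA₁, if_neg (notMem_empty _), hA₂, clearingPrice_empty]
  obtain ⟨k, -, hk1, hk2, hk⟩ := exists_left_divAlloc (I.types π) le_rfl
    (by norm_num : (0 : ℝ) ≤ 1 / 4) ω.order₂ (mem_singleton_self (0 : Fin n))
  have h := hk (I.types π 0)
  rw [Function.update_eq_self] at h
  rw [h, purchase, if_pos (I.types π 0).value_nonneg, if_pos rfl]
  refine le_antisymm hk1 (le_trans ?_ hk2)
  simp

/-- For each fixed number of agents there is some ratio. -/
theorem exists_liquidDiv_approximates (n : ℕ) [NeZero n] :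
    ∃ K, (liquidDiv n (1 / 10) 1.0001 (by norm_num) (by norm_num)).Approximates K := by
  set N := (Fintype.card (Equiv.Perm (Fin n)) : ℝ) with hN
  set R := (Fintype.card (RSCoins n) : ℝ) with hR
  have hNpos : 0 < N := by
    rw [hN]
    exact_mod_cast Fintype.card_pos
  have hRpos : 0 < R := by
    rw [hR]
    exact_mod_cast Fintype.card_pos
  refine ⟨n * (N * (R * 4) * (10 / 9)), fun I => ?_⟩
  obtain ⟨x, -, hmax⟩ := exists_max_image univ (fun l => min (I.value l) (I.budget l))
    ⟨0, mem_univ (0 : Fin n)⟩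
  refine (optLiquidWelfare_le_card_mul I fun l => hmax l (mem_univ l)).trans ?_
  rw [mul_assoc]
  refine mul_le_mul_of_nonneg_left ?_ (Nat.cast_nonneg n)
  unfold liquidDiv
  rw [expectedLiquidWelfare_mix]
  have hEM0 : 0 ≤ (mvcg n 1.0001).expectedLiquidWelfare I :=
    expectedLiquidWelfare_nonneg I (mvcg_feasible _)
  set M := min (I.value x) (I.budget x) with hM
  -- The agent with the highest liquid value comes first, and all coins show heads.
  set π : Equiv.Perm (Fin n) := Equiv.swap 0 x
  set ω : RSCoins n := (fun _ => true, fun _ => true, 1, 1, 1)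
  have hω : ω.tails = 0 := by simp [ω, RSCoins.tails]
  have hterm : M / 4 ≤ liquidWelfare (fun i => I.value (π i)) (fun i => I.budget (π i))
      fun i => (rsOutcome (I.types π) ω i).amount := by
    have hx : π 0 = x := Equiv.swap_apply_left _ _
    refine le_trans ?_ (single_le_sum (fun i _ => le_min (mul_nonneg (I.value_pos (π i)).le
      (rsOutcome_amount_nonneg (I.types π) ω i)) (I.budget_pos (π i)).le) (mem_univ 0))
    rw [rsOutcome_amount_first I π hω, hx, hM]
    have h1 := min_le_left (I.value x) (I.budget x)
    have h2 := min_le_right (I.value x) (I.budget x)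
    have h3 := liquid_pos I x
    exact le_min (by linarith) (by linarith)
  have hER : N⁻¹ * (R⁻¹ * (M / 4)) ≤ (rsLiquid n).expectedLiquidWelfare I := by
    unfold Mechanism.expectedLiquidWelfare
    refine mul_le_mul_of_nonneg_left ?_ (inv_nonneg.2 hNpos.le)
    have hnonneg : ∀ (π : Equiv.Perm (Fin n)) (ω : RSCoins n), 0 ≤ R⁻¹ *
        liquidWelfare (fun i => I.value (π i)) (fun i => I.budget (π i))
          fun i => (rsOutcome (I.types π) ω i).amount := fun π ω =>
      mul_nonneg (inv_nonneg.2 hRpos.le) (liquidWelfare_nonneg I π (rsOutcome_amount_nonneg _ _))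
    calc R⁻¹ * (M / 4)
        ≤ R⁻¹ * liquidWelfare (fun i => I.value (π i)) (fun i => I.budget (π i))
          (fun i => (rsOutcome (I.types π) ω i).amount) :=
          mul_le_mul_of_nonneg_left hterm (inv_nonneg.2 hRpos.le)
      _ ≤ ∑ ω : RSCoins n, R⁻¹ *
          liquidWelfare (fun i => I.value (π i)) (fun i => I.budget (π i))
          (fun i => (rsOutcome (I.types π) ω i).amount) :=
          single_le_sum (fun ω _ => hnonneg π ω) (mem_univ ω)
      _ ≤ _ := single_le_sum (f := fun π : Equiv.Perm (Fin n) => ∑ ω : RSCoins n, R⁻¹ *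
          liquidWelfare (fun i => I.value (π i)) (fun i => I.budget (π i))
          (fun i => (rsOutcome (I.types π) ω i).amount))
          (fun π _ => sum_nonneg fun ω _ => hnonneg π ω) (mem_univ π)
  have hfac : M = N * (R * 4) * (N⁻¹ * (R⁻¹ * (M / 4))) := by field_simp
  calc M = N * (R * 4) * (N⁻¹ * (R⁻¹ * (M / 4))) := hfac
    _ ≤ N * (R * 4) * (rsLiquid n).expectedLiquidWelfare I :=
        mul_le_mul_of_nonneg_left hER (by positivity)
    _ = N * (R * 4) * (10 / 9) * ((1 - 1 / 10) * (rsLiquid n).expectedLiquidWelfare I) := by ring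
    _ ≤ _ := mul_le_mul_of_nonneg_left (by linarith) (by positivity)

theorem Mechanism.Approximates.mono {M : Mechanism n} {K K' : ℝ} (h : M.Approximates K)
    (hM : M.Feasible) (hK : K ≤ K') : M.Approximates K' := fun I =>
  (h I).trans (mul_le_mul_of_nonneg_right hK (expectedLiquidWelfare_nonneg I hM))

end Ratio

theorem liquidDiv_feasible {n : ℕ} [NeZero n] {μ γ : ℝ} {h₀ : 0 ≤ μ} {h₁ : μ ≤ 1} :
    (liquidDiv n μ γ h₀ h₁).Feasible :=
  mix_feasible (mvcg_feasible γ) rsLiquid_feasible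

theorem liquidDiv_individuallyRational {n : ℕ} [NeZero n] {μ γ : ℝ} {h₀ : 0 ≤ μ} {h₁ : μ ≤ 1} :
    (liquidDiv n μ γ h₀ h₁).IndividuallyRational := by
  refine Mechanism.individuallyRational_of_forall ?_
  rintro θ i (ω | ω)
  · exact mvcgOutcome_utility_nonneg θ ω i
  · exact rsOutcome_utility_nonneg θ ω i

end

end BudgetedSecretary

theorem mainTheorem2 :
    (∀ (n : ℕ) [NeZero n] (μ γ : ℝ) (h₀ : 0 ≤ μ) (h₁ : μ ≤ 1), 1 < γ →
      (liquidDiv n μ γ h₀ h₁).Feasible ∧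
      (liquidDiv n μ γ h₀ h₁).IndividuallyRational ∧
      (liquidDiv n μ γ h₀ h₁).Truthful) ∧
    (∃ C : ℝ, ∀ (n : ℕ) [NeZero n],
      (liquidDiv n (1 / 10) 1.0001 (by norm_num) (by norm_num)).Approximates C) ∧
    (∀ (n : ℕ) [NeZero n], 100 ≤ n →
      (liquidDiv n (1 / 10) 1.0001 (by norm_num) (by norm_num)).Approximates 2443) := by
  refine ⟨fun n _ μ γ h₀ h₁ hγ => ⟨liquidDiv_feasible, liquidDiv_individuallyRational,
    ((mvcg_coupled hγ).mix rsLiquid_coupled).truthful⟩, ?_, fun n _ hn => ?_⟩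
  · obtain ⟨K₁, h₁⟩ := exists_liquidDiv_approximates 1
    obtain ⟨K₂, h₂⟩ := exists_liquidDiv_approximates 2
    refine ⟨max 7329 (max K₁ K₂), fun n _ => ?_⟩
    by_cases hn : 3 ≤ n
    · refine (liquidDiv_approximates (K := 7329) (by omega) (by norm_num) ?_).mono
        liquidDiv_feasible (le_max_left _ _)
      have : (3 : ℝ) ≤ n := by exact_mod_cast hn
      linarith
    · obtain rfl | rfl : n = 1 ∨ n = 2 := by
        have := NeZero.pos n
        omega
      · exact h₁.mono liquidDiv_feasible ((le_max_left _ _).trans (le_max_right _ _))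
      · exact h₂.mono liquidDiv_feasible ((le_max_right _ _).trans (le_max_right _ _))
  · refine liquidDiv_approximates (by omega) le_rfl ?_
    have : (100 : ℝ) ≤ n := by exact_mod_cast hn
    linarith
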